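/- Let $\Theta$ be a Schwartz function on $\mathbb R$ supported on $(-1,1)$ with $\Theta(\xi)=1$ for $|\xi|\le 1/2$, and let $\widehat\Phi(\xi)=\Theta(\xi/2)-\Theta(\xi)$. Let $\beta>1$ and $b_\beta=\lfloor 100\,\beta^{100}\rfloor$. For an integer $m\ge b_\beta$ and $\xi,\eta\in\mathbb R$ put $$\phi_{8,\xi,\eta}(t)=\xi t+\eta t^2-2^{-m-1}|t|^{-\beta},$$ and, whenever $\phi_{8,\xi,\eta}$ has a unique critical point in $[1/16,9/16]$, denote it by $t_0=t_0(\xi,\eta)$; let $E_{\beta,m}$ be the set of $(\xi,\eta)\in\mathbb R^2$ for which it exists. For an integer $j\ge 0$ define $$\tilde\Lambda_{j,\beta,m,8}(f_1,f_2,f_3)=\iint_{E_{\beta,m}} f_1(\xi)\,f_2(\eta)\,f_3\big(2^{-j}\xi+\eta\big)\,\widehat\Phi(\xi)\,\widehat\Phi(\eta)\,e^{i2^{\beta j+m+1}\phi_{8,\xi,\eta}(t_0(\xi,\eta))}\,d\xi\,d\eta .$$ Then there exist $\varepsilon_0>0$ and a constant $C_\beta$, both independent of $j$, $m$, $f_1,f_2,f_3$,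 such that for all integers $j\ge 0$, $m\ge b_\beta$, and all $f_1\in L^4(\mathbb R)$, $f_2,f_3\in L^2(\mathbb R)$, the integral converges absolutely and $$\big|\tilde\Lambda_{j,\beta,m,8}(f_1,f_2,f_3)\big|\le C_\beta\,2^{-\varepsilon_0(j+m)}\,\|f_1\|_4\,\|f_2\|_2\,\|f_3\|_2 .$$ -/

import Mathlib

open MeasureTheory Set
open scoped SchwartzMap

noncomputable section

/-- The large integer `b_β = [100 β ^ 100]`. -/
def bBeta (β : ℝ) : ℤ := ⌊100 * β ^ 100⌋

/-- `Θ` is a Schwartz function supported on `(-1, 1)` with `Θ(ξ) = 1` for `|ξ| ≤ 1/2`. -/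
structure IsCutoff (Θ : 𝓢(ℝ, ℂ)) : Prop where
  support_subset : Function.support Θ ⊆ Ioo (-1) 1
  eq_one : ∀ ξ : ℝ, |ξ| ≤ 1 / 2 → Θ ξ = 1

/-- The Littlewood-Paley bump `Φ̂(ξ) = Θ(ξ/2) - Θ(ξ)`. -/
def phiHat (Θ : 𝓢(ℝ, ℂ)) (ξ : ℝ) : ℂ := Θ (ξ / 2) - Θ ξ

/-- The phase `φ_{8,ξ,η}(t) = ξ t + η t² - 2^{-m-1} |t|^{-β}`. -/
def phase8 (β : ℝ) (m : ℤ) (ξ η t : ℝ) : ℝ :=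
  ξ * t + η * t ^ 2 - (2 : ℝ) ^ (-m - 1) * |t| ^ (-β)

/-- `φ_{8,ξ,η}` has a unique critical point in `[1/16, 9/16]`. -/
def HasCritPt (β : ℝ) (m : ℤ) (ξ η : ℝ) : Prop :=
  ∃! t : ℝ, t ∈ Icc (1 / 16 : ℝ) (9 / 16) ∧ deriv (phase8 β m ξ η) t = 0

open Classical in
/-- The critical point `t₀(ξ, η)` of `φ_{8,ξ,η}` in `[1/16, 9/16]`
(with the irrelevant value `0` when there is none). -/
def critPt (β : ℝ) (m : ℤ) (ξ η : ℝ) : ℝ :=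
  if h : HasCritPt β m ξ η then h.choose else 0

/-- The set of frequencies `(ξ, η)` at which `t₀(ξ, η)` exists. -/
def critRegion (β : ℝ) (m : ℤ) : Set (ℝ × ℝ) := {p | HasCritPt β m p.1 p.2}

/-- The integrand
`f₁(ξ) f₂(η) f₃(2^{-j} ξ + η) Φ̂(ξ) Φ̂(η) exp (i 2^{βj+m+1} φ_{8,ξ,η}(t₀(ξ, η)))`. -/
def integrand8 (Θ : 𝓢(ℝ, ℂ)) (β : ℝ) (j : ℕ) (m : ℤ) (f₁ f₂ f₃ : ℝ → ℂ) (p : ℝ × ℝ) : ℂ :=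
  f₁ p.1 * f₂ p.2 * f₃ ((2 : ℝ) ^ (-(j : ℤ)) * p.1 + p.2) * phiHat Θ p.1 * phiHat Θ p.2 *
    Complex.exp (Complex.I *
      (((2 : ℝ) ^ (β * j + m + 1) * phase8 β m p.1 p.2 (critPt β m p.1 p.2) : ℝ) : ℂ))

/-- The trilinear oscillatory form: the integral of `integrand8` over all `(ξ, η)` at which
the critical point `t₀(ξ, η)` exists. -/
def trilinearForm8 (Θ : 𝓢(ℝ, ℂ)) (β : ℝ) (j : ℕ) (m : ℤ) (f₁ f₂ f₃ : ℝ → ℂ) : ℂ :=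
  ∫ p in critRegion β m, integrand8 Θ β j m f₁ f₂ f₃ p

end

open Filter Topology ComplexConjugate

/-! Write s = 2^{-j}, |λ| = 2^{βj+m+1}, and T for the critical point. For each sign of η the form
has kernel exp(iλΨ(ξ,η)) cut off to a bounded convex set, where Ψ is the critical value
(`critKernel_eq`); negative η is reduced to positive η by (ξ,η) ↦ -(ξ,η), λ ↦ -λ. Since m ≥ b_β, the
term 2^{-m-1}|t|^{-β} is a tiny perturbation w of ξt + ηt², with four small derivatives
(`exists_smallPhase`). The gradient of Ψ is (T, T²), because the t-derivative vanishes at T.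

Cauchy-Schwarz in η removes f₂; for each shift τ of ξ, Cauchy-Schwarz in ξ removes f₁. What remains
is an integral in ξ of four kernel values at the corners of a rectangle with sides τ and u - u',
translated along (1,-s), the direction in which sξ + η is constant. The ξ-derivative of its phase is
a second difference of T - sT², of size about |τ||u - u'| |1 - 4sT|. The first derivative test gives
decay 1/(|λ||τ||u - u'|) where 1 - 4sT is bounded below (`norm_quarticCorrelation_le`).
Interpolation with the trivial bound gives |λ|^{-p}(|τ||u - u'|)^{-p} with p < 1, which is locally
integrable; Schur's test in (u,u') and Cauchy-Schwarz in τ finish the estimate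
(`norm_trilinear_pow_four_le`). The loss is s⁻¹ = 2^j and the gain is |λ|^{-p}; as β > 1, some p < 1
has pβ > 1, and this yields decay in both j and m.

For j ≥ 2 the factor 1 - 4sT is at least 7/16. For j = 0, 1 it can vanish, but only near the line η
+ 2sξ = 0. A strip of width δ = 2^{-m/8} around that line is removed and bounded by its small width
(`trilinearBound_strip`); the two remaining pieces are convex (`trilinearBound_with_strip`). All
this is done for bounded functions of bounded support and extended by truncation
(`TrilinearBound.norm_le`). -/

/-! ### Mean values, second differences and the first derivative test. -/

/-- Mean value theorem without an ordering assumption on the endpoints. -/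
lemma exists_uIcc_mean_value {f f' : ℝ → ℝ} {a b : ℝ}
    (h : ∀ x ∈ uIcc a b, HasDerivAt f (f' x) x) :
    ∃ c ∈ uIcc a b, f b - f a = (b - a) * f' c := by
  have key : ∀ a b : ℝ, a < b → (∀ x ∈ Icc a b, HasDerivAt f (f' x) x) →
      ∃ c ∈ Icc a b, f b - f a = (b - a) * f' c := by
    intro a b hab h
    obtain ⟨c, hc, hc'⟩ := exists_hasDerivAt_eq_slope f f' hab
      (fun x hx => (h x hx).continuousAt.continuousWithinAt)
      (fun x hx => h x (Ioo_subset_Icc_self hx))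
    refine ⟨c, Ioo_subset_Icc_self hc, ?_⟩
    rw [hc']
    field_simp [(sub_pos.2 hab).ne']
  rcases lt_trichotomy a b with hab | hab | hab
  · rw [uIcc_of_le hab.le] at h ⊢
    exact key a b hab h
  · subst hab
    exact ⟨a, left_mem_uIcc, by ring⟩
  · rw [uIcc_of_ge hab.le] at h ⊢
    obtain ⟨c, hc, hc'⟩ := key b a hab h
    exact ⟨c, hc, by linarith⟩

/-- The second difference over a rectangle is the area times a value of the mixed derivative. -/
lemma exists_second_difference_eq {f fx fxy : ℝ → ℝ → ℝ} {x₁ x₂ y₁ y₂ : ℝ}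
    (h₁ : ∀ x ∈ uIcc x₁ x₂, ∀ y ∈ uIcc y₁ y₂, HasDerivAt (fun x => f x y) (fx x y) x)
    (h₂ : ∀ x ∈ uIcc x₁ x₂, ∀ y ∈ uIcc y₁ y₂, HasDerivAt (fun y => fx x y) (fxy x y) y) :
    ∃ x ∈ uIcc x₁ x₂, ∃ y ∈ uIcc y₁ y₂,
      f x₂ y₂ - f x₁ y₂ - f x₂ y₁ + f x₁ y₁ = (x₂ - x₁) * (y₂ - y₁) * fxy x y := by
  obtain ⟨x, hx, hx'⟩ := exists_uIcc_mean_value (f := fun x => f x y₂ - f x y₁)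
    (f' := fun x => fx x y₂ - fx x y₁)
    (fun x hx => (h₁ x hx y₂ right_mem_uIcc).sub (h₁ x hx y₁ left_mem_uIcc))
  obtain ⟨y, hy, hy'⟩ := exists_uIcc_mean_value (h₂ x hx)
  refine ⟨x, hx, y, hy, ?_⟩
  rw [mul_assoc, ← hy']
  linarith

/-- First derivative test of van der Corput, with a bound for the second derivative. -/
lemma norm_integral_exp_le_of_deriv_ge {θ θ₁ θ₂ : ℝ → ℝ} {a b c M lam : ℝ} (hab : a ≤ b)
    (hc : 0 < c) (hlam : lam ≠ 0)
    (h₁ : ∀ x ∈ Icc a b, HasDerivAt θ (θ₁ x) x)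
    (h₂ : ∀ x ∈ Icc a b, HasDerivAt θ₁ (θ₂ x) x)
    (hcont : ContinuousOn θ₂ (Icc a b))
    (hlow : ∀ x ∈ Icc a b, c ≤ |θ₁ x|) (hup : ∀ x ∈ Icc a b, |θ₂ x| ≤ M) :
    ‖∫ x in a..b, Complex.exp (Complex.I * ((lam * θ x : ℝ) : ℂ))‖
      ≤ (2 / c + M * (b - a) / c ^ 2) / |lam| := by
  have hne : ∀ x ∈ Icc a b, θ₁ x ≠ 0 := fun x hx h0 => by
    have := hlow x hx; rw [h0, abs_zero] at this; linarith
  set e : ℝ → ℂ := fun x => Complex.exp (Complex.I * ((lam * θ x : ℝ) : ℂ)) with he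
  set u : ℝ → ℂ := fun x => (((θ₁ x)⁻¹ : ℝ) : ℂ) with hu
  set u' : ℝ → ℂ := fun x => ((-(θ₂ x) / (θ₁ x) ^ 2 : ℝ) : ℂ) with hu'
  have he1 : ∀ x, ‖e x‖ = 1 := fun x => by
    rw [he]; simp only; rw [mul_comm]; exact Complex.norm_exp_ofReal_mul_I _
  have hde : ∀ x ∈ Icc a b, HasDerivAt e (Complex.I * ((lam * θ₁ x : ℝ) : ℂ) * e x) x := by
    intro x hx
    have h := (((h₁ x hx).const_mul lam).ofReal_comp.const_mul Complex.I).cexp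
    rw [mul_comm] at h
    exact h
  have hdu : ∀ x ∈ Icc a b, HasDerivAt u (u' x) x := fun x hx =>
    ((h₂ x hx).inv (hne x hx)).ofReal_comp
  have hcθ : ContinuousOn θ (Icc a b) := fun x hx => (h₁ x hx).continuousAt.continuousWithinAt
  have hcθ₁ : ContinuousOn θ₁ (Icc a b) :=
    fun x hx => (h₂ x hx).continuousAt.continuousWithinAt
  have hce : ContinuousOn e (Icc a b) := fun x hx => (hde x hx).continuousAt.continuousWithinAt
  have hcu' : ContinuousOn u' (Icc a b) := by
    refine Complex.continuous_ofReal.comp_continuousOn ?_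
    exact hcont.neg.div (hcθ₁.pow 2) (fun x hx => pow_ne_zero 2 (hne x hx))
  have hcde : ContinuousOn (fun x => Complex.I * ((lam * θ₁ x : ℝ) : ℂ) * e x) (Icc a b) := by
    refine ContinuousOn.mul (continuousOn_const.mul ?_) hce
    exact Complex.continuous_ofReal.comp_continuousOn (continuousOn_const.mul hcθ₁)
  -- Integration by parts in (1/θ')·(θ' e^{iλθ}) gains 1/λ; the bound on θ'' replaces the usual
  -- monotonicity of θ'.
  have hparts := intervalIntegral.integral_mul_deriv_eq_deriv_mul (a := a) (b := b)
    (u := u) (v := e) (u' := u') (v' := fun x => Complex.I * ((lam * θ₁ x : ℝ) : ℂ) * e x)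
    (by rwa [uIcc_of_le hab]) (by rwa [uIcc_of_le hab])
    (by apply ContinuousOn.intervalIntegrable; rwa [uIcc_of_le hab])
    (by apply ContinuousOn.intervalIntegrable; rwa [uIcc_of_le hab])
  have hleft : ∫ x in a..b, u x * (Complex.I * ((lam * θ₁ x : ℝ) : ℂ) * e x)
      = (Complex.I * (lam : ℂ)) * ∫ x in a..b, e x := by
    rw [← intervalIntegral.integral_const_mul]
    refine intervalIntegral.integral_congr (fun x hx => ?_)
    rw [uIcc_of_le hab] at hx
    have : (θ₁ x : ℂ) ≠ 0 := by exact_mod_cast hne x hx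
    simp only [hu, Complex.ofReal_mul, Complex.ofReal_inv]
    field_simp
  rw [hleft] at hparts
  have hun : ∀ x ∈ Icc a b, ‖u x‖ ≤ 1 / c := fun x hx => by
    rw [hu]; simp only [Complex.norm_real, norm_inv, Real.norm_eq_abs]
    rw [← one_div]
    exact one_div_le_one_div_of_le hc (hlow x hx)
  have hu'n : ∀ x ∈ Icc a b, ‖u' x * e x‖ ≤ M / c ^ 2 := fun x hx => by
    rw [norm_mul, he1, mul_one, hu']
    simp only [Complex.norm_real, norm_div, norm_neg, norm_pow, Real.norm_eq_abs]
    have := hlow x hx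
    have hM : 0 ≤ M := (abs_nonneg _).trans (hup x hx)
    gcongr
    exact hup x hx
  have hint : ‖∫ x in a..b, u' x * e x‖ ≤ M / c ^ 2 * |b - a| :=
    intervalIntegral.norm_integral_le_of_norm_le_const (fun x hx => by
      rw [uIoc_of_le hab] at hx
      exact hu'n x (Ioc_subset_Icc_self hx))
  have hA : |lam| * ‖∫ x in a..b, e x‖ ≤ 1 / c + 1 / c + M / c ^ 2 * |b - a| := by
    have : |lam| * ‖∫ x in a..b, e x‖ = ‖(Complex.I * (lam : ℂ)) * ∫ x in a..b, e x‖ := by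
      rw [norm_mul, norm_mul, Complex.norm_I, one_mul, Complex.norm_real, Real.norm_eq_abs]
    rw [this, hparts]
    refine (norm_sub_le _ _).trans (add_le_add ((norm_sub_le _ _).trans (add_le_add ?_ ?_)) hint)
    · rw [norm_mul, he1, mul_one]; exact hun b (right_mem_Icc.2 hab)
    · rw [norm_mul, he1, mul_one]; exact hun a (left_mem_Icc.2 hab)
  rw [abs_of_nonneg (sub_nonneg.2 hab)] at hA
  rw [le_div_iff₀ (abs_pos.2 hlam)]
  calc _ = |lam| * ‖∫ x in a..b, e x‖ := mul_comm _ _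
    _ ≤ _ := hA
    _ = _ := by ring

/-! ### Small perturbations of the quadratic phase and the critical root. -/

/-- A perturbation `w` of the quadratic phase with four small derivatives on `(1/32, 1)`. -/
structure SmallPhase (ε : ℝ) (w w₁ w₂ w₃ w₄ : ℝ → ℝ) : Prop where
  measurable : Measurable w
  eps_le : ε ≤ 1 / 1000
  deriv₀ : ∀ t ∈ Ioo (1 / 32 : ℝ) 1, HasDerivAt w (w₁ t) t
  deriv₁ : ∀ t ∈ Ioo (1 / 32 : ℝ) 1, HasDerivAt w₁ (w₂ t) t
  deriv₂ : ∀ t ∈ Ioo (1 / 32 : ℝ) 1, HasDerivAt w₂ (w₃ t) t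
  deriv₃ : ∀ t ∈ Ioo (1 / 32 : ℝ) 1, HasDerivAt w₃ (w₄ t) t
  bound₁ : ∀ t ∈ Ioo (1 / 32 : ℝ) 1, |w₁ t| ≤ ε
  bound₂ : ∀ t ∈ Ioo (1 / 32 : ℝ) 1, |w₂ t| ≤ ε
  bound₃ : ∀ t ∈ Ioo (1 / 32 : ℝ) 1, |w₃ t| ≤ ε
  bound₄ : ∀ t ∈ Ioo (1 / 32 : ℝ) 1, |w₄ t| ≤ ε

/-- Projection of the line to `[1/20, 7/10]`. -/
noncomputable def clampT (t : ℝ) : ℝ := max (1 / 20) (min t (7 / 10))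

lemma clampT_mem (t : ℝ) : clampT t ∈ Icc (1 / 20 : ℝ) (7 / 10) :=
  ⟨le_max_left _ _, max_le (by norm_num) (min_le_right _ _)⟩

lemma clampT_eq {t : ℝ} (ht : t ∈ Icc (1 / 20 : ℝ) (7 / 10)) : clampT t = t := by
  rw [clampT, min_eq_left ht.2, max_eq_right ht.1]

lemma continuous_clampT : Continuous clampT := by unfold clampT; fun_prop

lemma abs_clampT_sub_le (a b : ℝ) : |clampT a - clampT b| ≤ |a - b| := by
  unfold clampT
  rcases le_total a b with h | h
  · have h1 : max (1 / 20) (min a (7 / 10)) ≤ max (1 / 20) (min b (7 / 10 : ℝ)) := by gcongr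
    rw [abs_of_nonpos (by linarith), abs_of_nonpos (by linarith)]
    rcases max_cases (1 / 20) (min a (7 / 10 : ℝ)) with h2 | h2 <;>
    rcases max_cases (1 / 20) (min b (7 / 10 : ℝ)) with h3 | h3 <;>
    rcases min_cases a (7 / 10 : ℝ) with h4 | h4 <;>
    rcases min_cases b (7 / 10 : ℝ) with h5 | h5 <;> linarith
  · have h1 : max (1 / 20) (min b (7 / 10)) ≤ max (1 / 20) (min a (7 / 10 : ℝ)) := by gcongr
    rw [abs_of_nonneg (by linarith), abs_of_nonneg (by linarith)]
    rcases max_cases (1 / 20) (min a (7 / 10 : ℝ)) with h2 | h2 <;>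
    rcases max_cases (1 / 20) (min b (7 / 10 : ℝ)) with h3 | h3 <;>
    rcases min_cases a (7 / 10 : ℝ) with h4 | h4 <;>
    rcases min_cases b (7 / 10 : ℝ) with h5 | h5 <;> linarith

lemma Icc_clamp_subset : Icc (1 / 20 : ℝ) (7 / 10) ⊆ Ioo (1 / 32 : ℝ) 1 :=
  fun _ h => ⟨by linarith [h.1], by linarith [h.2]⟩

lemma max_three_eighths_pos (η : ℝ) : (3 / 8 : ℝ) ≤ max η (3 / 8) := le_max_right _ _

/-- The root `t` of `ξ + 2 η t + w₁ t = 0`, extended to all `(ξ, η)` by freezing `w₁` outside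
`[1/20, 7/10]` and `η` below `3/8`. -/
noncomputable def critRoot (w₁ : ℝ → ℝ) (ξ η : ℝ) : ℝ :=
  Function.invFun (fun t => 2 * max η (3 / 8) * t + w₁ (clampT t)) (-ξ)

namespace SmallPhase

variable {ε : ℝ} {w w₁ w₂ w₃ w₄ : ℝ → ℝ}

lemma eps_nonneg (h : SmallPhase ε w w₁ w₂ w₃ w₄) : 0 ≤ ε :=
  (abs_nonneg _).trans (h.bound₁ (1 / 2) ⟨by norm_num, by norm_num⟩)

lemma lipschitz_clamp (h : SmallPhase ε w w₁ w₂ w₃ w₄) (a b : ℝ) :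
    |w₁ (clampT a) - w₁ (clampT b)| ≤ ε * |a - b| := by
  have hsub : uIcc (clampT b) (clampT a) ⊆ Ioo (1 / 32 : ℝ) 1 :=
    ((ordConnected_Icc.uIcc_subset (clampT_mem b) (clampT_mem a))).trans Icc_clamp_subset
  obtain ⟨c, hc, hc'⟩ := exists_uIcc_mean_value (fun x hx => h.deriv₁ x (hsub hx))
  rw [hc', abs_mul, mul_comm]
  have := abs_clampT_sub_le a b
  exact mul_le_mul (h.bound₂ c (hsub hc)) this (abs_nonneg _) h.eps_nonneg

lemma continuous_clamp (h : SmallPhase ε w w₁ w₂ w₃ w₄) :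
    Continuous (fun t => w₁ (clampT t)) := by
  refine ContinuousOn.comp_continuous (s := Ioo (1 / 32 : ℝ) 1)
    (fun x hx => (h.deriv₁ x hx).continuousAt.continuousWithinAt) continuous_clampT
    (fun x => Icc_clamp_subset (clampT_mem x))

/-- The linear slope is at least 3/4 and dominates the Lipschitz constant ε of the frozen `w₁`. -/
lemma strictMono_aux (h : SmallPhase ε w w₁ w₂ w₃ w₄) (η : ℝ) :
    StrictMono (fun t => 2 * max η (3 / 8) * t + w₁ (clampT t)) := by
  intro a b hab
  have h1 := abs_le.1 (h.lipschitz_clamp b a)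
  have h2 := max_three_eighths_pos η
  have h3 := h.eps_le
  rw [abs_of_pos (sub_pos.2 hab)] at h1
  simp only
  nlinarith [h1.1, sub_pos.2 hab]

lemma surjective_aux (h : SmallPhase ε w w₁ w₂ w₃ w₄) (η : ℝ) :
    Function.Surjective (fun t => 2 * max η (3 / 8) * t + w₁ (clampT t)) := by
  have h2 := max_three_eighths_pos η
  refine Continuous.surjective ((continuous_const.mul continuous_id).add h.continuous_clamp) ?_ ?_
  · refine tendsto_atTop_add_right_of_le atTop (-ε)
      (tendsto_id.const_mul_atTop (by linarith)) (fun t => ?_)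
    exact (abs_le.1 (h.bound₁ _ (Icc_clamp_subset (clampT_mem t)))).1
  · refine tendsto_atBot_add_right_of_ge atBot ε
      (tendsto_id.const_mul_atBot (by linarith)) (fun t => ?_)
    exact (abs_le.1 (h.bound₁ _ (Icc_clamp_subset (clampT_mem t)))).2

lemma critRoot_spec (h : SmallPhase ε w w₁ w₂ w₃ w₄) (ξ η : ℝ) :
    2 * max η (3 / 8) * critRoot w₁ ξ η + w₁ (clampT (critRoot w₁ ξ η)) = -ξ :=
  Function.rightInverse_invFun (h.surjective_aux η) (-ξ)

lemma critRoot_eq (h : SmallPhase ε w w₁ w₂ w₃ w₄) {ξ η t : ℝ} (hη : 3 / 8 ≤ η)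
    (ht : t ∈ Icc (1 / 20 : ℝ) (7 / 10)) (h0 : ξ + 2 * η * t + w₁ t = 0) :
    critRoot w₁ ξ η = t := by
  refine (h.strictMono_aux η).injective ?_
  have hs := h.critRoot_spec ξ η
  rw [max_eq_left hη] at hs
  simp only [clampT_eq ht, max_eq_left hη]
  linarith

lemma critRoot_zero (h : SmallPhase ε w w₁ w₂ w₃ w₄) {ξ η : ℝ} (hη : 3 / 8 ≤ η)
    (ht : critRoot w₁ ξ η ∈ Icc (1 / 20 : ℝ) (7 / 10)) :
    ξ + 2 * η * critRoot w₁ ξ η + w₁ (critRoot w₁ ξ η) = 0 := by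
  have := h.critRoot_spec ξ η
  rw [clampT_eq ht, max_eq_left hη] at this
  linarith

/-- By monotonicity, comparing the root with a fixed t is a linear condition on (ξ,η). Convexity of
the critical domain rests on this. -/
lemma le_critRoot_iff (h : SmallPhase ε w w₁ w₂ w₃ w₄) {ξ η t : ℝ} (hη : 3 / 8 ≤ η)
    (ht : t ∈ Icc (1 / 20 : ℝ) (7 / 10)) :
    t ≤ critRoot w₁ ξ η ↔ ξ + 2 * η * t + w₁ t ≤ 0 := by
  rw [← (h.strictMono_aux η).le_iff_le]
  have hs := h.critRoot_spec ξ η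
  rw [max_eq_left hη] at hs
  simp only [clampT_eq ht, max_eq_left hη]
  constructor <;> intro <;> linarith

lemma critRoot_le_iff (h : SmallPhase ε w w₁ w₂ w₃ w₄) {ξ η t : ℝ} (hη : 3 / 8 ≤ η)
    (ht : t ∈ Icc (1 / 20 : ℝ) (7 / 10)) :
    critRoot w₁ ξ η ≤ t ↔ 0 ≤ ξ + 2 * η * t + w₁ t := by
  rw [← (h.strictMono_aux η).le_iff_le]
  have hs := h.critRoot_spec ξ η
  rw [max_eq_left hη] at hs
  simp only [clampT_eq ht, max_eq_left hη]
  constructor <;> intro <;> linarith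

/-- Subtract the two root equations and absorb the `w₁` term; the factor 2 is available because 3/4
- ε ≥ 1/2. -/
lemma abs_critRoot_sub_le (h : SmallPhase ε w w₁ w₂ w₃ w₄) (ξ η ξ' η' : ℝ) :
    |critRoot w₁ ξ η - critRoot w₁ ξ' η'| ≤
      2 * (|ξ - ξ'| + 2 * |critRoot w₁ ξ' η'| * |max η (3 / 8) - max η' (3 / 8)|) := by
  have h1 := h.critRoot_spec ξ η
  have h2 := h.critRoot_spec ξ' η'
  set T := critRoot w₁ ξ η
  set T' := critRoot w₁ ξ' η'
  have hL := h.lipschitz_clamp T T'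
  have he := max_three_eighths_pos η
  set e := max η (3 / 8)
  set e' := max η' (3 / 8)
  have hkey : 2 * e * (T - T') = -(ξ - ξ') - 2 * T' * (e - e') -
      (w₁ (clampT T) - w₁ (clampT T')) := by linarith
  have h3 : 2 * e * |T - T'| ≤ |ξ - ξ'| + 2 * |T'| * |e - e'| + ε * |T - T'| := by
    calc 2 * e * |T - T'| = |2 * e * (T - T')| := by
          rw [abs_mul, abs_of_pos (by linarith : 0 < 2 * e)]
      _ ≤ |-(ξ - ξ')| + |2 * T' * (e - e')| + |w₁ (clampT T) - w₁ (clampT T')| := by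
          rw [hkey]
          exact (abs_sub _ _).trans (add_le_add_left (abs_sub _ _) _)
      _ ≤ _ := by
          rw [abs_neg, abs_mul, abs_mul, abs_two]
          linarith
  have h4 := h.eps_le
  nlinarith [abs_nonneg (T - T')]

lemma continuous_critRoot (h : SmallPhase ε w w₁ w₂ w₃ w₄) :
    Continuous (fun p : ℝ × ℝ => critRoot w₁ p.1 p.2) := by
  rw [continuous_iff_continuousAt]
  intro p
  rw [ContinuousAt, tendsto_iff_norm_sub_tendsto_zero]
  refine squeeze_zero (fun _ => norm_nonneg _)
    (fun x => h.abs_critRoot_sub_le x.1 x.2 p.1 p.2) ?_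
  have : Continuous (fun x : ℝ × ℝ => 2 * (|x.1 - p.1| +
      2 * |critRoot w₁ p.1 p.2| * |max x.2 (3 / 8) - max p.2 (3 / 8)|)) := by fun_prop
  have := this.tendsto p
  simpa using this

/-- The derivative of the root along a curve. -/
lemma hasDerivAt_critRoot (h : SmallPhase ε w w₁ w₂ w₃ w₄) {X Y : ℝ → ℝ} {a b x₀ : ℝ}
    (hX : HasDerivAt X a x₀) (hY : HasDerivAt Y b x₀)
    (hT : critRoot w₁ (X x₀) (Y x₀) ∈ Ioo (1 / 20 : ℝ) (7 / 10)) (hη : 3 / 8 < Y x₀) :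
    HasDerivAt (fun x => critRoot w₁ (X x) (Y x))
      (-(a + 2 * critRoot w₁ (X x₀) (Y x₀) * b) /
        (2 * Y x₀ + w₂ (critRoot w₁ (X x₀) (Y x₀)))) x₀ := by
  set T : ℝ → ℝ := fun x => critRoot w₁ (X x) (Y x) with hTdef
  change HasDerivAt T (-(a + 2 * T x₀ * b) / (2 * Y x₀ + w₂ (T x₀))) x₀
  have hTc : ContinuousAt T x₀ :=
    h.continuous_critRoot.continuousAt.comp (f := fun x => (X x, Y x))
      (hX.continuousAt.prodMk hY.continuousAt)
  have hJ : T x₀ ∈ Ioo (1 / 32 : ℝ) 1 := Icc_clamp_subset (Ioo_subset_Icc_self hT)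
  have hw := h.deriv₁ _ hJ
  -- `dslope` takes the value of the derivative on the diagonal, so the limit survives points where
  -- T x = T x₀.
  have hds : Tendsto (fun x => dslope w₁ (T x₀) (T x)) (𝓝 x₀) (𝓝 (w₂ (T x₀))) := by
    have h1 : ContinuousAt (dslope w₁ (T x₀)) (T x₀) :=
      continuousAt_dslope_same.2 hw.differentiableAt
    have h2 := h1.tendsto.comp hTc.tendsto
    rwa [dslope_same, hw.deriv] at h2
  have hden : 0 < 2 * Y x₀ + w₂ (T x₀) := by
    have := (abs_le.1 (h.bound₂ _ hJ)).1
    have := h.eps_le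
    linarith
  have hdent : Tendsto (fun x => 2 * Y x + dslope w₁ (T x₀) (T x)) (𝓝 x₀)
      (𝓝 (2 * Y x₀ + w₂ (T x₀))) := (hY.continuousAt.tendsto.const_mul 2).add hds
  rw [hasDerivAt_iff_tendsto_slope] at hX hY ⊢
  have hlim : Tendsto (fun x => -(slope X x₀ x + 2 * T x₀ * slope Y x₀ x) /
      (2 * Y x + dslope w₁ (T x₀) (T x))) (𝓝[≠] x₀)
      (𝓝 (-(a + 2 * T x₀ * b) / (2 * Y x₀ + w₂ (T x₀)))) :=
    (hX.add (hY.const_mul _)).neg.div (hdent.mono_left nhdsWithin_le_nhds) hden.ne'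
  refine hlim.congr' ?_
  have e1 : ∀ᶠ x in 𝓝 x₀, T x ∈ Ioo (1 / 20 : ℝ) (7 / 10) := hTc (isOpen_Ioo.mem_nhds hT)
  have hYc : ContinuousAt Y x₀ := (hasDerivAt_iff_tendsto_slope.2 hY).continuousAt
  have e2 : ∀ᶠ x in 𝓝 x₀, 3 / 8 < Y x := hYc (isOpen_Ioi.mem_nhds hη)
  have e3 : ∀ᶠ x in 𝓝 x₀, 0 < 2 * Y x + dslope w₁ (T x₀) (T x) :=
    hdent (isOpen_Ioi.mem_nhds hden)
  filter_upwards [e1.filter_mono nhdsWithin_le_nhds, e2.filter_mono nhdsWithin_le_nhds,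
    e3.filter_mono nhdsWithin_le_nhds, self_mem_nhdsWithin] with x h1 h2 h3 h4
  -- Subtracting the two root equations and dividing by x - x₀ gives the slope of T exactly.
  have z0 : X x₀ + 2 * Y x₀ * T x₀ + w₁ (T x₀) = 0 :=
    h.critRoot_zero hη.le (Ioo_subset_Icc_self hT)
  have z1 : X x + 2 * Y x * T x + w₁ (T x) = 0 := h.critRoot_zero h2.le (Ioo_subset_Icc_self h1)
  have hsl := sub_smul_dslope w₁ (T x₀) (T x)
  rw [smul_eq_mul] at hsl
  have hx : x - x₀ ≠ 0 := sub_ne_zero.2 h4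
  rw [slope_def_field, slope_def_field, slope_def_field, div_eq_div_iff h3.ne' hx]
  field_simp
  linarith

end SmallPhase

/-! ### The critical value and its derivatives along lines. -/

/-- The critical value `ξ t + η t² + w t` at the critical root `t`. -/
noncomputable def critPhase (w w₁ : ℝ → ℝ) (ξ η : ℝ) : ℝ :=
  ξ * critRoot w₁ ξ η + η * critRoot w₁ ξ η ^ 2 + w (critRoot w₁ ξ η)

/-- The kernel `exp (i λ Ψ)` cut off to the set `D`. -/
noncomputable def phaseKernel (w w₁ : ℝ → ℝ) (D : Set (ℝ × ℝ)) (lam : ℝ) (p : ℝ × ℝ) : ℂ :=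
  D.indicator (fun p => Complex.exp (Complex.I * ((lam * critPhase w w₁ p.1 p.2 : ℝ) : ℂ))) p

/-- Pairs `(ξ, η)` with `1/2 ≤ η ≤ 2` whose critical root lies in `[1/16, 9/16]`. -/
def critDomain (w₁ : ℝ → ℝ) : Set (ℝ × ℝ) :=
  {p | p.2 ∈ Icc (1 / 2 : ℝ) 2 ∧ critRoot w₁ p.1 p.2 ∈ Icc (1 / 16 : ℝ) (9 / 16)}

/-- Keeps the intermediate point of `exists_second_difference_eq` in the domain when only the
corners are known to lie there. -/
lemma Convex.rectangle_mem {D : Set (ℝ × ℝ)} (hD : Convex ℝ D) {x₁ x₂ y₁ y₂ x y : ℝ}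
    (h₁₁ : (x₁, y₁) ∈ D) (h₁₂ : (x₁, y₂) ∈ D) (h₂₁ : (x₂, y₁) ∈ D) (h₂₂ : (x₂, y₂) ∈ D)
    (hx : x ∈ uIcc x₁ x₂) (hy : y ∈ uIcc y₁ y₂) : (x, y) ∈ D := by
  rw [← segment_eq_uIcc] at hx hy
  obtain ⟨a, b, ha, hb, hab, rfl⟩ := hx
  obtain ⟨c, d, hc, hd, hcd, rfl⟩ := hy
  have e1 : (a • x₁ + b • x₂, y₁) ∈ D := by
    convert hD h₁₁ h₂₁ ha hb hab using 1
    ext <;> simp [← add_mul, hab]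
  have e2 : (a • x₁ + b • x₂, y₂) ∈ D := by
    convert hD h₁₂ h₂₂ ha hb hab using 1
    ext <;> simp [← add_mul, hab]
  convert hD e1 e2 hc hd hcd using 1
  ext <;> simp [← add_mul, hcd]

lemma abs_mul_le_mul {a b A B : ℝ} (ha : |a| ≤ A) (hb : |b| ≤ B) : |a * b| ≤ A * B := by
  rw [abs_mul]
  exact mul_le_mul ha hb (abs_nonneg _) ((abs_nonneg _).trans ha)

namespace SmallPhase

variable {ε : ℝ} {w w₁ w₂ w₃ w₄ : ℝ → ℝ}

lemma mem_Ioo_of_mem {p : ℝ × ℝ} (hp : p ∈ critDomain w₁) :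
    critRoot w₁ p.1 p.2 ∈ Ioo (1 / 20 : ℝ) (7 / 10) :=
  ⟨by linarith [hp.2.1], by linarith [hp.2.2]⟩

lemma mem_dom_of_mem {p : ℝ × ℝ} (hp : p ∈ critDomain w₁) :
    critRoot w₁ p.1 p.2 ∈ Ioo (1 / 32 : ℝ) 1 :=
  Icc_clamp_subset (Ioo_subset_Icc_self (mem_Ioo_of_mem hp))

lemma hessian_mem (h : SmallPhase ε w w₁ w₂ w₃ w₄) {p : ℝ × ℝ} (hp : p ∈ critDomain w₁) :
    2 * p.2 + w₂ (critRoot w₁ p.1 p.2) ∈ Icc (999 / 1000 : ℝ) (4001 / 1000) := by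
  have h1 := abs_le.1 (h.bound₂ _ (mem_dom_of_mem hp))
  have h2 := h.eps_le
  have h3 := hp.1
  exact ⟨by linarith [h1.1, h3.1], by linarith [h1.2, h3.2]⟩

lemma critRoot_zero' (h : SmallPhase ε w w₁ w₂ w₃ w₄) {p : ℝ × ℝ} (hp : p ∈ critDomain w₁) :
    p.1 + 2 * p.2 * critRoot w₁ p.1 p.2 + w₁ (critRoot w₁ p.1 p.2) = 0 :=
  h.critRoot_zero (by linarith [hp.1.1]) (Ioo_subset_Icc_self (mem_Ioo_of_mem hp))

/-- The critical equation gives ξ ≈ -2ηT with 2ηT ≤ 9/4, so ξ is bounded without any cutoff in ξ. -/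
lemma fst_mem (h : SmallPhase ε w w₁ w₂ w₃ w₄) {p : ℝ × ℝ} (hp : p ∈ critDomain w₁) :
    p.1 ∈ Icc (-3 : ℝ) 0 := by
  have h1 := abs_le.1 (h.bound₁ _ (mem_dom_of_mem hp))
  have h2 := h.eps_le
  have h3 := h.critRoot_zero' hp
  obtain ⟨⟨a, b⟩, c, d⟩ := hp
  constructor <;> nlinarith

section curve

variable {X Y : ℝ → ℝ} {a b x₀ s : ℝ}

lemma hasDerivAt_root (h : SmallPhase ε w w₁ w₂ w₃ w₄)
    (hX : HasDerivAt X a x₀) (hY : HasDerivAt Y b x₀) (hp : (X x₀, Y x₀) ∈ critDomain w₁) :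
    HasDerivAt (fun x => critRoot w₁ (X x) (Y x))
      (-(a + 2 * critRoot w₁ (X x₀) (Y x₀) * b) /
        (2 * Y x₀ + w₂ (critRoot w₁ (X x₀) (Y x₀)))) x₀ :=
  h.hasDerivAt_critRoot hX hY (mem_Ioo_of_mem hp) (by linarith [hp.1.1])

/-- Envelope identity: the derivative of the root is multiplied by the critical equation and drops
out, leaving only the explicit dependence on ξ and η. -/
lemma hasDerivAt_critPhase (h : SmallPhase ε w w₁ w₂ w₃ w₄)
    (hX : HasDerivAt X a x₀) (hY : HasDerivAt Y b x₀) (hp : (X x₀, Y x₀) ∈ critDomain w₁) :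
    HasDerivAt (fun x => critPhase w w₁ (X x) (Y x))
      (a * critRoot w₁ (X x₀) (Y x₀) + b * critRoot w₁ (X x₀) (Y x₀) ^ 2) x₀ := by
  have hT := h.hasDerivAt_root hX hY hp
  have h0 := h.critRoot_zero' hp
  have hw := (h.deriv₀ _ (mem_dom_of_mem hp)).comp x₀ hT
  refine (((hX.mul hT).add (hY.mul (hT.pow 2))).add hw).congr_deriv ?_
  simp only [Pi.pow_apply] at h0 ⊢
  push_cast
  linear_combination (-(a + 2 * critRoot w₁ (X x₀) (Y x₀) * b) /
        (2 * Y x₀ + w₂ (critRoot w₁ (X x₀) (Y x₀)))) * h0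

lemma hasDerivAt_hessian (h : SmallPhase ε w w₁ w₂ w₃ w₄)
    (hX : HasDerivAt X a x₀) (hY : HasDerivAt Y b x₀) (hp : (X x₀, Y x₀) ∈ critDomain w₁) :
    HasDerivAt (fun x => 2 * Y x + w₂ (critRoot w₁ (X x) (Y x)))
      (2 * b + w₃ (critRoot w₁ (X x₀) (Y x₀)) * (-(a + 2 * critRoot w₁ (X x₀) (Y x₀) * b) /
        (2 * Y x₀ + w₂ (critRoot w₁ (X x₀) (Y x₀))))) x₀ :=
  (hY.const_mul 2).add ((h.deriv₂ _ (mem_dom_of_mem hp)).comp x₀ (h.hasDerivAt_root hX hY hp))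

lemma hasDerivAt_slopeFactor (h : SmallPhase ε w w₁ w₂ w₃ w₄)
    (hX : HasDerivAt X a x₀) (hY : HasDerivAt Y b x₀) (hp : (X x₀, Y x₀) ∈ critDomain w₁) :
    HasDerivAt (fun x => 1 - 2 * s * critRoot w₁ (X x) (Y x))
      (2 * s * (a + 2 * critRoot w₁ (X x₀) (Y x₀) * b) /
        (2 * Y x₀ + w₂ (critRoot w₁ (X x₀) (Y x₀)))) x₀ := by
  refine (((h.hasDerivAt_root hX hY hp).const_mul (2 * s)).const_sub 1).congr_deriv ?_
  ring

lemma hasDerivAt_lineDeriv (h : SmallPhase ε w w₁ w₂ w₃ w₄)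
    (hX : HasDerivAt X a x₀) (hY : HasDerivAt Y b x₀) (hp : (X x₀, Y x₀) ∈ critDomain w₁) :
    HasDerivAt (fun x => critRoot w₁ (X x) (Y x) - s * critRoot w₁ (X x) (Y x) ^ 2)
      (-(1 - 2 * s * critRoot w₁ (X x₀) (Y x₀)) * (a + 2 * critRoot w₁ (X x₀) (Y x₀) * b) /
        (2 * Y x₀ + w₂ (critRoot w₁ (X x₀) (Y x₀)))) x₀ := by
  have hT := h.hasDerivAt_root hX hY hp
  refine (hT.sub ((hT.pow 2).const_mul s)).congr_deriv ?_
  push_cast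
  ring

end curve

/-- The derivative of the critical phase along `(1, -s)`. -/
noncomputable def lineDerivPhase (w₁ : ℝ → ℝ) (s ξ η : ℝ) : ℝ :=
  critRoot w₁ ξ η - s * critRoot w₁ ξ η ^ 2

/-- Minus the second derivative of the critical phase along `(1, -s)`. -/
noncomputable def lineDeriv2Phase (w₁ w₂ : ℝ → ℝ) (s ξ η : ℝ) : ℝ :=
  (1 - 2 * s * critRoot w₁ ξ η) ^ 2 / (2 * η + w₂ (critRoot w₁ ξ η))

lemma continuousAt_lineDeriv2Phase (h : SmallPhase ε w w₁ w₂ w₃ w₄) {X Y : ℝ → ℝ} {a b x₀ s : ℝ}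
    (hX : HasDerivAt X a x₀) (hY : HasDerivAt Y b x₀) (hp : (X x₀, Y x₀) ∈ critDomain w₁) :
    ContinuousAt (fun x => lineDeriv2Phase w₁ w₂ s (X x) (Y x)) x₀ := by
  have hH := (h.hessian_mem hp).1
  exact (((h.hasDerivAt_slopeFactor (s := s) hX hY hp).pow 2).div (h.hasDerivAt_hessian hX hY hp)
    (by simp only at hH ⊢; linarith)).continuousAt

/-- Lower bound for the second differences of `lineDerivPhase`. -/
lemma abs_second_difference_lineDeriv_ge (h : SmallPhase ε w w₁ w₂ w₃ w₄) {D : Set (ℝ × ℝ)}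
    (hconv : Convex ℝ D) (hsub : D ⊆ critDomain w₁) {s δ : ℝ} (hs : 0 < s) (hs1 : s ≤ 1)
    (hδ : ∀ p ∈ D, δ ≤ |1 - 4 * s * critRoot w₁ p.1 p.2|) (hδε : 100 * ε ≤ δ)
    {x₁ x₂ y₁ y₂ : ℝ} (h₁₁ : (x₁, y₁) ∈ D) (h₁₂ : (x₁, y₂) ∈ D) (h₂₁ : (x₂, y₁) ∈ D)
    (h₂₂ : (x₂, y₂) ∈ D) :
    δ / 10 * (|x₂ - x₁| * |y₂ - y₁|) ≤
      |lineDerivPhase w₁ s x₂ y₂ - lineDerivPhase w₁ s x₁ y₂ - lineDerivPhase w₁ s x₂ y₁ +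
        lineDerivPhase w₁ s x₁ y₁| := by
  have hmem : ∀ x ∈ uIcc x₁ x₂, ∀ y ∈ uIcc y₁ y₂, (x, y) ∈ D := fun x hx y hy =>
    hconv.rectangle_mem h₁₁ h₁₂ h₂₁ h₂₂ hx hy
  obtain ⟨x, hx, y, hy, hxy⟩ := exists_second_difference_eq (f := lineDerivPhase w₁ s)
    (fx := fun ξ η => -(1 - 2 * s * critRoot w₁ ξ η) / (2 * η + w₂ (critRoot w₁ ξ η)))
    (fxy := fun ξ η => 2 / (2 * η + w₂ (critRoot w₁ ξ η)) ^ 2 * (1 - 4 * s * critRoot w₁ ξ η -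
      (1 - 2 * s * critRoot w₁ ξ η) * critRoot w₁ ξ η * w₃ (critRoot w₁ ξ η) /
        (2 * η + w₂ (critRoot w₁ ξ η))))
    (x₁ := x₁) (x₂ := x₂) (y₁ := y₁) (y₂ := y₂)
    (fun x hx y hy => by
      have := h.hasDerivAt_lineDeriv (s := s) (hasDerivAt_id x) (hasDerivAt_const x y)
        (hsub (hmem x hx y hy))
      refine this.congr_deriv ?_
      simp)
    (fun x hx y hy => by
      have hH := (h.hessian_mem (hsub (hmem x hx y hy))).1
      have := (h.hasDerivAt_slopeFactor (s := s) (hasDerivAt_const y x) (hasDerivAt_id y)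
        (hsub (hmem x hx y hy))).neg.div (h.hasDerivAt_hessian (hasDerivAt_const y x)
          (hasDerivAt_id y) (hsub (hmem x hx y hy))) (by simp only [id] at hH ⊢; linarith)
      refine this.congr_deriv ?_
      simp only [id, zero_add, mul_one, Pi.neg_apply] at hH ⊢
      have hH0 : 2 * y + w₂ (critRoot w₁ x y) ≠ 0 := by linarith
      field_simp
      ring)
  rw [hxy, abs_mul, abs_mul, mul_comm]
  refine mul_le_mul_of_nonneg_left ?_ (by positivity)
  have hp := hsub (hmem x hx y hy)
  have hH := h.hessian_mem hp
  have h3 := h.bound₃ _ (mem_dom_of_mem hp)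
  have hd := hδ _ (hmem x hx y hy)
  have hT := hp.2
  simp only at hH h3 hd hT ⊢
  set T := critRoot w₁ x y
  set H := 2 * y + w₂ T
  have hε := h.eps_nonneg
  have hHpos : 0 < H := by linarith [hH.1]
  have hsT : |1 - 2 * s * T| ≤ 1 := by
    rw [abs_le]; constructor <;> nlinarith [hT.1, hT.2]
  have hT1 : |T| ≤ 9 / 16 := by rw [abs_le]; constructor <;> linarith [hT.1, hT.2]
  -- The `w₃` correction to the main term 1 - 4sT is at most ε ≤ δ/100; this is the role of 100ε ≤
  -- δ.
  have herr : |(1 - 2 * s * T) * T * w₃ T / H| ≤ ε := by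
    rw [abs_div, abs_of_pos hHpos, div_le_iff₀ hHpos]
    have := abs_mul_le_mul (abs_mul_le_mul hsT hT1) h3
    nlinarith [hH.1]
  rw [abs_mul, abs_of_pos (by positivity : 0 < 2 / H ^ 2)]
  have h5 : 99 / 100 * δ ≤ |1 - 4 * s * T - (1 - 2 * s * T) * T * w₃ T / H| := by
    have := abs_sub_abs_le_abs_sub (1 - 4 * s * T) ((1 - 2 * s * T) * T * w₃ T / H)
    linarith
  -- From H ≤ 4.001; then 0.12 · 0.99 exceeds 1/10.
  have h6 : (12 / 100 : ℝ) ≤ 2 / H ^ 2 := by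
    rw [le_div_iff₀ (by positivity)]
    nlinarith [hH.1, hH.2]
  have hδ0 : 0 ≤ δ := by linarith
  calc δ / 10 ≤ 12 / 100 * (99 / 100 * δ) := by linarith
    _ ≤ _ := mul_le_mul h6 h5 (by positivity) (by positivity)

/-- Upper bound for the second differences of `lineDeriv2Phase`. -/
lemma abs_second_difference_lineDeriv2_le (h : SmallPhase ε w w₁ w₂ w₃ w₄) {D : Set (ℝ × ℝ)}
    (hconv : Convex ℝ D) (hsub : D ⊆ critDomain w₁) {s : ℝ} (hs : 0 < s) (hs1 : s ≤ 1)
    {x₁ x₂ y₁ y₂ : ℝ} (h₁₁ : (x₁, y₁) ∈ D) (h₁₂ : (x₁, y₂) ∈ D) (h₂₁ : (x₂, y₁) ∈ D)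
    (h₂₂ : (x₂, y₂) ∈ D) :
    |lineDeriv2Phase w₁ w₂ s x₂ y₂ - lineDeriv2Phase w₁ w₂ s x₁ y₂ -
        lineDeriv2Phase w₁ w₂ s x₂ y₁ + lineDeriv2Phase w₁ w₂ s x₁ y₁| ≤
      40 * (|x₂ - x₁| * |y₂ - y₁|) := by
  have hmem : ∀ x ∈ uIcc x₁ x₂, ∀ y ∈ uIcc y₁ y₂, (x, y) ∈ D := fun x hx y hy =>
    hconv.rectangle_mem h₁₁ h₁₂ h₂₁ h₂₂ hx hy
  obtain ⟨x, hx, y, hy, hxy⟩ := exists_second_difference_eq (f := lineDeriv2Phase w₁ w₂ s)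
    (fx := fun ξ η => 4 * s * (1 - 2 * s * critRoot w₁ ξ η) /
        (2 * η + w₂ (critRoot w₁ ξ η)) ^ 2 +
      (1 - 2 * s * critRoot w₁ ξ η) ^ 2 * w₃ (critRoot w₁ ξ η) /
        (2 * η + w₂ (critRoot w₁ ξ η)) ^ 3)
    -- Expanded as a polynomial in H⁻¹, so that each of the five terms can be bounded factor by
    -- factor.
    (fxy := fun ξ η =>
      4 * s * (4 * s * critRoot w₁ ξ η * (2 * η + w₂ (critRoot w₁ ξ η))⁻¹) *
        (2 * η + w₂ (critRoot w₁ ξ η))⁻¹ ^ 2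
      - 8 * s * (1 - 2 * s * critRoot w₁ ξ η) *
        (2 - 2 * w₃ (critRoot w₁ ξ η) * critRoot w₁ ξ η * (2 * η + w₂ (critRoot w₁ ξ η))⁻¹) *
        (2 * η + w₂ (critRoot w₁ ξ η))⁻¹ ^ 3
      + 2 * (1 - 2 * s * critRoot w₁ ξ η) *
        (4 * s * critRoot w₁ ξ η * (2 * η + w₂ (critRoot w₁ ξ η))⁻¹) *
        w₃ (critRoot w₁ ξ η) * (2 * η + w₂ (critRoot w₁ ξ η))⁻¹ ^ 3
      - 2 * (1 - 2 * s * critRoot w₁ ξ η) ^ 2 * w₄ (critRoot w₁ ξ η) * critRoot w₁ ξ η *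
        (2 * η + w₂ (critRoot w₁ ξ η))⁻¹ ^ 4
      - 3 * (1 - 2 * s * critRoot w₁ ξ η) ^ 2 * w₃ (critRoot w₁ ξ η) *
        (2 - 2 * w₃ (critRoot w₁ ξ η) * critRoot w₁ ξ η * (2 * η + w₂ (critRoot w₁ ξ η))⁻¹) *
        (2 * η + w₂ (critRoot w₁ ξ η))⁻¹ ^ 4)
    (x₁ := x₁) (x₂ := x₂) (y₁ := y₁) (y₂ := y₂)
    (fun x hx y hy => by
      have hH := (h.hessian_mem (hsub (hmem x hx y hy))).1
      have := ((h.hasDerivAt_slopeFactor (s := s) (hasDerivAt_id x) (hasDerivAt_const x y)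
        (hsub (hmem x hx y hy))).pow 2).div (h.hasDerivAt_hessian (hasDerivAt_id x)
          (hasDerivAt_const x y) (hsub (hmem x hx y hy))) (by simp only [id] at hH ⊢; linarith)
      refine this.congr_deriv ?_
      simp only [id, mul_zero, zero_add, add_zero, mul_one, Pi.pow_apply] at hH ⊢
      have hH0 : 2 * y + w₂ (critRoot w₁ x y) ≠ 0 := by linarith
      push_cast
      field_simp
      ring)
    (fun x hx y hy => by
      have hp := hsub (hmem x hx y hy)
      have hH := (h.hessian_mem hp).1
      have hA := h.hasDerivAt_slopeFactor (s := s) (hasDerivAt_const y x) (hasDerivAt_id y) hp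
      have hB := h.hasDerivAt_hessian (hasDerivAt_const y x) (hasDerivAt_id y) hp
      have hW := (h.deriv₃ _ (mem_dom_of_mem hp)).comp y
        (h.hasDerivAt_root (hasDerivAt_const y x) (hasDerivAt_id y) hp)
      have hH0 : 2 * y + w₂ (critRoot w₁ x y) ≠ 0 := by simp only at hH; linarith
      have := ((hA.const_mul (4 * s)).div (hB.pow 2) (pow_ne_zero 2 hH0)).add
        (((hA.pow 2).mul hW).div (hB.pow 3) (pow_ne_zero 3 hH0))
      refine this.congr_deriv ?_
      simp only [id, zero_add, mul_one, Function.comp, Pi.pow_apply, Pi.mul_apply]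
      push_cast
      field_simp
      ring)
  rw [hxy, abs_mul, abs_mul, mul_comm (40 : ℝ)]
  refine mul_le_mul_of_nonneg_left ?_ (by positivity)
  have hp := hsub (hmem x hx y hy)
  have hH := h.hessian_mem hp
  have h3 := h.bound₃ _ (mem_dom_of_mem hp)
  have h4 := h.bound₄ _ (mem_dom_of_mem hp)
  have hT := hp.2
  have hε1 := h.eps_le
  simp only at hH h3 h4 hT ⊢
  set T := critRoot w₁ x y
  set H := 2 * y + w₂ T
  have hHpos : 0 < H := by linarith [hH.1]
  have hI : |H⁻¹| ≤ 101 / 100 := by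
    rw [abs_inv, abs_of_pos hHpos, inv_le_comm₀ hHpos (by norm_num)]
    linarith [hH.1]
  generalize H⁻¹ = I at *
  have h3' : |w₃ T| ≤ 1 / 1000 := h3.trans hε1
  have h4' : |w₄ T| ≤ 1 / 1000 := h4.trans hε1
  generalize w₃ T = W at *
  generalize w₄ T = V at *
  have hA : |1 - 2 * s * T| ≤ 1 := by
    rw [abs_le]; constructor <;> nlinarith [hT.1, hT.2]
  have hT1 : |T| ≤ 9 / 16 := by rw [abs_le]; constructor <;> linarith [hT.1, hT.2]
  have hs' : |s| ≤ 1 := by rwa [abs_of_pos hs]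
  generalize 1 - 2 * s * T = A at *
  have hpow : ∀ n : ℕ, |I ^ n| ≤ (101 / 100) ^ n := fun n => by
    rw [abs_pow]; exact pow_le_pow_left₀ (abs_nonneg _) hI n
  have hA2 : |A ^ 2| ≤ 1 := by rw [abs_pow]; exact pow_le_one₀ (abs_nonneg _) hA
  have n2 : |(2 : ℝ)| ≤ 2 := by norm_num
  have n3 : |(3 : ℝ)| ≤ 3 := by norm_num
  have n4 : |(4 : ℝ)| ≤ 4 := by norm_num
  have n8 : |(8 : ℝ)| ≤ 8 := by norm_num
  have hAy := abs_mul_le_mul (abs_mul_le_mul (abs_mul_le_mul n4 hs') hT1) hI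
  have hHy : |2 - 2 * W * T * I| ≤ 201 / 100 := by
    refine (abs_sub _ _).trans ?_
    have := abs_mul_le_mul (abs_mul_le_mul (abs_mul_le_mul n2 h3') hT1) hI
    rw [abs_two]
    linarith
  have t1 := abs_mul_le_mul (abs_mul_le_mul (abs_mul_le_mul n4 hs') hAy) (hpow 2)
  have t2 := abs_mul_le_mul (abs_mul_le_mul (abs_mul_le_mul (abs_mul_le_mul n8 hs') hA) hHy)
    (hpow 3)
  have t3 := abs_mul_le_mul (abs_mul_le_mul (abs_mul_le_mul (abs_mul_le_mul n2 hA) hAy) h3')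
    (hpow 3)
  have t4 := abs_mul_le_mul (abs_mul_le_mul (abs_mul_le_mul (abs_mul_le_mul n2 hA2) h4') hT1)
    (hpow 4)
  have t5 := abs_mul_le_mul (abs_mul_le_mul (abs_mul_le_mul (abs_mul_le_mul n3 hA2) h3') hHy)
    (hpow 4)
  rw [abs_le] at t1 t2 t3 t4 t5 ⊢
  norm_num at t1 t2 t3 t4 t5
  constructor <;> linarith [t1.1, t1.2, t2.1, t2.2, t3.1, t3.2, t4.1, t4.2, t5.1, t5.2]

end SmallPhase

/-! ### Decay of the fourfold correlations. -/

namespace SmallPhase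

variable {ε : ℝ} {w w₁ w₂ w₃ w₄ : ℝ → ℝ}

lemma norm_phaseKernel_le (D : Set (ℝ × ℝ)) (lam : ℝ) (p : ℝ × ℝ) :
    ‖phaseKernel w w₁ D lam p‖ ≤ 1 := by
  unfold phaseKernel
  refine (norm_indicator_le_norm_self _ _).trans ?_
  rw [mul_comm, Complex.norm_exp_ofReal_mul_I]

lemma measurable_phaseKernel (h : SmallPhase ε w w₁ w₂ w₃ w₄) {D : Set (ℝ × ℝ)}
    (hD : MeasurableSet D) (lam : ℝ) : Measurable (phaseKernel w w₁ D lam) := by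
  refine Measurable.indicator ?_ hD
  have h1 : Measurable (fun p : ℝ × ℝ => critRoot w₁ p.1 p.2) := h.continuous_critRoot.measurable
  have h2 : Measurable (fun p : ℝ × ℝ => w (critRoot w₁ p.1 p.2)) := h.measurable.comp h1
  have h3 : Measurable (fun p : ℝ × ℝ => lam * critPhase w w₁ p.1 p.2) :=
    (((measurable_fst.mul h1).add (measurable_snd.mul (h1.pow_const 2))).add h2).const_mul lam
  exact Complex.measurable_exp.comp ((Complex.measurable_ofReal.comp h3).const_mul Complex.I)

lemma phaseKernel_mul_eq {D : Set (ℝ × ℝ)} {lam : ℝ} {a b c d : ℝ × ℝ} (ha : a ∈ D) (hb : b ∈ D)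
    (hc : c ∈ D) (hd : d ∈ D) :
    phaseKernel w w₁ D lam a * conj (phaseKernel w w₁ D lam b) *
      conj (phaseKernel w w₁ D lam c * conj (phaseKernel w w₁ D lam d)) =
    Complex.exp (Complex.I * ((lam * (critPhase w w₁ a.1 a.2 - critPhase w w₁ b.1 b.2 -
      critPhase w w₁ c.1 c.2 + critPhase w w₁ d.1 d.2) : ℝ) : ℂ)) := by
  unfold phaseKernel
  rw [indicator_of_mem ha, indicator_of_mem hb, indicator_of_mem hc, indicator_of_mem hd,
    map_mul, Complex.conj_conj, ← Complex.exp_conj, ← Complex.exp_conj, ← Complex.exp_add,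
    ← Complex.exp_add, ← Complex.exp_add]
  congr 1
  simp only [map_mul, Complex.conj_I, Complex.conj_ofReal]
  push_cast
  ring

/-- The fourfold correlations of the phase kernel along the lines `s ξ + η = u`. -/
noncomputable def quarticCorrelation (k : ℝ × ℝ → ℂ) (s τ u u' : ℝ) : ℂ :=
  ∫ ξ, (k (ξ, u - s * ξ) * conj (k (ξ + τ, u - s * ξ))) *
    conj (k (ξ, u' - s * ξ) * conj (k (ξ + τ, u' - s * ξ)))

lemma norm_quarticCorrelation_le (h : SmallPhase ε w w₁ w₂ w₃ w₄) {D : Set (ℝ × ℝ)}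
    (hconv : Convex ℝ D) (hclosed : IsClosed D) (hsub : D ⊆ critDomain w₁)
    {s δ : ℝ} (hs : 0 < s) (hs1 : s ≤ 1) (hδ0 : 0 < δ)
    (hδ : ∀ p ∈ D, δ ≤ |1 - 4 * s * critRoot w₁ p.1 p.2|) (hδε : 100 * ε ≤ δ)
    {lam : ℝ} (hlam : lam ≠ 0) {τ u u' : ℝ} (hτ : τ ≠ 0) (hu : u ≠ u') :
    ‖quarticCorrelation (phaseKernel w w₁ D lam) s τ u u'‖ ≤
      20000 / (|lam| * δ ^ 2 * (|τ| * |u - u'|)) := by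
  -- The ξ for which all four corners lie in D. Affine preimages of a convex set are convex, so S is
  -- an interval and the first derivative test applies.
  set S : Set ℝ := {ξ | (ξ, u - s * ξ) ∈ D ∧ (ξ + τ, u - s * ξ) ∈ D ∧ (ξ, u' - s * ξ) ∈ D ∧
    (ξ + τ, u' - s * ξ) ∈ D} with hS
  have hSc : IsClosed S := by
    rw [hS]
    simp only [ofPred_and]
    refine IsClosed.inter ?_ (IsClosed.inter ?_ (IsClosed.inter ?_ ?_)) <;>
    exact hclosed.preimage (by fun_prop)
  have hSb : S ⊆ Icc (-3 : ℝ) 0 := fun ξ hξ => h.fst_mem (hsub hξ.1)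
  have hSconv : Convex ℝ S := by
    intro x hx y hy a b ha hb hab
    have key : ∀ v σ : ℝ, (x + σ, v - s * x) ∈ D → (y + σ, v - s * y) ∈ D →
        (a • x + b • y + σ, v - s * (a • x + b • y)) ∈ D := by
      intro v σ h1 h2
      convert hconv h1 h2 ha hb hab using 1
      ext
      · simp only [Prod.smul_mk, Prod.mk_add_mk, smul_eq_mul]
        linear_combination -σ * hab
      · simp only [Prod.smul_mk, Prod.mk_add_mk, smul_eq_mul]
        linear_combination -v * hab
    have k0 := fun v => key v 0
    simp only [add_zero] at k0
    exact ⟨k0 _ hx.1 hy.1, key _ _ hx.2.1 hy.2.1, k0 _ hx.2.2.1 hy.2.2.1,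
      key _ _ hx.2.2.2 hy.2.2.2⟩
  set θ : ℝ → ℝ := fun ξ => critPhase w w₁ ξ (u - s * ξ) - critPhase w w₁ (ξ + τ) (u - s * ξ) -
    critPhase w w₁ ξ (u' - s * ξ) + critPhase w w₁ (ξ + τ) (u' - s * ξ) with hθ
  have hint : quarticCorrelation (phaseKernel w w₁ D lam) s τ u u' =
      ∫ ξ in S, Complex.exp (Complex.I * ((lam * θ ξ : ℝ) : ℂ)) := by
    rw [← integral_indicator hSc.measurableSet]
    refine integral_congr_ae (ae_of_all _ fun ξ => ?_)
    by_cases hξ : ξ ∈ S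
    · rw [indicator_of_mem hξ]
      exact phaseKernel_mul_eq hξ.1 hξ.2.1 hξ.2.2.1 hξ.2.2.2
    · rw [indicator_of_notMem hξ]
      have : (ξ, u - s * ξ) ∉ D ∨ (ξ + τ, u - s * ξ) ∉ D ∨ (ξ, u' - s * ξ) ∉ D ∨
          (ξ + τ, u' - s * ξ) ∉ D := by
        by_contra hcon
        push Not at hcon
        exact hξ hcon
      simp only [phaseKernel]
      rcases this with h1 | h1 | h1 | h1 <;> rw [indicator_of_notMem h1] <;> simp
  rw [hint]
  rcases S.eq_empty_or_nonempty with hem | hne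
  · rw [hem]
    simp only [Measure.restrict_empty, integral_zero_measure, norm_zero]
    positivity
  have hcomp : IsCompact S := isCompact_Icc.of_isClosed_subset hSc hSb
  have hSeq : S = Icc (sInf S) (sSup S) :=
    eq_Icc_of_connected_compact ⟨hne, hSconv.isPreconnected⟩ hcomp
  set a := sInf S
  set b := sSup S
  have hab : a ≤ b := by
    rw [hSeq] at hne
    exact nonempty_Icc.1 hne
  have hlen : b - a ≤ 3 := by
    have h1 : a ∈ S := by rw [hSeq]; exact left_mem_Icc.2 hab
    have h2 : b ∈ S := by rw [hSeq]; exact right_mem_Icc.2 hab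
    linarith [(hSb h1).1, (hSb h2).2]
  have hline : ∀ v x : ℝ, HasDerivAt (fun ξ : ℝ => v - s * ξ) (-s) x := fun v x => by
    simpa using ((hasDerivAt_id x).const_mul s).const_sub v
  have hshift : ∀ x : ℝ, HasDerivAt (fun ξ : ℝ => ξ + τ) 1 x := fun x =>
    (hasDerivAt_id x).add_const τ
  have hPd : ∀ {X Y : ℝ → ℝ} {x : ℝ}, HasDerivAt X 1 x → HasDerivAt Y (-s) x →
      (X x, Y x) ∈ D → HasDerivAt (fun ξ => critPhase w w₁ (X ξ) (Y ξ))
        (lineDerivPhase w₁ s (X x) (Y x)) x := fun hX hY hp => by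
    refine (h.hasDerivAt_critPhase hX hY (hsub hp)).congr_deriv ?_
    unfold lineDerivPhase
    ring
  have hQd : ∀ {X Y : ℝ → ℝ} {x : ℝ}, HasDerivAt X 1 x → HasDerivAt Y (-s) x →
      (X x, Y x) ∈ D → HasDerivAt (fun ξ => lineDerivPhase w₁ s (X ξ) (Y ξ))
        (-lineDeriv2Phase w₁ w₂ s (X x) (Y x)) x := fun hX hY hp => by
    refine (h.hasDerivAt_lineDeriv hX hY (hsub hp)).congr_deriv ?_
    unfold lineDeriv2Phase
    ring
  have hpos : 0 < |τ| * |u - u'| := by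
    have := abs_pos.2 hτ
    have := abs_pos.2 (sub_ne_zero.2 hu)
    positivity
  rw [hSeq, integral_Icc_eq_integral_Ioc, ← intervalIntegral.integral_of_le hab]
  -- As ξ varies the rectangle is translated along (1,-s) with fixed sides, so θ' and θ'' are second
  -- differences of `lineDerivPhase` and of minus `lineDeriv2Phase`.
  have hvdc := norm_integral_exp_le_of_deriv_ge (θ := θ)
    (θ₁ := fun ξ => lineDerivPhase w₁ s ξ (u - s * ξ) - lineDerivPhase w₁ s (ξ + τ) (u - s * ξ) -
      lineDerivPhase w₁ s ξ (u' - s * ξ) + lineDerivPhase w₁ s (ξ + τ) (u' - s * ξ))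
    (θ₂ := fun ξ => -lineDeriv2Phase w₁ w₂ s ξ (u - s * ξ) -
      -lineDeriv2Phase w₁ w₂ s (ξ + τ) (u - s * ξ) -
      -lineDeriv2Phase w₁ w₂ s ξ (u' - s * ξ) + -lineDeriv2Phase w₁ w₂ s (ξ + τ) (u' - s * ξ))
    (c := δ / 10 * (|τ| * |u - u'|)) (M := 40 * (|τ| * |u - u'|)) hab (by positivity) hlam
    (fun x hx => by
      rw [← hSeq] at hx
      exact (((hPd (hasDerivAt_id x) (hline u x) hx.1).sub
        (hPd (hshift x) (hline u x) hx.2.1)).sub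
        (hPd (hasDerivAt_id x) (hline u' x) hx.2.2.1)).add
        (hPd (hshift x) (hline u' x) hx.2.2.2))
    (fun x hx => by
      rw [← hSeq] at hx
      exact (((hQd (hasDerivAt_id x) (hline u x) hx.1).sub
        (hQd (hshift x) (hline u x) hx.2.1)).sub
        (hQd (hasDerivAt_id x) (hline u' x) hx.2.2.1)).add
        (hQd (hshift x) (hline u' x) hx.2.2.2))
    (fun x hx => by
      rw [← hSeq] at hx
      exact ((((h.continuousAt_lineDeriv2Phase (hasDerivAt_id x) (hline u x)
        (hsub hx.1)).neg.sub (h.continuousAt_lineDeriv2Phase (hshift x) (hline u x)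
        (hsub hx.2.1)).neg).sub (h.continuousAt_lineDeriv2Phase (hasDerivAt_id x) (hline u' x)
        (hsub hx.2.2.1)).neg).add (h.continuousAt_lineDeriv2Phase (hshift x) (hline u' x)
        (hsub hx.2.2.2)).neg).continuousWithinAt)
    (fun x hx => by
      rw [← hSeq] at hx
      have := h.abs_second_difference_lineDeriv_ge hconv hsub hs hs1 hδ hδε hx.2.2.2 hx.2.1
        hx.2.2.1 hx.1
      rw [sub_add_cancel_left, abs_neg, sub_sub_sub_cancel_right] at this
      exact this)
    (fun x hx => by
      rw [← hSeq] at hx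
      have := h.abs_second_difference_lineDeriv2_le hconv hsub hs hs1 hx.2.2.1 hx.1
        hx.2.2.2 hx.2.1
      convert this using 2
      · ring
      · ring_nf)
  refine hvdc.trans ?_
  -- With b - a ≤ 3 this bounds the numerator 20δ + 4000(b - a) by 20000.
  have hδ2 : δ ≤ 2 := by
    have ha : a ∈ S := by rw [hSeq]; exact left_mem_Icc.2 hab
    have h1 := hδ _ ha.1
    have h2 := (hsub ha.1).2
    refine h1.trans ?_
    rw [abs_le]
    constructor <;> nlinarith [h2.1, h2.2]
  set P := |τ| * |u - u'|
  have hl := abs_pos.2 hlam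
  have e : (20000 : ℝ) / (|lam| * δ ^ 2 * P) = 20000 / (δ ^ 2 * P) / |lam| := by
    field_simp
  rw [e]
  refine div_le_div_of_nonneg_right ?_ hl.le
  have e2 : 2 / (δ / 10 * P) + 40 * P * (b - a) / (δ / 10 * P) ^ 2 =
      (20 * δ + 4000 * (b - a)) / (δ ^ 2 * P) := by
    field_simp
    ring
  rw [e2]
  refine div_le_div_of_nonneg_right ?_ (by positivity)
  linarith

end SmallPhase

/-! ### A class of functions closed under the Fubini steps, and Cauchy-Schwarz. -/

/-- Bounded measurable functions with bounded support. -/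
structure BddSupp {E F : Type*} [NormedAddCommGroup E] [MeasurableSpace E]
    [NormedAddCommGroup F] [MeasurableSpace F] (f : E → F) : Prop where
  measurable : Measurable f
  bdd : ∃ M, 0 ≤ M ∧ ∀ x, ‖f x‖ ≤ M
  supp : ∃ R, ∀ x, f x ≠ 0 → ‖x‖ ≤ R

namespace BddSupp

variable {E E' : Type*} [NormedAddCommGroup E] [NormedAddCommGroup E'] [MeasureSpace E]
  [MeasureSpace E'] {𝕜 : Type*} [RCLike 𝕜]

lemma norm {f : E → 𝕜} (hf : BddSupp f) : BddSupp (fun x => ‖f x‖) := by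
  obtain ⟨M, h0, hM⟩ := hf.bdd
  obtain ⟨R, hR⟩ := hf.supp
  exact ⟨hf.measurable.norm, ⟨M, h0, fun x => by simpa using hM x⟩,
    ⟨R, fun x hx => hR x (norm_ne_zero_iff.1 hx)⟩⟩

lemma pow {f : E → 𝕜} (hf : BddSupp f) {n : ℕ} (hn : n ≠ 0) : BddSupp (fun x => f x ^ n) := by
  obtain ⟨M, h0, hM⟩ := hf.bdd
  obtain ⟨R, hR⟩ := hf.supp
  refine ⟨hf.measurable.pow_const n, ⟨M ^ n, pow_nonneg h0 n, fun x => ?_⟩,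
    ⟨R, fun x hx => hR x fun h => hx (by rw [h, zero_pow hn])⟩⟩
  rw [norm_pow]
  exact pow_le_pow_left₀ (norm_nonneg _) (hM x) n

lemma integral_right [ProperSpace E'] [IsFiniteMeasureOnCompacts (volume : Measure E')]
    [SFinite (volume : Measure E')] {f : E × E' → 𝕜} (hf : BddSupp f) :
    BddSupp (fun x => ∫ y, f (x, y)) := by
  obtain ⟨M, h0, hM⟩ := hf.bdd
  obtain ⟨R, hR⟩ := hf.supp
  refine ⟨hf.measurable.stronglyMeasurable.integral_prod_right'.measurable,
    ⟨M * (volume : Measure E').real (Metric.closedBall 0 R), by positivity, fun x => ?_⟩,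
    ⟨R, fun x hx => ?_⟩⟩
  · rw [← setIntegral_eq_integral_of_forall_compl_eq_zero (s := Metric.closedBall 0 R)]
    · exact norm_setIntegral_le_of_norm_le_const (isCompact_closedBall 0 R).measure_lt_top
        (fun y _ => hM (x, y))
    · intro y hy
      by_contra h
      exact hy (by simpa using (norm_snd_le (x, y)).trans (hR _ h))
  · by_contra hcon
    refine hx ?_
    have : ∀ y, f (x, y) = 0 := fun y => by
      by_contra h
      exact hcon ((norm_fst_le (x, y)).trans (hR _ h))
    simp [this]

variable [ProperSpace E] [IsFiniteMeasureOnCompacts (volume : Measure E)]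

lemma integrable {f : E → 𝕜} (hf : BddSupp f) : Integrable f := by
  obtain ⟨M, h0, hM⟩ := hf.bdd
  obtain ⟨R, hR⟩ := hf.supp
  have h1 : IntegrableOn f (Metric.closedBall 0 R) := by
    refine Measure.integrableOn_of_bounded (M := M) ?_ hf.measurable.aestronglyMeasurable
      (ae_of_all _ hM)
    exact (isCompact_closedBall 0 R).measure_lt_top.ne
  refine (integrableOn_iff_integrable_of_support_subset ?_).1 h1
  intro x hx
  simpa using hR x hx

lemma memLp_two {f : E → 𝕜} (hf : BddSupp f) : MemLp f 2 :=
  (memLp_two_iff_integrable_sq_norm hf.measurable.aestronglyMeasurable).2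
    (hf.norm.pow two_ne_zero).integrable

end BddSupp

/-- The Cauchy-Schwarz inequality for integrals. -/
lemma norm_integral_mul_sq_le {α 𝕜 : Type*} [RCLike 𝕜] [MeasurableSpace α] {μ : Measure α}
    {f g : α → 𝕜} (hf : MemLp f 2 μ) (hg : MemLp g 2 μ) :
    ‖∫ x, f x * g x ∂μ‖ ^ 2 ≤ (∫ x, ‖f x‖ ^ 2 ∂μ) * ∫ x, ‖g x‖ ^ 2 ∂μ := by
  have h := integral_mul_norm_le_Lp_mul_Lq (μ := μ) Real.HolderConjugate.two_two (f := f) (g := g)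
    (by simpa using hf) (by simpa using hg)
  have h1 : ‖∫ x, f x * g x ∂μ‖ ≤ ∫ x, ‖f x‖ * ‖g x‖ ∂μ := by
    refine (norm_integral_le_integral_norm _).trans_eq ?_
    simp_rw [norm_mul]
  have h2 := pow_le_pow_left₀ (norm_nonneg _) (h1.trans h) 2
  refine h2.trans_eq ?_
  have hfn : 0 ≤ ∫ x, ‖f x‖ ^ 2 ∂μ := integral_nonneg fun _ => by positivity
  have hgn : 0 ≤ ∫ x, ‖g x‖ ^ 2 ∂μ := integral_nonneg fun _ => by positivity
  simp only [Real.rpow_two]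
  rw [mul_pow, ← Real.sqrt_eq_rpow, ← Real.sqrt_eq_rpow, Real.sq_sqrt hfn, Real.sq_sqrt hgn]

/-- Cauchy-Schwarz in one variable, expanding the square in the other one. -/
lemma norm_integral_mul_integral_sq_le {a : ℝ → ℂ} {K : ℝ × ℝ → ℂ} (ha : BddSupp a)
    (hK : BddSupp K) :
    ‖∫ x, a x * ∫ y, K (x, y)‖ ^ 2 ≤
      (∫ x, ‖a x‖ ^ 2) * ‖∫ z : ℝ × ℝ, ∫ x, K (x, z.1) * conj (K (x, z.2))‖ := by
  refine (norm_integral_mul_sq_le ha.memLp_two hK.integral_right.memLp_two).trans ?_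
  refine mul_le_mul_of_nonneg_left ?_ (integral_nonneg fun _ => by positivity)
  have hint : Integrable (Function.uncurry fun (x : ℝ) (z : ℝ × ℝ) =>
      K (x, z.1) * conj (K (x, z.2))) (volume.prod volume) := by
    refine BddSupp.integrable ?_
    obtain ⟨M, h0, hM⟩ := hK.bdd
    obtain ⟨R, hR⟩ := hK.supp
    have hm := hK.measurable
    refine ⟨?_, ⟨M * M, by positivity, fun x => ?_⟩, ⟨R, fun x hx => ?_⟩⟩
    · unfold Function.uncurry
      have := Complex.continuous_conj.measurable
      refine Measurable.mul (by fun_prop) (this.comp (hm.comp (by fun_prop)))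
    · simp only [Function.uncurry, norm_mul, RCLike.norm_conj]
      exact mul_le_mul (hM _) (hM _) (norm_nonneg _) h0
    · have h1 := left_ne_zero_of_mul hx
      have h2 := (map_ne_zero _).1 (right_ne_zero_of_mul hx)
      have h1' := hR _ h1
      have h2' := hR _ h2
      simp only [Prod.norm_def, max_le_iff] at h1' h2' ⊢
      exact ⟨h1'.1, h1'.2, h2'.2⟩
  -- The squared inner integral is an integral over pairs of y-variables; Fubini moves the
  -- x-integral inside.
  have key : ((∫ x, ‖∫ y, K (x, y)‖ ^ 2 : ℝ) : ℂ) =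
      ∫ z : ℝ × ℝ, ∫ x, K (x, z.1) * conj (K (x, z.2)) := by
    rw [← integral_integral_swap hint, ← integral_complex_ofReal]
    refine integral_congr_ae (ae_of_all _ fun x => ?_)
    simp only
    rw [Measure.volume_eq_prod, integral_prod_mul (fun y => K (x, y)) (fun y => conj (K (x, y))),
      integral_conj, Complex.mul_conj, Complex.normSq_eq_norm_sq]
  rw [← key, Complex.norm_real]
  exact le_abs_self _

/-! ### Schur's test for a locally integrable singularity. -/

/-- The integrable singularity `|v| ^ (-p)` cut off to `[-R, R]`. -/
noncomputable def singularWeight (p R v : ℝ) : ℝ := (Icc (-R) R).indicator (fun v => |v| ^ (-p)) v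

lemma singularWeight_nonneg (p R v : ℝ) : 0 ≤ singularWeight p R v :=
  indicator_nonneg (fun _ _ => by positivity) _

lemma singularWeight_neg (p R v : ℝ) : singularWeight p R (-v) = singularWeight p R v := by
  unfold singularWeight
  have : -v ∈ Icc (-R) R ↔ v ∈ Icc (-R) R := by
    constructor <;> intro h <;> exact ⟨by linarith [h.2], by linarith [h.1]⟩
  by_cases h : v ∈ Icc (-R) R
  · rw [indicator_of_mem h, indicator_of_mem (this.2 h), abs_neg]
  · rw [indicator_of_notMem h, indicator_of_notMem (fun h' => h (this.1 h'))]

lemma singularWeight_of_abs_le {p R v : ℝ} (h : |v| ≤ R) :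
    singularWeight p R v = |v| ^ (-p) :=
  indicator_of_mem (mem_Icc.2 (abs_le.1 h)) _

lemma measurable_singularWeight (p R : ℝ) : Measurable (singularWeight p R) := by
  unfold singularWeight
  exact Measurable.indicator (by fun_prop) measurableSet_Icc

lemma integrable_singularWeight {p : ℝ} (hp : p < 1) (R : ℝ) :
    Integrable (singularWeight p R) := by
  have h1 : Integrable ((Ioc 0 R).indicator (fun v : ℝ => |v| ^ (-p))) := by
    rw [integrable_indicator_iff measurableSet_Ioc]
    rcases le_or_gt R 0 with hR | hR
    · rw [Ioc_eq_empty (not_lt.2 hR)]; exact integrableOn_empty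
    · have := (intervalIntegral.intervalIntegrable_rpow' (a := 0) (b := R)
        (by linarith : -1 < -p)).1
      refine this.congr_fun (fun x hx => ?_) measurableSet_Ioc
      simp only [abs_of_pos hx.1]
  have h2 := h1.add h1.comp_neg
  refine h2.congr ?_
  have h0 : ∀ᵐ v : ℝ, v ≠ 0 := by simp [ae_iff]
  filter_upwards [h0] with v hv
  simp only [Pi.add_apply, singularWeight, indicator_apply, mem_Ioc, mem_Icc, abs_neg]
  rcases lt_or_gt_of_ne hv with h | h
  · rw [if_neg (by intro h'; linarith [h'.1]), zero_add]
    congr 1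
    apply propext
    constructor
    · rintro ⟨_, h2⟩; constructor <;> linarith
    · rintro ⟨h1, _⟩; constructor <;> linarith
  · rw [if_neg (by intro h'; linarith [h'.1] : ¬(0 < -v ∧ -v ≤ R)), add_zero]
    congr 1
    apply propext
    constructor
    · rintro ⟨_, h2⟩; constructor <;> linarith
    · rintro ⟨_, h1⟩; constructor <;> linarith

/-- Schur's test for an even convolution kernel. -/
lemma integral_prod_mul_weight_le {g wt : ℝ → ℝ} (hg : BddSupp g)
    (hwt : Integrable wt) (hwm : Measurable wt) (hwt0 : ∀ v, 0 ≤ wt v)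
    (heven : ∀ v, wt (-v) = wt v) (hg0 : ∀ u, 0 ≤ g u) :
    Integrable (fun z : ℝ × ℝ => g z.1 * g z.2 * wt (z.1 - z.2)) ∧
      ∫ z : ℝ × ℝ, g z.1 * g z.2 * wt (z.1 - z.2) ≤ (∫ v, wt v) * ∫ u, g u ^ 2 := by
  have hg2 : Integrable (fun u => g u ^ 2) := (hg.pow two_ne_zero).integrable
  have h2 : Integrable (fun z : ℝ × ℝ => g z.2 ^ 2 * wt (z.1 - z.2)) (volume.prod volume) :=
    hg2.convolution_integrand (ContinuousLinearMap.mul ℝ ℝ) hwt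
  have h1 : Integrable (fun z : ℝ × ℝ => g z.1 ^ 2 * wt (z.1 - z.2)) (volume.prod volume) := by
    refine h2.swap.congr (ae_of_all _ fun z => ?_)
    simp only [Function.comp, Prod.fst_swap, Prod.snd_swap]
    rw [← heven, neg_sub]
  have i2 : ∫ z : ℝ × ℝ, g z.2 ^ 2 * wt (z.1 - z.2) = (∫ v, wt v) * ∫ u, g u ^ 2 := by
    rw [Measure.volume_eq_prod, integral_prod_symm _ h2]
    simp only [integral_const_mul, integral_sub_right_eq_self, integral_mul_const]
    ring
  have i1 : ∫ z : ℝ × ℝ, g z.1 ^ 2 * wt (z.1 - z.2) = (∫ v, wt v) * ∫ u, g u ^ 2 := by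
    rw [← i2, Measure.volume_eq_prod, ← integral_prod_swap]
    refine integral_congr_ae (ae_of_all _ fun z => ?_)
    simp only [Prod.fst_swap, Prod.snd_swap]
    rw [← heven, neg_sub]
  -- The inequality ab ≤ (a² + b²)/2 reduces the form to two convolutions, each with integral (∫
  -- wt)(∫ g²).
  have hdom : ∀ z : ℝ × ℝ, g z.1 * g z.2 * wt (z.1 - z.2) ≤
      2⁻¹ * (g z.1 ^ 2 * wt (z.1 - z.2) + g z.2 ^ 2 * wt (z.1 - z.2)) := fun z => by
    have := hwt0 (z.1 - z.2)
    nlinarith [mul_nonneg this (sq_nonneg (g z.1 - g z.2))]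
  have hnn : ∀ z : ℝ × ℝ, 0 ≤ g z.1 * g z.2 * wt (z.1 - z.2) := fun z =>
    mul_nonneg (mul_nonneg (hg0 _) (hg0 _)) (hwt0 _)
  have hsum := (h1.add h2).const_mul (2⁻¹ : ℝ)
  have hgm := hg.measurable
  constructor
  · refine hsum.mono' ?_ (ae_of_all _ fun z => ?_)
    · exact (by fun_prop : Measurable fun z : ℝ × ℝ =>
        g z.1 * g z.2 * wt (z.1 - z.2)).aestronglyMeasurable
    · rw [Real.norm_of_nonneg (hnn z)]
      exact hdom z
  · calc _ ≤ ∫ z : ℝ × ℝ, 2⁻¹ * (g z.1 ^ 2 * wt (z.1 - z.2) + g z.2 ^ 2 * wt (z.1 - z.2)) :=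
          integral_mono_of_nonneg (ae_of_all _ hnn) hsum (ae_of_all _ hdom)
      _ = _ := by
          rw [integral_const_mul]
          erw [integral_add h1 h2]
          erw [i1, i2]
          ring

lemma bddSupp_mul_comp_add {f : ℝ → ℂ} (hf : BddSupp f) (c : ℝ) :
    BddSupp (fun x => f x * conj (f (x + c))) := by
  obtain ⟨M, h0, hM⟩ := hf.bdd
  obtain ⟨R, hR⟩ := hf.supp
  have hm := hf.measurable
  refine ⟨?_, ⟨M * M, by positivity, fun x => ?_⟩, ⟨R, fun x hx => hR x (left_ne_zero_of_mul hx)⟩⟩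
  · exact hm.mul (Complex.continuous_conj.measurable.comp (hm.comp (by fun_prop)))
  · rw [norm_mul, RCLike.norm_conj]
    exact mul_le_mul (hM _) (hM _) (norm_nonneg _) h0

/-- This is where the L⁴ norm of f₁ enters, through products of f₁ with its own translate. -/
lemma integral_sq_norm_mul_comp_add_le {f : ℝ → ℂ} (hf : BddSupp f) (c : ℝ) :
    ∫ x, ‖f x * conj (f (x + c))‖ ^ 2 ≤ ∫ x, ‖f x‖ ^ 4 := by
  have h4 : Integrable (fun x => ‖f x‖ ^ 4) := (hf.norm.pow four_ne_zero).integrable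
  have h4' : Integrable (fun x => ‖f (x + c)‖ ^ 4) := h4.comp_add_right c
  calc _ ≤ ∫ x, 2⁻¹ * (‖f x‖ ^ 4 + ‖f (x + c)‖ ^ 4) := by
        refine integral_mono_of_nonneg (ae_of_all _ fun _ => by positivity)
          ((h4.add h4').const_mul _) (ae_of_all _ fun x => ?_)
        simp only [norm_mul, RCLike.norm_conj]
        nlinarith [sq_nonneg (‖f x‖ ^ 2 - ‖f (x + c)‖ ^ 2)]
    _ = _ := by
        rw [integral_const_mul, integral_add h4 h4',
          integral_add_right_eq_self (fun x => ‖f x‖ ^ 4)]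
        ring

/-! ### The trilinear estimate from correlation decay. -/

section Trilinear

variable {f₁ f₂ f₃ : ℝ → ℂ} {k : ℝ × ℝ → ℂ} {s p B R : ℝ}

/-- The bilinear form obtained for a fixed shift `τ`. -/
noncomputable def shiftedForm (f₁ f₃ : ℝ → ℂ) (k : ℝ × ℝ → ℂ) (s τ : ℝ) : ℂ :=
  ∫ ξ, (f₁ ξ * conj (f₁ (ξ + τ))) * ∫ u, (f₃ u * conj (f₃ (u + s * τ))) *
    (k (ξ, u - s * ξ) * conj (k (ξ + τ, u - s * ξ)))

lemma bddSupp_shifted_kernel (hf : BddSupp f₃) (hk : BddSupp k) (s τ : ℝ) :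
    BddSupp (fun z : ℝ × ℝ => (f₃ z.2 * conj (f₃ (z.2 + s * τ))) *
      (k (z.1, z.2 - s * z.1) * conj (k (z.1 + τ, z.2 - s * z.1)))) := by
  obtain ⟨M, h0, hM⟩ := hf.bdd
  obtain ⟨R, hR⟩ := hf.supp
  obtain ⟨M', h0', hM'⟩ := hk.bdd
  obtain ⟨R', hR'⟩ := hk.supp
  have hm := hf.measurable
  have hm' := hk.measurable
  have hc := Complex.continuous_conj.measurable
  refine ⟨?_, ⟨M * M * (M' * M'), by positivity, fun x => ?_⟩, ⟨max R R', fun z hz => ?_⟩⟩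
  · refine Measurable.mul (Measurable.mul (by fun_prop) (hc.comp (by fun_prop))) ?_
    exact Measurable.mul (hm'.comp (by fun_prop)) (hc.comp (hm'.comp (by fun_prop)))
  · simp only [norm_mul, RCLike.norm_conj]
    gcongr <;> first | exact hM _ | exact hM' _
  · have h1 := hR _ (left_ne_zero_of_mul (left_ne_zero_of_mul hz))
    have h2 := hR' _ (left_ne_zero_of_mul (right_ne_zero_of_mul hz))
    rw [Prod.norm_def] at h2 ⊢
    exact max_le ((le_max_left _ _).trans (h2.trans (le_max_right _ _)))
      (h1.trans (le_max_left _ _))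

/-- Cauchy-Schwarz in ξ removes f₁; the expanded square is a form in (u,u') weighted by the
correlation, and Schur's test sums |u - u'|^{-p}. The cutoff 2R is harmless since u and u' both lie
in [-R,R]. -/
lemma norm_shiftedForm_sq_le (hf₁ : BddSupp f₁) (hf₃ : BddSupp f₃) (hk : BddSupp k)
    (hR₃ : ∀ x, f₃ x ≠ 0 → |x| ≤ R) (hB : 0 ≤ B) (hp : p < 1)
    (hQ : ∀ τ u u', τ ≠ 0 → u ≠ u' →
      ‖SmallPhase.quarticCorrelation k s τ u u'‖ ≤ B * (|τ| * |u - u'|) ^ (-p))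
    {τ : ℝ} (hτ : τ ≠ 0) :
    ‖shiftedForm f₁ f₃ k s τ‖ ^ 2 ≤ (∫ ξ, ‖f₁ ξ‖ ^ 4) *
      (B * |τ| ^ (-p) * ((∫ v, singularWeight p (2 * R) v) *
        ∫ u, ‖f₃ u * conj (f₃ (u + s * τ))‖ ^ 2)) := by
  set G : ℝ → ℂ := fun u => f₃ u * conj (f₃ (u + s * τ)) with hG
  have hGb : BddSupp G := bddSupp_mul_comp_add hf₃ (s * τ)
  have h1 := norm_integral_mul_integral_sq_le (bddSupp_mul_comp_add hf₁ τ)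
    (bddSupp_shifted_kernel hf₃ hk s τ)
  refine h1.trans (mul_le_mul (integral_sq_norm_mul_comp_add_le hf₁ τ) ?_ (norm_nonneg _)
    (integral_nonneg fun _ => by positivity))
  have hz : ∀ z : ℝ × ℝ, ∫ x, (f₃ z.1 * conj (f₃ (z.1 + s * τ)) *
      (k (x, z.1 - s * x) * conj (k (x + τ, z.1 - s * x)))) *
      conj (f₃ z.2 * conj (f₃ (z.2 + s * τ)) *
        (k (x, z.2 - s * x) * conj (k (x + τ, z.2 - s * x)))) =
      G z.1 * conj (G z.2) * SmallPhase.quarticCorrelation k s τ z.1 z.2 := fun z => by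
    unfold SmallPhase.quarticCorrelation
    rw [← integral_const_mul]
    refine integral_congr_ae (ae_of_all _ fun x => ?_)
    simp only [hG, map_mul]
    ring
  simp only [hz]
  have hgn : BddSupp (fun u => ‖G u‖) := hGb.norm
  obtain ⟨hi, hle⟩ := integral_prod_mul_weight_le hgn (integrable_singularWeight hp (2 * R))
    (measurable_singularWeight p (2 * R)) (singularWeight_nonneg p _) (singularWeight_neg p _)
    (fun u => norm_nonneg _)
  -- The correlation bound holds only off the diagonal, which is a null set.
  have hne : ∀ᵐ z : ℝ × ℝ, z.1 ≠ z.2 := by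
    have hms : MeasurableSet {z : ℝ × ℝ | z.1 = z.2} :=
      measurableSet_eq_fun measurable_fst measurable_snd
    rw [ae_iff]
    simp only [ne_eq, not_not]
    rw [Measure.volume_eq_prod, Measure.measure_prod_null hms]
    refine ae_of_all _ fun x => ?_
    have : Prod.mk x ⁻¹' {z : ℝ × ℝ | z.1 = z.2} = {x} := by
      ext y; simp [eq_comm]
    change volume (Prod.mk x ⁻¹' {z : ℝ × ℝ | z.1 = z.2}) = 0
    rw [this, Real.volume_singleton]
  have hτ0 := abs_pos.2 hτ
  calc _ ≤ ∫ z : ℝ × ℝ, ‖G z.1 * conj (G z.2) * SmallPhase.quarticCorrelation k s τ z.1 z.2‖ :=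
        norm_integral_le_integral_norm _
    _ ≤ ∫ z : ℝ × ℝ, B * |τ| ^ (-p) *
          (‖G z.1‖ * ‖G z.2‖ * singularWeight p (2 * R) (z.1 - z.2)) := by
        refine integral_mono_of_nonneg (ae_of_all _ fun _ => norm_nonneg _) (hi.const_mul _) ?_
        filter_upwards [hne] with z hz
        simp only [norm_mul, RCLike.norm_conj]
        by_cases h0 : G z.1 = 0 ∨ G z.2 = 0
        · rcases h0 with h0 | h0 <;> simp [h0]
        · push Not at h0
          have b1 := hR₃ _ (left_ne_zero_of_mul h0.1)
          have b2 := hR₃ _ (left_ne_zero_of_mul h0.2)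
          have b3 : |z.1 - z.2| ≤ 2 * R := by
            refine (abs_sub _ _).trans ?_
            linarith
          rw [singularWeight_of_abs_le b3]
          have := hQ τ z.1 z.2 hτ hz
          rw [Real.mul_rpow hτ0.le (abs_nonneg _)] at this
          calc _ ≤ ‖G z.1‖ * ‖G z.2‖ * (B * (|τ| ^ (-p) * |z.1 - z.2| ^ (-p))) := by gcongr
            _ = _ := by ring
    _ = B * |τ| ^ (-p) * ∫ z : ℝ × ℝ,
          ‖G z.1‖ * ‖G z.2‖ * singularWeight p (2 * R) (z.1 - z.2) := integral_const_mul _ _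
    _ ≤ _ := by gcongr

lemma shiftedForm_eq_zero (hR₁ : ∀ x, f₁ x ≠ 0 → |x| ≤ R) {τ : ℝ} (hτ : ¬|τ| ≤ 2 * R) :
    shiftedForm f₁ f₃ k s τ = 0 := by
  unfold shiftedForm
  have : ∀ ξ, f₁ ξ * conj (f₁ (ξ + τ)) = 0 := fun ξ => by
    by_contra h
    have b1 := hR₁ _ (left_ne_zero_of_mul h)
    have b2 := hR₁ _ ((map_ne_zero _).1 (right_ne_zero_of_mul h))
    refine hτ ?_
    have := abs_sub (ξ + τ) ξ
    rw [add_sub_cancel_left] at this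
    linarith
  simp [this]

lemma bddSupp_shift_sq (hf₃ : BddSupp f₃) (hs : 0 < s) :
    BddSupp (fun z : ℝ × ℝ => ‖f₃ z.2 * conj (f₃ (z.2 + s * z.1))‖ ^ 2) := by
  obtain ⟨M, h0, hM⟩ := hf₃.bdd
  obtain ⟨R, hR⟩ := hf₃.supp
  have hm := hf₃.measurable
  refine ⟨?_, ⟨(M * M) ^ 2, by positivity, fun x => ?_⟩, ⟨max (2 * R / s) R, fun z hz => ?_⟩⟩
  · refine Measurable.pow_const (Measurable.norm (Measurable.mul (by fun_prop) ?_)) 2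
    exact Complex.continuous_conj.measurable.comp (by fun_prop)
  · rw [norm_mul, RCLike.norm_conj, norm_pow, norm_mul, norm_norm, norm_norm]
    gcongr <;> exact hM _
  · have hz' := norm_ne_zero_iff.1 (ne_zero_pow two_ne_zero hz)
    have b1 := hR _ (left_ne_zero_of_mul hz')
    have b2 := hR _ ((map_ne_zero _).1 (right_ne_zero_of_mul hz'))
    rw [Prod.norm_def]
    refine max_le_max ?_ b1
    rw [le_div_iff₀ hs]
    rw [Real.norm_eq_abs] at *
    have := abs_sub (z.2 + s * z.1) z.2
    rw [add_sub_cancel_left, abs_mul, abs_of_pos hs] at this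
    linarith

/-- The substitution v = u + sτ costs s⁻¹ = 2^j, a loss that the decay in λ must later beat. -/
lemma integral_shift_sq (hf₃ : BddSupp f₃) (hs : 0 < s) :
    ∫ τ, ∫ u, ‖f₃ u * conj (f₃ (u + s * τ))‖ ^ 2 = s⁻¹ * (∫ u, ‖f₃ u‖ ^ 2) ^ 2 := by
  have hint := (bddSupp_shift_sq hf₃ hs).integrable
  rw [integral_integral_swap (f := fun τ u => ‖f₃ u * conj (f₃ (u + s * τ))‖ ^ 2) hint]
  have : ∀ u, ∫ τ, ‖f₃ u * conj (f₃ (u + s * τ))‖ ^ 2 =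
      ‖f₃ u‖ ^ 2 * (s⁻¹ * ∫ v, ‖f₃ v‖ ^ 2) := fun u => by
    simp only [norm_mul, RCLike.norm_conj, mul_pow]
    rw [integral_const_mul, Measure.integral_comp_mul_left (fun τ => ‖f₃ (u + τ)‖ ^ 2),
      integral_add_left_eq_self (fun v => ‖f₃ v‖ ^ 2), abs_of_pos (inv_pos.2 hs), smul_eq_mul]
  simp only [this]
  rw [integral_mul_const]
  ring

/-- For fixed τ the bound is √(|τ|^{-p}) times the square root of the shifted mass of f₃;
Cauchy-Schwarz in τ separates the two. -/
lemma integral_norm_shiftedForm_sq_le (hf₁ : BddSupp f₁) (hf₃ : BddSupp f₃) (hk : BddSupp k)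
    (hR₁ : ∀ x, f₁ x ≠ 0 → |x| ≤ R) (hR₃ : ∀ x, f₃ x ≠ 0 → |x| ≤ R) (hs : 0 < s)
    (hB : 0 ≤ B) (hp : p < 1)
    (hQ : ∀ τ u u', τ ≠ 0 → u ≠ u' →
      ‖SmallPhase.quarticCorrelation k s τ u u'‖ ≤ B * (|τ| * |u - u'|) ^ (-p)) :
    (∫ τ, ‖shiftedForm f₁ f₃ k s τ‖) ^ 2 ≤
      B * (∫ v, singularWeight p (2 * R) v) ^ 2 * s⁻¹ * (∫ ξ, ‖f₁ ξ‖ ^ 4) *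
        (∫ u, ‖f₃ u‖ ^ 2) ^ 2 := by
  set W := ∫ v, singularWeight p (2 * R) v with hW
  set N := ∫ ξ, ‖f₁ ξ‖ ^ 4 with hN
  have hW0 : 0 ≤ W := integral_nonneg fun v => singularWeight_nonneg _ _ _
  have hN0 : 0 ≤ N := integral_nonneg fun v => by positivity
  set n : ℝ → ℝ := fun τ => ∫ u, ‖f₃ u * conj (f₃ (u + s * τ))‖ ^ 2 with hn
  have hn0 : ∀ τ, 0 ≤ n τ := fun τ => integral_nonneg fun v => by positivity
  have hnb : BddSupp n := (bddSupp_shift_sq hf₃ hs).integral_right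
  have hwi := integrable_singularWeight hp (2 * R)
  have hwm := measurable_singularWeight p (2 * R)
  have sq1 : MemLp (fun τ => √(singularWeight p (2 * R) τ)) 2 := by
    rw [memLp_two_iff_integrable_sq (hwm.sqrt).aestronglyMeasurable]
    simpa only [Real.sq_sqrt (singularWeight_nonneg _ _ _)] using hwi
  have sq2 : MemLp (fun τ => √(n τ)) 2 := by
    rw [memLp_two_iff_integrable_sq (hnb.measurable.sqrt).aestronglyMeasurable]
    simpa only [Real.sq_sqrt (hn0 _)] using hnb.integrable
  have h0 : ∀ᵐ v : ℝ, v ≠ 0 := by simp [ae_iff]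
  have hcs := norm_integral_mul_sq_le sq1 sq2
  simp only [Real.norm_eq_abs, sq_abs, Real.sq_sqrt (hn0 _),
    Real.sq_sqrt (singularWeight_nonneg _ _ _)] at hcs
  have hle : ∫ τ, ‖shiftedForm f₁ f₃ k s τ‖ ≤
      √(N * B * W) * ∫ τ, √(singularWeight p (2 * R) τ) * √(n τ) := by
    rw [← integral_const_mul]
    refine integral_mono_of_nonneg (ae_of_all _ fun _ => norm_nonneg _)
      ((sq1.integrable_mul sq2).const_mul _) ?_
    filter_upwards [h0] with τ hτ
    by_cases hτR : |τ| ≤ 2 * R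
    · rw [← Real.sqrt_mul (singularWeight_nonneg _ _ _), ← Real.sqrt_mul (by positivity)]
      refine Real.le_sqrt_of_sq_le ?_
      refine (norm_shiftedForm_sq_le hf₁ hf₃ hk hR₃ hB hp hQ hτ).trans_eq ?_
      rw [singularWeight_of_abs_le hτR]
      ring
    · rw [shiftedForm_eq_zero hR₁ hτR, norm_zero]
      positivity
  calc _ ≤ (√(N * B * W) * ∫ τ, √(singularWeight p (2 * R) τ) * √(n τ)) ^ 2 :=
        pow_le_pow_left₀ (integral_nonneg fun _ => norm_nonneg _) hle 2
    _ = N * B * W * (∫ τ, √(singularWeight p (2 * R) τ) * √(n τ)) ^ 2 := by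
        rw [mul_pow, Real.sq_sqrt (by positivity)]
    _ ≤ N * B * W * (W * ∫ τ, n τ) := by gcongr
    _ = _ := by
        rw [hn, integral_shift_sq hf₃ hs]
        ring

lemma bddSupp_trilinear_kernel (hf₁ : BddSupp f₁) (hf₃ : BddSupp f₃) (hk : BddSupp k) (s : ℝ) :
    BddSupp (fun z : ℝ × ℝ => f₁ z.2 * f₃ (s * z.2 + z.1) * k (z.2, z.1)) := by
  obtain ⟨M₁, h₁, hM₁⟩ := hf₁.bdd
  obtain ⟨M₃, h₃, hM₃⟩ := hf₃.bdd
  obtain ⟨M, h, hM⟩ := hk.bdd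
  obtain ⟨R, hR⟩ := hk.supp
  have m1 := hf₁.measurable
  have m3 := hf₃.measurable
  have m := hk.measurable
  refine ⟨by fun_prop, ⟨M₁ * M₃ * M, by positivity, fun z => ?_⟩, ⟨R, fun z hz => ?_⟩⟩
  · simp only [norm_mul]
    gcongr
    exacts [hM₁ _, hM₃ _, hM _]
  · have := hR _ (right_ne_zero_of_mul hz)
    rwa [Prod.norm_def, max_comm, ← Prod.norm_def] at this

lemma bddSupp_shifted_integrand (hf₁ : BddSupp f₁) (hf₃ : BddSupp f₃) (hk : BddSupp k) (s : ℝ) :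
    BddSupp (fun z : (ℝ × ℝ) × ℝ => (f₁ z.1.1 * conj (f₁ (z.1.1 + z.1.2))) *
      ((f₃ z.2 * conj (f₃ (z.2 + s * z.1.2))) *
        (k (z.1.1, z.2 - s * z.1.1) * conj (k (z.1.1 + z.1.2, z.2 - s * z.1.1))))) := by
  obtain ⟨M₁, h₁, hM₁⟩ := hf₁.bdd
  obtain ⟨M₃, h₃, hM₃⟩ := hf₃.bdd
  obtain ⟨M, h, hM⟩ := hk.bdd
  obtain ⟨R₁, hR₁⟩ := hf₁.supp
  obtain ⟨R₃, hR₃⟩ := hf₃.supp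
  have m1 := hf₁.measurable
  have m3 := hf₃.measurable
  have m := hk.measurable
  have hc := Complex.continuous_conj.measurable
  refine ⟨?_, ⟨M₁ * M₁ * (M₃ * M₃ * (M * M)), by positivity, fun z => ?_⟩,
    ⟨max (2 * R₁) R₃, fun z hz => ?_⟩⟩
  · refine Measurable.mul (Measurable.mul (by fun_prop) (hc.comp (by fun_prop)))
      (Measurable.mul (Measurable.mul (by fun_prop) (hc.comp (by fun_prop))) ?_)
    exact Measurable.mul (m.comp (by fun_prop)) (hc.comp (m.comp (by fun_prop)))
  · simp only [norm_mul, RCLike.norm_conj]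
    gcongr <;> first | exact hM _ | exact hM₁ _ | exact hM₃ _
  · have b1 := hR₁ _ (left_ne_zero_of_mul (left_ne_zero_of_mul hz))
    have b2 := hR₁ _ ((map_ne_zero _).1 (right_ne_zero_of_mul (left_ne_zero_of_mul hz)))
    have b3 := hR₃ _ (left_ne_zero_of_mul (left_ne_zero_of_mul (right_ne_zero_of_mul hz)))
    rw [Prod.norm_def, Prod.norm_def]
    have b4 := norm_sub_le (z.1.1 + z.1.2) z.1.1
    rw [add_sub_cancel_left] at b4
    have b5 := norm_nonneg z.1.1
    refine max_le_max (max_le ?_ ?_) b3 <;> linarith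

/-- The trilinear estimate deduced from decay of the fourfold correlations of the kernel. -/
theorem norm_trilinear_pow_four_le (hf₁ : BddSupp f₁) (hf₂ : BddSupp f₂) (hf₃ : BddSupp f₃)
    (hk : BddSupp k) (hR₁ : ∀ x, f₁ x ≠ 0 → |x| ≤ R) (hR₃ : ∀ x, f₃ x ≠ 0 → |x| ≤ R)
    (hs : 0 < s) (hB : 0 ≤ B) (hp : p < 1)
    (hQ : ∀ τ u u', τ ≠ 0 → u ≠ u' →
      ‖SmallPhase.quarticCorrelation k s τ u u'‖ ≤ B * (|τ| * |u - u'|) ^ (-p)) :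
    ‖∫ η, f₂ η * ∫ ξ, f₁ ξ * f₃ (s * ξ + η) * k (ξ, η)‖ ^ 4 ≤
      B * (∫ v, singularWeight p (2 * R) v) ^ 2 * s⁻¹ * (∫ ξ, ‖f₁ ξ‖ ^ 4) *
        (∫ u, ‖f₂ u‖ ^ 2) ^ 2 * (∫ u, ‖f₃ u‖ ^ 2) ^ 2 := by
  set K : ℝ × ℝ → ℂ := fun z => f₁ z.2 * f₃ (s * z.2 + z.1) * k (z.2, z.1) with hK
  have hKb : BddSupp K := bddSupp_trilinear_kernel hf₁ hf₃ hk s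
  have h1 := norm_integral_mul_integral_sq_le hf₂ hKb
  have hint := (bddSupp_shifted_integrand hf₁ hf₃ hk s)
  have hzint : Integrable (fun z : ℝ × ℝ => ∫ η, K (η, z.1) * conj (K (η, z.2))) := by
    refine BddSupp.integrable (BddSupp.integral_right
      (f := fun z : (ℝ × ℝ) × ℝ => K (z.2, z.1.1) * conj (K (z.2, z.1.2))) ?_)
    obtain ⟨M, h0, hM⟩ := hKb.bdd
    obtain ⟨R, hR⟩ := hKb.supp
    have hm := hKb.measurable
    refine ⟨?_, ⟨M * M, by positivity, fun x => ?_⟩, ⟨R, fun x hx => ?_⟩⟩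
    · exact Measurable.mul (hm.comp (by fun_prop))
        (Complex.continuous_conj.measurable.comp (hm.comp (by fun_prop)))
    · simp only [norm_mul, RCLike.norm_conj]
      exact mul_le_mul (hM _) (hM _) (norm_nonneg _) h0
    · have h1' := hR _ (left_ne_zero_of_mul hx)
      have h2' := hR _ ((map_ne_zero _).1 (right_ne_zero_of_mul hx))
      simp only [Prod.norm_def, max_le_iff] at h1' h2' ⊢
      exact ⟨⟨h1'.2, h2'.2⟩, h1'.1⟩
  have hJ : ∫ z : ℝ × ℝ, ∫ η, K (η, z.1) * conj (K (η, z.2)) =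
      ∫ τ, shiftedForm f₁ f₃ k s τ := by
    rw [Measure.volume_eq_prod, integral_prod _ hzint]
    -- The substitutions ξ' = ξ + τ and η = u - sξ put f₃ at u and u + sτ.
    have step : ∀ ξ, ∫ ξ', ∫ η, K (η, ξ) * conj (K (η, ξ')) =
        ∫ τ, ∫ u, (f₁ ξ * conj (f₁ (ξ + τ))) * ((f₃ u * conj (f₃ (u + s * τ))) *
          (k (ξ, u - s * ξ) * conj (k (ξ + τ, u - s * ξ)))) := fun ξ => by
      rw [← integral_add_left_eq_self _ ξ]
      refine integral_congr_ae (ae_of_all _ fun τ => ?_)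
      simp only
      rw [← integral_sub_right_eq_self _ (s * ξ)]
      refine integral_congr_ae (ae_of_all _ fun u => ?_)
      simp only [hK, map_mul]
      rw [show s * ξ + (u - s * ξ) = u by ring, show s * (ξ + τ) + (u - s * ξ) = u + s * τ by ring]
      ring
    simp only [step]
    rw [integral_integral_swap (f := fun ξ τ => ∫ u, (f₁ ξ * conj (f₁ (ξ + τ))) *
      ((f₃ u * conj (f₃ (u + s * τ))) * (k (ξ, u - s * ξ) * conj (k (ξ + τ, u - s * ξ)))))
      hint.integral_right.integrable]
    refine integral_congr_ae (ae_of_all _ fun τ => ?_)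
    simp only [shiftedForm, integral_const_mul]
  have h2 := integral_norm_shiftedForm_sq_le hf₁ hf₃ hk hR₁ hR₃ hs hB hp hQ
  have h3 : ‖∫ z : ℝ × ℝ, ∫ η, K (η, z.1) * conj (K (η, z.2))‖ ≤
      ∫ τ, ‖shiftedForm f₁ f₃ k s τ‖ := by
    rw [hJ]
    exact norm_integral_le_integral_norm _
  have hA : 0 ≤ ∫ u, ‖f₂ u‖ ^ 2 := integral_nonneg fun _ => by positivity
  calc _ = (‖∫ η, f₂ η * ∫ ξ, K (η, ξ)‖ ^ 2) ^ 2 := by rw [← pow_mul]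
    _ ≤ ((∫ u, ‖f₂ u‖ ^ 2) * ∫ τ, ‖shiftedForm f₁ f₃ k s τ‖) ^ 2 := by
        refine pow_le_pow_left₀ (by positivity) (h1.trans ?_) 2
        gcongr
    _ = (∫ u, ‖f₂ u‖ ^ 2) ^ 2 * (∫ τ, ‖shiftedForm f₁ f₃ k s τ‖) ^ 2 := mul_pow _ _ _
    _ ≤ _ := mul_le_mul_of_nonneg_left h2 (by positivity)
    _ = _ := by ring

end Trilinear

/-! ### Trilinear bounds for kernels, including thin strips. -/

/-- The product `‖f₁‖₄ ‖f₂‖₂ ‖f₃‖₂`. -/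
noncomputable def triNorm (f₁ f₂ f₃ : ℝ → ℂ) : ℝ :=
  (∫ x, ‖f₁ x‖ ^ 4) ^ (1 / 4 : ℝ) * (∫ x, ‖f₂ x‖ ^ 2) ^ (1 / 2 : ℝ) *
    (∫ x, ‖f₃ x‖ ^ 2) ^ (1 / 2 : ℝ)

/-- The trilinear form with kernel `k`, along the lines `s ξ + η = u`. -/
noncomputable def trilinearForm (k : ℝ × ℝ → ℂ) (s : ℝ) (f₁ f₂ f₃ : ℝ → ℂ) : ℂ :=
  ∫ p : ℝ × ℝ, f₁ p.1 * f₂ p.2 * f₃ (s * p.1 + p.2) * k p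

/-- The trilinear form is bounded by `A` on bounded functions supported in `[-5, 5]`. -/
def TrilinearBound (k : ℝ × ℝ → ℂ) (s A : ℝ) : Prop :=
  ∀ f₁ f₂ f₃ : ℝ → ℂ, BddSupp f₁ → BddSupp f₂ → BddSupp f₃ →
    (∀ x, f₁ x ≠ 0 → |x| ≤ 5) → (∀ x, f₃ x ≠ 0 → |x| ≤ 5) →
      ‖trilinearForm k s f₁ f₂ f₃‖ ≤ A * triNorm f₁ f₂ f₃

lemma triNorm_nonneg (f₁ f₂ f₃ : ℝ → ℂ) : 0 ≤ triNorm f₁ f₂ f₃ := by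
  have h1 : 0 ≤ ∫ x, ‖f₁ x‖ ^ 4 := integral_nonneg fun _ => by positivity
  have h2 : 0 ≤ ∫ x, ‖f₂ x‖ ^ 2 := integral_nonneg fun _ => by positivity
  have h3 : 0 ≤ ∫ x, ‖f₃ x‖ ^ 2 := integral_nonneg fun _ => by positivity
  unfold triNorm
  positivity

lemma le_mul_triNorm {x X : ℝ} (f₁ f₂ f₃ : ℝ → ℂ) (hX : 0 ≤ X)
    (h : x ^ 4 ≤ X * (∫ x, ‖f₁ x‖ ^ 4) * (∫ x, ‖f₂ x‖ ^ 2) ^ 2 * (∫ x, ‖f₃ x‖ ^ 2) ^ 2) :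
    x ≤ X ^ (1 / 4 : ℝ) * triNorm f₁ f₂ f₃ := by
  have h1 : 0 ≤ ∫ x, ‖f₁ x‖ ^ 4 := integral_nonneg fun _ => by positivity
  have h2 : 0 ≤ ∫ x, ‖f₂ x‖ ^ 2 := integral_nonneg fun _ => by positivity
  have h3 : 0 ≤ ∫ x, ‖f₃ x‖ ^ 2 := integral_nonneg fun _ => by positivity
  refine le_of_pow_le_pow_left₀ four_ne_zero
    (mul_nonneg (by positivity) (triNorm_nonneg _ _ _)) (h.trans_eq ?_)
  have e4 : ∀ y : ℝ, 0 ≤ y → (y ^ (1 / 4 : ℝ)) ^ 4 = y := fun y hy => by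
    rw [← Real.rpow_natCast, ← Real.rpow_mul hy]; norm_num
  have e2 : ∀ y : ℝ, 0 ≤ y → (y ^ (1 / 2 : ℝ)) ^ 4 = y ^ 2 := fun y hy => by
    rw [← Real.rpow_natCast, ← Real.rpow_mul hy, ← Real.rpow_natCast]; norm_num
  unfold triNorm
  simp only [mul_pow]
  rw [e4 _ hX, e4 _ h1, e2 _ h2, e2 _ h3]
  ring

lemma measurePreserving_shear (s : ℝ) :
    MeasurePreserving (fun p : ℝ × ℝ => (p.1, s * p.1 + p.2)) volume volume :=
  (MeasurePreserving.id volume).skew_product (g := fun x y => s * x + y) (by fun_prop)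
    (ae_of_all _ fun x => (measurePreserving_add_left volume (s * x)).map_eq)

lemma bddSupp_trilinear {f₁ f₂ f₃ : ℝ → ℂ} {k : ℝ × ℝ → ℂ} (hf₁ : BddSupp f₁) (hf₂ : BddSupp f₂)
    (hf₃ : BddSupp f₃) (hk : BddSupp k) (s : ℝ) :
    BddSupp (fun p : ℝ × ℝ => f₁ p.1 * f₂ p.2 * f₃ (s * p.1 + p.2) * k p) := by
  obtain ⟨M₁, h₁, hM₁⟩ := hf₁.bdd
  obtain ⟨M₂, h₂, hM₂⟩ := hf₂.bdd
  obtain ⟨M₃, h₃, hM₃⟩ := hf₃.bdd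
  obtain ⟨M, h, hM⟩ := hk.bdd
  obtain ⟨R, hR⟩ := hk.supp
  have m1 := hf₁.measurable
  have m2 := hf₂.measurable
  have m3 := hf₃.measurable
  have m := hk.measurable
  refine ⟨by fun_prop, ⟨M₁ * M₂ * M₃ * M, by positivity, fun z => ?_⟩,
    ⟨R, fun z hz => hR _ (right_ne_zero_of_mul hz)⟩⟩
  simp only [norm_mul]
  gcongr
  exacts [hM₁ _, hM₂ _, hM₃ _, hM _]

lemma TrilinearBound.add {k k' : ℝ × ℝ → ℂ} {s A A' : ℝ} (hk : BddSupp k) (hk' : BddSupp k')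
    (h : TrilinearBound k s A) (h' : TrilinearBound k' s A') :
    TrilinearBound (fun p => k p + k' p) s (A + A') := by
  intro f₁ f₂ f₃ h₁ h₂ h₃ s₁ s₃
  have : trilinearForm (fun p => k p + k' p) s f₁ f₂ f₃ =
      trilinearForm k s f₁ f₂ f₃ + trilinearForm k' s f₁ f₂ f₃ := by
    unfold trilinearForm
    rw [← integral_add (bddSupp_trilinear h₁ h₂ h₃ hk s).integrable
      (bddSupp_trilinear h₁ h₂ h₃ hk' s).integrable]
    simp only [mul_add]
  rw [this, add_mul]
  exact (norm_add_le _ _).trans (add_le_add (h _ _ _ h₁ h₂ h₃ s₁ s₃) (h' _ _ _ h₁ h₂ h₃ s₁ s₃))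

lemma TrilinearBound.mono {k : ℝ × ℝ → ℂ} {s A A' : ℝ} (h : TrilinearBound k s A) (hA : A ≤ A') :
    TrilinearBound k s A' := fun _ _ _ h₁ h₂ h₃ s₁ s₃ =>
  (h _ _ _ h₁ h₂ h₃ s₁ s₃).trans (mul_le_mul_of_nonneg_right hA (triNorm_nonneg _ _ _))

lemma BddSupp.comp_neg {E F : Type*} [NormedAddCommGroup E] [MeasurableSpace E] [MeasurableNeg E]
    [NormedAddCommGroup F] [MeasurableSpace F] {f : E → F} (hf : BddSupp f) :
    BddSupp (fun x => f (-x)) := by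
  obtain ⟨M, h, hM⟩ := hf.bdd
  obtain ⟨R, hR⟩ := hf.supp
  exact ⟨hf.measurable.comp measurable_neg, ⟨M, h, fun x => hM _⟩,
    ⟨R, fun x hx => by simpa using hR _ hx⟩⟩

lemma TrilinearBound.comp_neg {k : ℝ × ℝ → ℂ} {s A : ℝ} (h : TrilinearBound k s A) :
    TrilinearBound (fun p => k (-p)) s A := by
  intro f₁ f₂ f₃ h₁ h₂ h₃ s₁ s₃
  have := h (fun x => f₁ (-x)) (fun x => f₂ (-x)) (fun x => f₃ (-x)) h₁.comp_neg h₂.comp_neg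
    h₃.comp_neg (fun x hx => by simpa using s₁ _ hx) (fun x hx => by simpa using s₃ _ hx)
  have e1 : triNorm (fun x => f₁ (-x)) (fun x => f₂ (-x)) (fun x => f₃ (-x)) =
      triNorm f₁ f₂ f₃ := by
    unfold triNorm
    rw [integral_neg_eq_self (fun x => ‖f₁ x‖ ^ 4), integral_neg_eq_self (fun x => ‖f₂ x‖ ^ 2),
      integral_neg_eq_self (fun x => ‖f₃ x‖ ^ 2)]
  have e2 : trilinearForm k s (fun x => f₁ (-x)) (fun x => f₂ (-x)) (fun x => f₃ (-x)) =
      trilinearForm (fun p => k (-p)) s f₁ f₂ f₃ := by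
    unfold trilinearForm
    rw [← integral_neg_eq_self]
    refine integral_congr_ae (ae_of_all _ fun p => ?_)
    simp only [Prod.fst_neg, Prod.snd_neg, neg_neg]
    congr 3
    ring
  rwa [e1, e2] at this

/-- The trilinear bound from decay of the fourfold correlations. -/
lemma trilinearBound_of_correlation {k : ℝ × ℝ → ℂ} {s p B : ℝ} (hk : BddSupp k)
    (hs : 0 < s) (hB : 0 ≤ B) (hp : p < 1)
    (hQ : ∀ τ u u', τ ≠ 0 → u ≠ u' →
      ‖SmallPhase.quarticCorrelation k s τ u u'‖ ≤ B * (|τ| * |u - u'|) ^ (-p)) :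
    TrilinearBound k s
      ((B * (∫ v, singularWeight p (2 * 5) v) ^ 2 * s⁻¹) ^ (1 / 4 : ℝ)) := by
  intro f₁ f₂ f₃ h₁ h₂ h₃ s₁ s₃
  refine le_mul_triNorm f₁ f₂ f₃ (by positivity) ?_
  refine le_trans (le_of_eq ?_) (norm_trilinear_pow_four_le h₁ h₂ h₃ hk s₁ s₃ hs hB hp hQ)
  congr 2
  unfold trilinearForm
  rw [Measure.volume_eq_prod,
    integral_prod_symm _ (bddSupp_trilinear h₁ h₂ h₃ hk s).integrable]
  refine integral_congr_ae (ae_of_all _ fun y => ?_)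
  simp only
  rw [← integral_const_mul]
  refine integral_congr_ae (ae_of_all _ fun x => ?_)
  simp only
  ring

/-- Cauchy-Schwarz against the indicator of [-R,R]; it turns the L² norm of f₁ in the strip estimate
into the L⁴ norm. -/
lemma integral_sq_norm_sq_le {f : ℝ → ℂ} {R : ℝ} (hR0 : 0 ≤ R) (hf : BddSupp f)
    (hR : ∀ x, f x ≠ 0 → |x| ≤ R) : (∫ x, ‖f x‖ ^ 2) ^ 2 ≤ 2 * R * ∫ x, ‖f x‖ ^ 4 := by
  have hg : BddSupp (fun x : ℝ => (Icc (-R) R).indicator (fun _ => (1 : ℝ)) x) := by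
    refine ⟨measurable_const.indicator measurableSet_Icc, ⟨1, zero_le_one, fun x => ?_⟩,
      ⟨R, fun x hx => ?_⟩⟩
    · exact (norm_indicator_le_norm_self _ _).trans (by simp)
    · exact abs_le.2 (mem_Icc.1 (mem_of_indicator_ne_zero hx))
  have h := norm_integral_mul_sq_le (hf.norm.pow two_ne_zero).memLp_two hg.memLp_two
  have e1 : ∀ x, ‖f x‖ ^ 2 * (Icc (-R) R).indicator (fun _ => (1 : ℝ)) x = ‖f x‖ ^ 2 := fun x => by
    by_cases hx : f x = 0
    · simp [hx]
    · rw [indicator_of_mem (mem_Icc.2 (abs_le.1 (hR x hx))), mul_one]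
  have e2 : ∀ x, ‖(Icc (-R) R).indicator (fun _ => (1 : ℝ)) x‖ ^ 2 =
      (Icc (-R) R).indicator (fun _ => (1 : ℝ)) x := fun x => by
    by_cases hx : x ∈ Icc (-R) R <;> simp [hx]
  have e3 : ∀ x, ‖‖f x‖ ^ 2‖ ^ 2 = ‖f x‖ ^ 4 := fun x => by
    rw [norm_pow, norm_norm, ← pow_mul]
  simp only [e1, e2, e3] at h
  rw [Real.norm_eq_abs, sq_abs, integral_indicator measurableSet_Icc] at h
  simp only [integral_const, MeasurableSet.univ, measureReal_restrict_apply, univ_inter,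
    Real.volume_real_Icc, smul_eq_mul, mul_one] at h
  rw [max_eq_left (by linarith)] at h
  linarith

/-- The trivial bound for a kernel living in a strip of width `δ`. -/
lemma trilinearBound_strip {k : ℝ × ℝ → ℂ} {s δ c : ℝ} (hk : BddSupp k) (hk1 : ∀ p, ‖k p‖ ≤ 1)
    (hs : 0 < s) (hδ : 0 ≤ δ) (hsupp : ∀ p, k p ≠ 0 → |p.2 + c * p.1| ≤ δ) :
    TrilinearBound k s ((40 * δ ^ 2 * s⁻¹ ^ 2) ^ (1 / 4 : ℝ)) := by
  intro f₁ f₂ f₃ h₁ h₂ h₃ s₁ s₃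
  refine le_mul_triNorm f₁ f₂ f₃ (by positivity) ?_
  have hF : BddSupp (fun p : ℝ × ℝ => f₁ p.1 * k p) := by
    obtain ⟨M₁, a₁, hM₁⟩ := h₁.bdd
    obtain ⟨R, hR⟩ := hk.supp
    have m1 := h₁.measurable
    have m := hk.measurable
    refine ⟨by fun_prop, ⟨M₁ * 1, by positivity, fun z => ?_⟩,
      ⟨R, fun z hz => hR _ (right_ne_zero_of_mul hz)⟩⟩
    rw [norm_mul]
    gcongr
    exacts [hM₁ _, hk1 _]
  have hG : BddSupp (fun p : ℝ × ℝ => f₂ p.2 * f₃ (s * p.1 + p.2)) := by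
    obtain ⟨M₂, a₂, hM₂⟩ := h₂.bdd
    obtain ⟨M₃, a₃, hM₃⟩ := h₃.bdd
    obtain ⟨R, hR⟩ := h₂.supp
    have m2 := h₂.measurable
    have m3 := h₃.measurable
    refine ⟨by fun_prop, ⟨M₂ * M₃, by positivity, fun z => ?_⟩, ⟨max ((5 + R) / s) R,
      fun z hz => ?_⟩⟩
    · rw [norm_mul]
      gcongr
      exacts [hM₂ _, hM₃ _]
    · have b1 := hR _ (left_ne_zero_of_mul hz)
      have b2 := s₃ _ (right_ne_zero_of_mul hz)
      rw [Prod.norm_def]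
      refine max_le_max ?_ b1
      rw [le_div_iff₀ hs]
      rw [Real.norm_eq_abs] at *
      have := abs_sub (s * z.1 + z.2) z.2
      rw [add_sub_cancel_right, abs_mul, abs_of_pos hs] at this
      linarith
  -- With f₁k paired against f₂f₃, the strip has length 2δ in η for each ξ, and the change of
  -- variable in ξ costs s⁻¹.
  have hcs := norm_integral_mul_sq_le hF.memLp_two hG.memLp_two
  have hform : trilinearForm k s f₁ f₂ f₃ =
      ∫ p : ℝ × ℝ, (f₁ p.1 * k p) * (f₂ p.2 * f₃ (s * p.1 + p.2)) := by
    unfold trilinearForm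
    refine integral_congr_ae (ae_of_all _ fun p => ?_)
    simp only
    ring
  have hf2 := (h₁.norm.pow two_ne_zero).integrable
  have hFle : ∫ p : ℝ × ℝ, ‖f₁ p.1 * k p‖ ^ 2 ≤ 2 * δ * ∫ x, ‖f₁ x‖ ^ 2 := by
    have hFi := (hF.norm.pow two_ne_zero).integrable
    have hFi' := hFi
    rw [Measure.volume_eq_prod] at hFi' ⊢
    rw [integral_prod _ hFi', ← integral_const_mul]
    refine integral_mono_of_nonneg (ae_of_all _ fun x => integral_nonneg fun _ => by positivity)
      (hf2.const_mul _) (ae_of_all _ fun x => ?_)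
    simp only
    calc ∫ y, ‖f₁ x * k (x, y)‖ ^ 2 ≤
        ∫ y, (Icc (-δ - c * x) (δ - c * x)).indicator (fun _ => ‖f₁ x‖ ^ 2) y := by
          refine integral_mono_of_nonneg (ae_of_all _ fun _ => by positivity) ?_
            (ae_of_all _ fun y => ?_)
          · exact (integrable_indicator_iff measurableSet_Icc).2
              (integrableOn_const (by simp))
          · by_cases hky : k (x, y) = 0
            · simp only [hky, mul_zero, norm_zero, zero_pow two_ne_zero]
              exact indicator_nonneg (fun _ _ => by positivity) _
            · have := abs_le.1 (hsupp _ hky)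
              simp only at this
              rw [indicator_of_mem (mem_Icc.2 ⟨by linarith, by linarith⟩)]
              beta_reduce
              rw [norm_mul]
              have := hk1 (x, y)
              have h0 := norm_nonneg (f₁ x)
              have h00 := norm_nonneg (k (x, y))
              exact pow_le_pow_left₀ (by positivity) (mul_le_of_le_one_right h0 this) 2
      _ = 2 * δ * ‖f₁ x‖ ^ 2 := by
          rw [integral_indicator measurableSet_Icc]
          simp only [integral_const, MeasurableSet.univ, measureReal_restrict_apply, univ_inter,
            Real.volume_real_Icc, smul_eq_mul]
          rw [max_eq_left (by linarith)]
          ring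
  have hGeq : ∫ p : ℝ × ℝ, ‖f₂ p.2 * f₃ (s * p.1 + p.2)‖ ^ 2 =
      s⁻¹ * (∫ x, ‖f₂ x‖ ^ 2) * ∫ x, ‖f₃ x‖ ^ 2 := by
    have hGi := (hG.norm.pow two_ne_zero).integrable
    rw [Measure.volume_eq_prod] at hGi ⊢
    rw [integral_prod_symm _ hGi]
    have : ∀ y, ∫ x, ‖f₂ y * f₃ (s * x + y)‖ ^ 2 =
        ‖f₂ y‖ ^ 2 * (s⁻¹ * ∫ v, ‖f₃ v‖ ^ 2) := fun y => by
      simp only [norm_mul, mul_pow]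
      rw [integral_const_mul, Measure.integral_comp_mul_left (fun τ => ‖f₃ (τ + y)‖ ^ 2),
        integral_add_right_eq_self (fun v => ‖f₃ v‖ ^ 2), abs_of_pos (inv_pos.2 hs), smul_eq_mul]
    simp only [this]
    rw [integral_mul_const]
    ring
  have h2 := integral_sq_norm_sq_le (by norm_num) h₁ s₁
  have i1 : 0 ≤ ∫ x, ‖f₁ x‖ ^ 2 := integral_nonneg fun _ => by positivity
  have i2 : 0 ≤ ∫ x, ‖f₂ x‖ ^ 2 := integral_nonneg fun _ => by positivity
  have i3 : 0 ≤ ∫ x, ‖f₃ x‖ ^ 2 := integral_nonneg fun _ => by positivity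
  calc _ = (‖trilinearForm k s f₁ f₂ f₃‖ ^ 2) ^ 2 := by rw [← pow_mul]
    _ ≤ ((2 * δ * ∫ x, ‖f₁ x‖ ^ 2) * (s⁻¹ * (∫ x, ‖f₂ x‖ ^ 2) * ∫ x, ‖f₃ x‖ ^ 2)) ^ 2 := by
        refine pow_le_pow_left₀ (by positivity) ?_ 2
        rw [hform]
        refine hcs.trans ?_
        rw [hGeq]
        gcongr
    _ = 4 * δ ^ 2 * s⁻¹ ^ 2 * (∫ x, ‖f₂ x‖ ^ 2) ^ 2 * (∫ x, ‖f₃ x‖ ^ 2) ^ 2 *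
          (∫ x, ‖f₁ x‖ ^ 2) ^ 2 := by ring
    _ ≤ 4 * δ ^ 2 * s⁻¹ ^ 2 * (∫ x, ‖f₂ x‖ ^ 2) ^ 2 * (∫ x, ‖f₃ x‖ ^ 2) ^ 2 *
          (2 * 5 * ∫ x, ‖f₁ x‖ ^ 4) := by gcongr
    _ = _ := by ring

/-! ### Extension to L⁴ × L² × L². -/

/-- Truncation of a function in height and to `[-5, 5]`. -/
noncomputable def truncation (f : ℝ → ℂ) (n : ℕ) : ℝ → ℂ :=
  {x | ‖f x‖ ≤ n ∧ |x| ≤ 5}.indicator f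

lemma bddSupp_truncation {f : ℝ → ℂ} (hf : Measurable f) (n : ℕ) : BddSupp (truncation f n) := by
  refine ⟨hf.indicator ?_, ⟨n, n.cast_nonneg, fun x => ?_⟩, ⟨5, fun x hx => ?_⟩⟩
  · exact (measurableSet_le hf.norm measurable_const).inter
      (measurableSet_le continuous_abs.measurable measurable_const)
  · unfold truncation
    by_cases h : x ∈ {x | ‖f x‖ ≤ n ∧ |x| ≤ 5}
    · rw [indicator_of_mem h]; exact h.1
    · rw [indicator_of_notMem h, norm_zero]; exact n.cast_nonneg
  · exact (mem_of_indicator_ne_zero hx).2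

lemma norm_truncation_le (f : ℝ → ℂ) (n : ℕ) (x : ℝ) : ‖truncation f n x‖ ≤ ‖f x‖ :=
  norm_indicator_le_norm_self _ _

lemma eventually_truncation_eq (f : ℝ → ℂ) {x : ℝ} (hx : |x| ≤ 5) :
    ∀ᶠ n in atTop, truncation f n x = f x := by
  obtain ⟨N, hN⟩ := exists_nat_ge ‖f x‖
  filter_upwards [eventually_ge_atTop N] with n hn
  have hNn : (N : ℝ) ≤ n := by exact_mod_cast hn
  exact indicator_of_mem (s := {x | ‖f x‖ ≤ n ∧ |x| ≤ 5}) ⟨hN.trans hNn, hx⟩ f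

lemma triNorm_truncation_le {f₁ f₂ f₃ : ℝ → ℂ} (h₁ : MemLp f₁ 4) (h₂ : MemLp f₂ 2)
    (h₃ : MemLp f₃ 2) (n : ℕ) :
    triNorm (truncation f₁ n) (truncation f₂ n) (truncation f₃ n) ≤ triNorm f₁ f₂ f₃ := by
  have key : ∀ {f : ℝ → ℂ} {m : ℕ}, MemLp f m → m ≠ 0 →
      ∫ x, ‖truncation f n x‖ ^ m ≤ ∫ x, ‖f x‖ ^ m := fun {f m} h hm =>
    integral_mono_of_nonneg (ae_of_all _ fun _ => by positivity) (h.integrable_norm_pow hm)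
      (ae_of_all _ fun x => pow_le_pow_left₀ (norm_nonneg _) (norm_truncation_le f n x) m)
  have h1 : 0 ≤ ∫ x, ‖truncation f₁ n x‖ ^ 4 := integral_nonneg fun _ => by positivity
  have h2 : 0 ≤ ∫ x, ‖truncation f₂ n x‖ ^ 2 := integral_nonneg fun _ => by positivity
  have h3 : 0 ≤ ∫ x, ‖truncation f₃ n x‖ ^ 2 := integral_nonneg fun _ => by positivity
  have h1' : 0 ≤ ∫ x, ‖f₁ x‖ ^ 4 := integral_nonneg fun _ => by positivity
  have h2' : 0 ≤ ∫ x, ‖f₂ x‖ ^ 2 := integral_nonneg fun _ => by positivity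
  have k1 := key (m := 4) h₁ (by norm_num)
  have k2 := key (m := 2) h₂ (by norm_num)
  have k3 := key (m := 2) h₃ (by norm_num)
  unfold triNorm
  gcongr

section

variable {f₁ f₂ f₃ : ℝ → ℂ} {k : ℝ × ℝ → ℂ} {s A : ℝ}

/-- Since |f₂f₃| ≤ |f₂|² + |f₃|² and the shear (ξ,η) ↦ (ξ, sξ + η) preserves measure, the integrand
is dominated by products of integrable functions of one variable. -/
lemma integrable_trilinear (h₁ : MemLp f₁ 4) (h₂ : MemLp f₂ 2) (h₃ : MemLp f₃ 2)
    (m₁ : Measurable f₁) (m₂ : Measurable f₂) (m₃ : Measurable f₃) (hk : BddSupp k)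
    (hsupp : ∀ p, k p ≠ 0 → |p.1| ≤ 3) :
    Integrable (fun p : ℝ × ℝ => f₁ p.1 * f₂ p.2 * f₃ (s * p.1 + p.2) * k p) := by
  have m := hk.measurable
  obtain ⟨M, hM0, hM⟩ := hk.bdd
  set g : ℝ → ℝ := (Icc (-3) 3).indicator (fun x => ‖f₁ x‖) with hg
  have hgi : Integrable g := by
    rw [hg, integrable_indicator_iff measurableSet_Icc]
    exact ((h₁.restrict _).integrable (by norm_num)).norm
  have i2 : Integrable (fun x => ‖f₂ x‖ ^ 2) := h₂.integrable_norm_pow two_ne_zero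
  have i3 : Integrable (fun x => ‖f₃ x‖ ^ 2) := h₃.integrable_norm_pow two_ne_zero
  have d2 : Integrable (fun p : ℝ × ℝ => g p.1 * ‖f₂ p.2‖ ^ 2) := hgi.mul_prod i2
  have d3 : Integrable (fun p : ℝ × ℝ => g p.1 * ‖f₃ (s * p.1 + p.2)‖ ^ 2) :=
    (measurePreserving_shear s).integrable_comp_of_integrable (hgi.mul_prod i3)
  refine ((d2.add d3).const_mul M).mono' (by fun_prop) (ae_of_all _ fun p => ?_)
  simp only [norm_mul, Pi.add_apply]
  by_cases hp : k p = 0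
  · have hg0 : 0 ≤ g p.1 := indicator_nonneg (fun _ _ => norm_nonneg _) _
    simp only [hp, norm_zero, mul_zero]
    positivity
  · have hgp : g p.1 = ‖f₁ p.1‖ := indicator_of_mem (mem_Icc.2 (abs_le.1 (hsupp p hp))) _
    rw [hgp]
    have hab : ‖f₂ p.2‖ * ‖f₃ (s * p.1 + p.2)‖ ≤
        ‖f₂ p.2‖ ^ 2 + ‖f₃ (s * p.1 + p.2)‖ ^ 2 := by
      nlinarith [sq_nonneg (‖f₂ p.2‖ - ‖f₃ (s * p.1 + p.2)‖), sq_nonneg ‖f₂ p.2‖,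
        sq_nonneg ‖f₃ (s * p.1 + p.2)‖]
    calc _ = ‖f₁ p.1‖ * (‖f₂ p.2‖ * ‖f₃ (s * p.1 + p.2)‖) * ‖k p‖ := by ring
      _ ≤ ‖f₁ p.1‖ * (‖f₂ p.2‖ ^ 2 + ‖f₃ (s * p.1 + p.2)‖ ^ 2) * M := by
          gcongr
          exact hM p
      _ = _ := by ring

lemma TrilinearBound.norm_le_of_measurable (hA : TrilinearBound k s A) (hA0 : 0 ≤ A)
    (h₁ : MemLp f₁ 4) (h₂ : MemLp f₂ 2) (h₃ : MemLp f₃ 2)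
    (m₁ : Measurable f₁) (m₂ : Measurable f₂) (m₃ : Measurable f₃) (hk : BddSupp k)
    (hs : 0 < s) (hs1 : s ≤ 1) (hsupp : ∀ p, k p ≠ 0 → |p.1| ≤ 3 ∧ |p.2| ≤ 2) :
    ‖trilinearForm k s f₁ f₂ f₃‖ ≤ A * triNorm f₁ f₂ f₃ := by
  have hint := integrable_trilinear (s := s) h₁ h₂ h₃ m₁ m₂ m₃ hk (fun p hp => (hsupp p hp).1)
  have hlim : Tendsto (fun n => trilinearForm k s (truncation f₁ n) (truncation f₂ n)
      (truncation f₃ n)) atTop (𝓝 (trilinearForm k s f₁ f₂ f₃)) := by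
    refine tendsto_integral_of_dominated_convergence _ (fun n => ?_) hint.norm
      (fun n => ae_of_all _ fun p => ?_) (ae_of_all _ fun p => ?_)
    · exact (bddSupp_trilinear (bddSupp_truncation m₁ n) (bddSupp_truncation m₂ n)
        (bddSupp_truncation m₃ n) hk s).measurable.aestronglyMeasurable
    · simp only [norm_mul]
      gcongr <;> exact norm_truncation_le _ _ _
    · by_cases hp : k p = 0
      · simp only [hp, mul_zero]
        exact tendsto_const_nhds
      · obtain ⟨b1, b2⟩ := hsupp p hp
        -- On the support of k one has |sξ + η| ≤ 3 + 2, which is why truncation and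
        -- `TrilinearBound` use [-5,5].
        have b3 : |s * p.1 + p.2| ≤ 5 := by
          refine (abs_add_le _ _).trans ?_
          rw [abs_mul, abs_of_pos hs]
          nlinarith [abs_nonneg p.1]
        refine tendsto_const_nhds.congr' ?_
        filter_upwards [eventually_truncation_eq f₁ (b1.trans (by norm_num)),
          eventually_truncation_eq f₂ (b2.trans (by norm_num)),
          eventually_truncation_eq f₃ b3] with n e1 e2 e3
        rw [e1, e2, e3]
  refine le_of_tendsto hlim.norm (Eventually.of_forall fun n => ?_)
  refine (hA _ _ _ (bddSupp_truncation m₁ n) (bddSupp_truncation m₂ n) (bddSupp_truncation m₃ n)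
    (fun x hx => (mem_of_indicator_ne_zero hx).2)
    (fun x hx => (mem_of_indicator_ne_zero hx).2)).trans ?_
  exact mul_le_mul_of_nonneg_left (triNorm_truncation_le h₁ h₂ h₃ n) hA0

/-- A trilinear bound on bounded functions extends to `L⁴ × L² × L²`. -/
theorem TrilinearBound.norm_le (hA : TrilinearBound k s A) (hA0 : 0 ≤ A)
    (h₁ : MemLp f₁ 4) (h₂ : MemLp f₂ 2) (h₃ : MemLp f₃ 2) (hk : BddSupp k)
    (hs : 0 < s) (hs1 : s ≤ 1) (hsupp : ∀ p, k p ≠ 0 → |p.1| ≤ 3 ∧ |p.2| ≤ 2) :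
    Integrable (fun p : ℝ × ℝ => f₁ p.1 * f₂ p.2 * f₃ (s * p.1 + p.2) * k p) ∧
      ‖trilinearForm k s f₁ f₂ f₃‖ ≤ A * triNorm f₁ f₂ f₃ := by
  obtain ⟨g₁, sg₁, e₁⟩ := h₁.aestronglyMeasurable
  obtain ⟨g₂, sg₂, e₂⟩ := h₂.aestronglyMeasurable
  obtain ⟨g₃, sg₃, e₃⟩ := h₃.aestronglyMeasurable
  have hg₁ := (memLp_congr_ae e₁).1 h₁
  have hg₂ := (memLp_congr_ae e₂).1 h₂
  have hg₃ := (memLp_congr_ae e₃).1 h₃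
  have q₁ : ∀ᵐ p : ℝ × ℝ, f₁ p.1 = g₁ p.1 :=
    (Measure.quasiMeasurePreserving_fst (μ := volume) (ν := volume)).ae e₁
  have q₂ : ∀ᵐ p : ℝ × ℝ, f₂ p.2 = g₂ p.2 :=
    (Measure.quasiMeasurePreserving_snd (μ := volume) (ν := volume)).ae e₂
  have q₃ : ∀ᵐ p : ℝ × ℝ, f₃ (s * p.1 + p.2) = g₃ (s * p.1 + p.2) :=
    ((Measure.quasiMeasurePreserving_snd (μ := volume) (ν := volume)).comp
      (measurePreserving_shear s).quasiMeasurePreserving).ae e₃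
  have hae : (fun p : ℝ × ℝ => f₁ p.1 * f₂ p.2 * f₃ (s * p.1 + p.2) * k p) =ᵐ[volume]
      fun p : ℝ × ℝ => g₁ p.1 * g₂ p.2 * g₃ (s * p.1 + p.2) * k p := by
    filter_upwards [q₁, q₂, q₃] with p a b c
    rw [a, b, c]
  have hn : triNorm f₁ f₂ f₃ = triNorm g₁ g₂ g₃ := by
    unfold triNorm
    congr 1
    · congr 2
      · exact integral_congr_ae (by filter_upwards [e₁] with x hx; rw [hx])
      · exact integral_congr_ae (by filter_upwards [e₂] with x hx; rw [hx])
    · congr 1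
      exact integral_congr_ae (by filter_upwards [e₃] with x hx; rw [hx])
  have hf : trilinearForm k s f₁ f₂ f₃ = trilinearForm k s g₁ g₂ g₃ := integral_congr_ae hae
  rw [hn, hf, integrable_congr hae]
  exact ⟨integrable_trilinear hg₁ hg₂ hg₃ sg₁.measurable sg₂.measurable sg₃.measurable hk
    (fun p hp => (hsupp p hp).1),
    hA.norm_le_of_measurable hA0 hg₁ hg₂ hg₃ sg₁.measurable sg₂.measurable sg₃.measurable hk
      hs hs1 hsupp⟩

end

lemma triNorm_eq_eLpNorm {f₁ f₂ f₃ : ℝ → ℂ} (h₁ : MemLp f₁ 4) (h₂ : MemLp f₂ 2)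
    (h₃ : MemLp f₃ 2) :
    triNorm f₁ f₂ f₃ = (eLpNorm f₁ 4 volume).toReal * (eLpNorm f₂ 2 volume).toReal *
      (eLpNorm f₃ 2 volume).toReal := by
  have e2 : ∀ {f : ℝ → ℂ}, MemLp f 2 → (eLpNorm f 2 volume).toReal =
      (∫ x, ‖f x‖ ^ 2) ^ (1 / 2 : ℝ) := fun {f} h => by
    rw [h.eLpNorm_eq_integral_rpow_norm (by norm_num) (by norm_num), ENNReal.toReal_ofReal]
    · norm_num
    · have : 0 ≤ ∫ x, ‖f x‖ ^ (2 : ENNReal).toReal := integral_nonneg fun _ => by positivity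
      positivity
  have e4 : (eLpNorm f₁ 4 volume).toReal = (∫ x, ‖f₁ x‖ ^ 4) ^ (1 / 4 : ℝ) := by
    rw [h₁.eLpNorm_eq_integral_rpow_norm (by norm_num) (by norm_num), ENNReal.toReal_ofReal]
    · have : (4 : ENNReal).toReal = ((4 : ℕ) : ℝ) := by norm_num
      simp only [this, Real.rpow_natCast]
      norm_num
    · have : 0 ≤ ∫ x, ‖f₁ x‖ ^ (4 : ENNReal).toReal := integral_nonneg fun _ => by positivity
      positivity
  rw [e2 h₂, e2 h₃, e4, triNorm]

/-! ### Convexity of the critical domain and removal of the degenerate strip. -/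

/-- The closed half plane `α ξ + γ η + c ≤ 0`. -/
def halfPlane (α γ c : ℝ) : Set (ℝ × ℝ) := {p | α * p.1 + γ * p.2 + c ≤ 0}

lemma convex_halfPlane (α γ c : ℝ) : Convex ℝ (halfPlane α γ c) := by
  intro x hx y hy a b ha hb hab
  simp only [halfPlane, mem_ofPred_eq, Prod.fst_add, Prod.snd_add, Prod.smul_fst, Prod.smul_snd,
    smul_eq_mul] at *
  have h1 := mul_le_mul_of_nonneg_left hx ha
  have h2 := mul_le_mul_of_nonneg_left hy hb
  have h3 : c = a * c + b * c := by rw [← add_mul, hab, one_mul]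
  linarith

lemma isClosed_halfPlane (α γ c : ℝ) : IsClosed (halfPlane α γ c) :=
  isClosed_le (by fun_prop) continuous_const

namespace SmallPhase

variable {ε : ℝ} {w w₁ w₂ w₃ w₄ : ℝ → ℝ}

/-- The conditions on the root become linear at the fixed times 1/16 and 9/16, where `w₁`
contributes only constants. -/
lemma critDomain_eq (h : SmallPhase ε w w₁ w₂ w₃ w₄) : critDomain w₁ =
    halfPlane 0 (-1) (1 / 2) ∩ halfPlane 0 1 (-2) ∩ halfPlane 1 (1 / 8) (w₁ (1 / 16)) ∩
      halfPlane (-1) (-9 / 8) (-w₁ (9 / 16)) := by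
  ext p
  have e1 : (1 / 16 : ℝ) ∈ Icc (1 / 20 : ℝ) (7 / 10) := ⟨by norm_num, by norm_num⟩
  have e2 : (9 / 16 : ℝ) ∈ Icc (1 / 20 : ℝ) (7 / 10) := ⟨by norm_num, by norm_num⟩
  simp only [critDomain, halfPlane, mem_inter_iff, mem_ofPred_eq, mem_Icc]
  constructor
  · rintro ⟨⟨a, b⟩, c, d⟩
    have hη : 3 / 8 ≤ p.2 := by linarith
    rw [h.le_critRoot_iff hη e1] at c
    rw [h.critRoot_le_iff hη e2] at d
    refine ⟨⟨⟨?_, ?_⟩, ?_⟩, ?_⟩ <;> linarith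
  · rintro ⟨⟨⟨a, b⟩, c⟩, d⟩
    have hη : 3 / 8 ≤ p.2 := by linarith
    rw [h.le_critRoot_iff hη e1, h.critRoot_le_iff hη e2]
    refine ⟨⟨?_, ?_⟩, ?_, ?_⟩ <;> linarith

lemma convex_critDomain (h : SmallPhase ε w w₁ w₂ w₃ w₄) : Convex ℝ (critDomain w₁) := by
  rw [h.critDomain_eq]
  exact (((convex_halfPlane _ _ _).inter (convex_halfPlane _ _ _)).inter
    (convex_halfPlane _ _ _)).inter (convex_halfPlane _ _ _)

lemma isClosed_critDomain (h : SmallPhase ε w w₁ w₂ w₃ w₄) : IsClosed (critDomain w₁) := by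
  rw [h.critDomain_eq]
  exact (((isClosed_halfPlane _ _ _).inter (isClosed_halfPlane _ _ _)).inter
    (isClosed_halfPlane _ _ _)).inter (isClosed_halfPlane _ _ _)

lemma mem_of_phaseKernel_ne_zero {D : Set (ℝ × ℝ)} {lam : ℝ} {p : ℝ × ℝ}
    (hp : phaseKernel w w₁ D lam p ≠ 0) : p ∈ D := by
  unfold phaseKernel at hp
  exact mem_of_indicator_ne_zero hp

lemma bddSupp_phaseKernel (h : SmallPhase ε w w₁ w₂ w₃ w₄) {D : Set (ℝ × ℝ)}
    (hD : MeasurableSet D) (hsub : D ⊆ critDomain w₁) (lam : ℝ) :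
    BddSupp (phaseKernel w w₁ D lam) := by
  refine ⟨h.measurable_phaseKernel hD lam, ⟨1, zero_le_one, norm_phaseKernel_le D lam⟩,
    ⟨3, fun p hp => ?_⟩⟩
  have hp' := hsub (mem_of_phaseKernel_ne_zero hp)
  have h1 := h.fst_mem hp'
  rw [Prod.norm_def]
  refine max_le (abs_le.2 ⟨h1.1, by linarith [h1.2]⟩) (abs_le.2 ⟨?_, ?_⟩)
  · linarith [hp'.1.1]
  · linarith [hp'.1.2]

lemma norm_quarticCorrelation_le_three (h : SmallPhase ε w w₁ w₂ w₃ w₄) {D : Set (ℝ × ℝ)}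
    (hsub : D ⊆ critDomain w₁) (lam s τ u u' : ℝ) :
    ‖quarticCorrelation (phaseKernel w w₁ D lam) s τ u u'‖ ≤ 3 := by
  unfold quarticCorrelation
  rw [← setIntegral_eq_integral_of_forall_compl_eq_zero (s := Icc (-3 : ℝ) 0)]
  · have := norm_setIntegral_le_of_norm_le_const (μ := volume) (s := Icc (-3 : ℝ) 0) (C := 1)
      (f := fun ξ => (phaseKernel w w₁ D lam (ξ, u - s * ξ) *
        conj (phaseKernel w w₁ D lam (ξ + τ, u - s * ξ))) *
        conj (phaseKernel w w₁ D lam (ξ, u' - s * ξ) *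
          conj (phaseKernel w w₁ D lam (ξ + τ, u' - s * ξ)))) (by simp) (fun ξ _ => by
        simp only [norm_mul, RCLike.norm_conj]
        have hk := norm_phaseKernel_le (w := w) (w₁ := w₁) D lam
        exact mul_le_one₀ (mul_le_one₀ (hk _) (norm_nonneg _) (hk _)) (by positivity)
          (mul_le_one₀ (hk _) (norm_nonneg _) (hk _)))
    refine this.trans_eq ?_
    simp
  · intro ξ hξ
    have : phaseKernel w w₁ D lam (ξ, u - s * ξ) = 0 := by
      by_contra hne
      exact hξ (h.fst_mem (hsub (mem_of_phaseKernel_ne_zero hne)))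
    simp [this]

/-- With v = |τ||u - u'|, the decay v⁻¹ is not integrable; interpolating it with the trivial bound 3
gives v^{-p}, p < 1. The constant is 60000 = 3 · 20000. -/
lemma trilinearBound_phaseKernel (h : SmallPhase ε w w₁ w₂ w₃ w₄) {D : Set (ℝ × ℝ)}
    (hconv : Convex ℝ D) (hclosed : IsClosed D) (hsub : D ⊆ critDomain w₁)
    {s δ : ℝ} (hs : 0 < s) (hs1 : s ≤ 1) (hδ0 : 0 < δ)
    (hδ : ∀ p ∈ D, δ ≤ |1 - 4 * s * critRoot w₁ p.1 p.2|) (hδε : 100 * ε ≤ δ)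
    {lam p : ℝ} (hlam : lam ≠ 0) (hp0 : 0 ≤ p) (hp1 : p < 1) :
    TrilinearBound (phaseKernel w w₁ D lam) s ((60000 * (|lam| * δ ^ 2) ^ (-p) *
      (∫ v, singularWeight p (2 * 5) v) ^ 2 * s⁻¹) ^ (1 / 4 : ℝ)) := by
  have hl := abs_pos.2 hlam
  refine trilinearBound_of_correlation (h.bddSupp_phaseKernel hclosed.measurableSet hsub lam) hs
    (by positivity) hp1 (fun τ u u' hτ hu => ?_)
  have h1 := h.norm_quarticCorrelation_le hconv hclosed hsub hs hs1 hδ0 hδ hδε hlam hτ hu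
  have h3 := h.norm_quarticCorrelation_le_three hsub lam s τ u u'
  set q := ‖quarticCorrelation (phaseKernel w w₁ D lam) s τ u u'‖
  have hq : 0 ≤ q := norm_nonneg _
  have hv : 0 < |τ| * |u - u'| := by
    have := abs_pos.2 hτ
    have := abs_pos.2 (sub_ne_zero.2 hu)
    positivity
  set v := |τ| * |u - u'|
  have hL : 0 < |lam| * δ ^ 2 := by positivity
  set L := |lam| * δ ^ 2
  have e1 : q = q ^ (1 - p) * q ^ p := by
    rw [← Real.rpow_add' hq (by norm_num)]
    norm_num
  have e2 : q ^ (1 - p) ≤ 3 := by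
    calc q ^ (1 - p) ≤ 3 ^ (1 - p) := Real.rpow_le_rpow hq h3 (by linarith)
      _ ≤ 3 ^ (1 : ℝ) := Real.rpow_le_rpow_of_exponent_le (by norm_num) (by linarith)
      _ = 3 := Real.rpow_one _
  have e3 : q ^ p ≤ 20000 * (L ^ (-p) * v ^ (-p)) := by
    calc q ^ p ≤ (20000 / (L * v)) ^ p := Real.rpow_le_rpow hq h1 hp0
      _ = 20000 ^ p * (L ^ (-p) * v ^ (-p)) := by
          rw [Real.div_rpow (by norm_num) (by positivity), Real.mul_rpow hL.le hv.le,
            Real.rpow_neg hL.le, Real.rpow_neg hv.le, ← mul_inv, div_eq_mul_inv]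
      _ ≤ _ := by
          gcongr
          calc (20000 : ℝ) ^ p ≤ 20000 ^ (1 : ℝ) :=
                Real.rpow_le_rpow_of_exponent_le (by norm_num) hp1.le
            _ = 20000 := Real.rpow_one _
  calc q = q ^ (1 - p) * q ^ p := e1
    _ ≤ 3 * (20000 * (L ^ (-p) * v ^ (-p))) := by gcongr
    _ = _ := by ring

/-- Here 4sT ≤ 9/16, so δ = 7/16 works on the whole critical domain. -/
lemma trilinearBound_of_le_quarter (h : SmallPhase ε w w₁ w₂ w₃ w₄)
    {s : ℝ} (hs : 0 < s) (hs1 : s ≤ 1 / 4)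
    {lam p : ℝ} (hlam : lam ≠ 0) (hp0 : 0 ≤ p) (hp1 : p < 1) :
    TrilinearBound (phaseKernel w w₁ (critDomain w₁) lam) s
      ((60000 * (|lam| * (7 / 16) ^ 2) ^ (-p) *
        (∫ v, singularWeight p (2 * 5) v) ^ 2 * s⁻¹) ^ (1 / 4 : ℝ)) := by
  refine h.trilinearBound_phaseKernel h.convex_critDomain h.isClosed_critDomain subset_rfl hs
    (by linarith) (by norm_num) (fun q hq => ?_) (by linarith [h.eps_le]) hlam hp0 hp1
  refine le_trans ?_ (le_abs_self _)
  have := hq.2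
  nlinarith [this.1, this.2]

/-- The critical equation gives η + 2sξ = η(1 - 4sT) - 2s w₁(T). Hence the degenerate set 4sT = 1 is
close to a line, and half planes can separate it without losing convexity. -/
lemma abs_linear_le (h : SmallPhase ε w w₁ w₂ w₃ w₄) {s : ℝ} (hs : 0 < s) (hs1 : s ≤ 1)
    {p : ℝ × ℝ} (hp : p ∈ critDomain w₁) :
    |p.2 + 2 * s * p.1| ≤ 2 * |1 - 4 * s * critRoot w₁ p.1 p.2| + 2 * ε := by
  have h0 := h.critRoot_zero' hp
  have h1 := h.bound₁ _ (mem_dom_of_mem hp)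
  have hp2 := hp.1
  set T := critRoot w₁ p.1 p.2
  have : p.2 + 2 * s * p.1 = p.2 * (1 - 4 * s * T) - 2 * s * w₁ T := by
    linear_combination 2 * s * h0
  rw [this]
  refine (abs_sub _ _).trans (add_le_add ?_ ?_)
  · rw [abs_mul, abs_of_pos (by linarith [hp2.1])]
    exact mul_le_mul_of_nonneg_right hp2.2 (abs_nonneg _)
  · rw [abs_mul, abs_of_pos (by linarith)]
    have := abs_nonneg (w₁ T)
    nlinarith

/-- On the two half-plane pieces |1 - 4sT| ≥ δ/2 - ε ≥ δ/4, and 400ε ≤ δ is the smallness needed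
with δ/4 in place of δ. The strip between them is estimated by its width. -/
lemma trilinearBound_with_strip (h : SmallPhase ε w w₁ w₂ w₃ w₄)
    {s δ : ℝ} (hs : 0 < s) (hs1 : s ≤ 1) (hδ0 : 0 < δ) (hδε : 400 * ε ≤ δ)
    {lam p : ℝ} (hlam : lam ≠ 0) (hp0 : 0 ≤ p) (hp1 : p < 1) :
    TrilinearBound (phaseKernel w w₁ (critDomain w₁) lam) s
      (2 * (60000 * (|lam| * (δ / 4) ^ 2) ^ (-p) *
        (∫ v, singularWeight p (2 * 5) v) ^ 2 * s⁻¹) ^ (1 / 4 : ℝ) +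
        (40 * δ ^ 2 * s⁻¹ ^ 2) ^ (1 / 4 : ℝ)) := by
  set D := critDomain w₁ with hD
  set Dp := D ∩ halfPlane (-(2 * s)) (-1) δ with hDp
  set Dm := D ∩ halfPlane (2 * s) 1 δ with hDm
  set S := D ∩ {p | |p.2 + 2 * s * p.1| < δ} with hSdef
  have hlow : ∀ q ∈ D, δ ≤ |q.2 + 2 * s * q.1| →
      δ / 4 ≤ |1 - 4 * s * critRoot w₁ q.1 q.2| := fun q hq hge => by
    have := h.abs_linear_le hs hs1 hq
    have := h.eps_nonneg
    linarith
  have bp : TrilinearBound (phaseKernel w w₁ Dp lam) s _ :=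
    h.trilinearBound_phaseKernel (h.convex_critDomain.inter (convex_halfPlane _ _ _))
      (h.isClosed_critDomain.inter (isClosed_halfPlane _ _ _)) inter_subset_left hs hs1
      (by positivity : 0 < δ / 4) (fun q hq => hlow q hq.1 (by
        have := hq.2
        simp only [halfPlane, mem_ofPred_eq] at this
        exact le_trans (by linarith) (le_abs_self _))) (by linarith) hlam hp0 hp1
  have bm : TrilinearBound (phaseKernel w w₁ Dm lam) s _ :=
    h.trilinearBound_phaseKernel (h.convex_critDomain.inter (convex_halfPlane _ _ _))
      (h.isClosed_critDomain.inter (isClosed_halfPlane _ _ _)) inter_subset_left hs hs1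
      (by positivity : 0 < δ / 4) (fun q hq => hlow q hq.1 (by
        have := hq.2
        simp only [halfPlane, mem_ofPred_eq] at this
        exact le_trans (by linarith) (neg_le_abs _))) (by linarith) hlam hp0 hp1
  have mS : MeasurableSet S := h.isClosed_critDomain.measurableSet.inter
    (isOpen_lt (by fun_prop) continuous_const).measurableSet
  have kS : BddSupp (phaseKernel w w₁ S lam) := h.bddSupp_phaseKernel mS inter_subset_left lam
  have kp : BddSupp (phaseKernel w w₁ Dp lam) := h.bddSupp_phaseKernel
    (h.isClosed_critDomain.inter (isClosed_halfPlane _ _ _)).measurableSet inter_subset_left lam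
  have km : BddSupp (phaseKernel w w₁ Dm lam) := h.bddSupp_phaseKernel
    (h.isClosed_critDomain.inter (isClosed_halfPlane _ _ _)).measurableSet inter_subset_left lam
  have bS : TrilinearBound (phaseKernel w w₁ S lam) s _ :=
    trilinearBound_strip (δ := δ) (c := 2 * s) kS (norm_phaseKernel_le S lam) hs hδ0.le
      (fun q hq => (mem_of_phaseKernel_ne_zero hq).2.le)
  have kpm : BddSupp (fun q => phaseKernel w w₁ Dp lam q + phaseKernel w w₁ Dm lam q) := by
    refine ⟨kp.measurable.add km.measurable, ⟨1 + 1, by norm_num, fun q => ?_⟩, ⟨3, fun q hq => ?_⟩⟩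
    · exact (norm_add_le _ _).trans
        (add_le_add (norm_phaseKernel_le _ _ _) (norm_phaseKernel_le _ _ _))
    · have hqD : q ∈ D := by
        by_contra hn
        refine hq ?_
        unfold phaseKernel
        rw [indicator_of_notMem (fun h' => hn h'.1), indicator_of_notMem (fun h' => hn h'.1),
          add_zero]
      have h1 := h.fst_mem hqD
      rw [Prod.norm_def]
      refine max_le (abs_le.2 ⟨h1.1, by linarith [h1.2]⟩) (abs_le.2 ⟨?_, ?_⟩)
      · linarith [hqD.1.1]
      · linarith [hqD.1.2]
  have hsum := (bp.add kp km bm).add kpm kS bS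
  have hker : phaseKernel w w₁ D lam = fun q =>
      phaseKernel w w₁ Dp lam q + phaseKernel w w₁ Dm lam q + phaseKernel w w₁ S lam q := by
    ext q
    simp only [phaseKernel]
    by_cases hq : q ∈ D
    · rw [indicator_of_mem hq]
      rcases lt_or_ge |q.2 + 2 * s * q.1| δ with hlt | hge
      · have hlt' := abs_lt.1 hlt
        rw [indicator_of_notMem (s := Dp), indicator_of_notMem (s := Dm),
          indicator_of_mem (s := S) ⟨hq, hlt⟩, zero_add, zero_add]
        · rintro ⟨_, h2⟩
          simp only [halfPlane, mem_ofPred_eq] at h2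
          linarith
        · rintro ⟨_, h2⟩
          simp only [halfPlane, mem_ofPred_eq] at h2
          linarith
      · rw [indicator_of_notMem (s := S) (fun h' => absurd h'.2 (not_lt.2 hge)), add_zero]
        rcases le_abs.1 hge with h1 | h1
        · rw [indicator_of_mem (s := Dp), indicator_of_notMem (s := Dm), add_zero]
          · rintro ⟨_, h2⟩
            simp only [halfPlane, mem_ofPred_eq] at h2
            linarith
          · refine ⟨hq, ?_⟩
            simp only [halfPlane, mem_ofPred_eq]
            linarith
        · rw [indicator_of_notMem (s := Dp), indicator_of_mem (s := Dm), zero_add]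
          · refine ⟨hq, ?_⟩
            simp only [halfPlane, mem_ofPred_eq]
            linarith
          · rintro ⟨_, h2⟩
            simp only [halfPlane, mem_ofPred_eq] at h2
            linarith
    · rw [indicator_of_notMem hq, indicator_of_notMem (fun h' => hq h'.1),
        indicator_of_notMem (fun h' => hq h'.1), indicator_of_notMem (fun h' => hq h'.1)]
      simp
  rw [hker, two_mul]
  exact hsum

end SmallPhase

/-! ### The power perturbation and its size. -/

/-- The perturbation `-κ |t| ^ (-β)`. -/
noncomputable def powerPert (κ β t : ℝ) : ℝ := -κ * |t| ^ (-β)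

/-- The derivative of `powerPert` on the positive axis. -/
noncomputable def powerPertDeriv (κ β t : ℝ) : ℝ := κ * β * t ^ (-β - 1)

lemma hasDerivAt_const_mul_rpow (c e : ℝ) {t : ℝ} (ht : 0 < t) :
    HasDerivAt (fun t : ℝ => c * t ^ e) (c * e * t ^ (e - 1)) t := by
  refine ((Real.hasDerivAt_rpow_const (Or.inl ht.ne')).const_mul c).congr_deriv ?_
  ring

lemma hasDerivAt_powerPert (κ β : ℝ) {t : ℝ} (ht : 0 < t) :
    HasDerivAt (powerPert κ β) (powerPertDeriv κ β t) t := by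
  have h := hasDerivAt_const_mul_rpow (-κ) (-β) ht
  refine (h.congr_of_eventuallyEq ?_).congr_deriv ?_
  · filter_upwards [lt_mem_nhds ht] with x hx
    rw [powerPert, abs_of_pos hx]
  · unfold powerPertDeriv
    ring

lemma rpow_neg_sub_le {β a t : ℝ} (ht : t ∈ Ioo (1 / 32 : ℝ) 1) (ha4 : a ≤ 4)
    (hβa : 0 ≤ β + a) : t ^ (-β - a) ≤ 32 ^ (β + 4) := by
  have ht0 : 0 < t := by linarith [ht.1]
  have h1 : t⁻¹ ≤ 32 := by
    rw [inv_le_comm₀ ht0 (by norm_num)]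
    linarith [ht.1]
  calc t ^ (-β - a) = t⁻¹ ^ (β + a) := by
        rw [Real.inv_rpow ht0.le, ← Real.rpow_neg ht0.le]
        congr 1
        ring
    _ ≤ 32 ^ (β + a) := Real.rpow_le_rpow (by positivity) h1 hβa
    _ ≤ 32 ^ (β + 4) := Real.rpow_le_rpow_of_exponent_le (by norm_num) (by linarith)

/-- The coefficients are at most β(β+1)(β+2)(β+3) ≤ (4β)⁴ as β > 1, and t > 1/32 gives t^{-β-4} ≤
32^{β+4}. -/
lemma smallPhase_powerPert {κ β ε : ℝ} (hβ : 1 < β)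
    (hε : |κ| * (4 * β) ^ 4 * 32 ^ (β + 4) ≤ ε) (hε1 : ε ≤ 1 / 1000) :
    SmallPhase ε (powerPert κ β) (powerPertDeriv κ β)
      (fun t => -κ * β * (β + 1) * t ^ (-β - 2))
      (fun t => κ * β * (β + 1) * (β + 2) * t ^ (-β - 3))
      (fun t => -κ * β * (β + 1) * (β + 2) * (β + 3) * t ^ (-β - 4)) := by
  have hpos : ∀ {t : ℝ}, t ∈ Ioo (1 / 32 : ℝ) 1 → 0 < t := fun ht => by linarith [ht.1]
  have hbound : ∀ c a : ℝ, |c| ≤ |κ| * (4 * β) ^ 4 → 0 ≤ a → a ≤ 4 →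
      ∀ t ∈ Ioo (1 / 32 : ℝ) 1, |c * t ^ (-β - a)| ≤ ε := fun c a hc ha ha4 t ht => by
    have ht0 := hpos ht
    rw [abs_mul, abs_of_pos (Real.rpow_pos_of_pos ht0 _)]
    refine le_trans ?_ hε
    exact mul_le_mul hc (rpow_neg_sub_le ht ha4 (by linarith)) (by positivity) (by positivity)
  have hb0 : 0 < β := by linarith
  have hκ := abs_nonneg κ
  have p1 : β ≤ 4 * β := by linarith
  have p2 : β + 1 ≤ 4 * β := by linarith
  have p3 : β + 2 ≤ 4 * β := by linarith
  have p4 : β + 3 ≤ 4 * β := by linarith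
  have one4 : 1 ≤ 4 * β := by linarith
  have c1 : |κ * β| ≤ |κ| * (4 * β) ^ 4 := by
    rw [abs_mul, abs_of_pos hb0]
    refine mul_le_mul_of_nonneg_left ?_ hκ
    calc β ≤ (4 * β) ^ 1 := by linarith
      _ ≤ _ := pow_le_pow_right₀ one4 (by norm_num)
  have c2 : |-κ * β * (β + 1)| ≤ |κ| * (4 * β) ^ 4 := by
    rw [abs_mul, abs_mul, abs_neg, abs_of_pos hb0, abs_of_pos (by linarith : 0 < β + 1), mul_assoc]
    refine mul_le_mul_of_nonneg_left ?_ hκ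
    calc β * (β + 1) ≤ (4 * β) * (4 * β) := by gcongr
      _ = (4 * β) ^ 2 := by ring
      _ ≤ _ := pow_le_pow_right₀ one4 (by norm_num)
  have c3 : |κ * β * (β + 1) * (β + 2)| ≤ |κ| * (4 * β) ^ 4 := by
    rw [abs_mul, abs_mul, abs_mul, abs_of_pos hb0, abs_of_pos (by linarith : 0 < β + 1),
      abs_of_pos (by linarith : 0 < β + 2), mul_assoc, mul_assoc]
    refine mul_le_mul_of_nonneg_left ?_ hκ
    calc β * ((β + 1) * (β + 2)) ≤ (4 * β) * ((4 * β) * (4 * β)) := by gcongr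
      _ = (4 * β) ^ 3 := by ring
      _ ≤ _ := pow_le_pow_right₀ one4 (by norm_num)
  have c4 : |-κ * β * (β + 1) * (β + 2) * (β + 3)| ≤ |κ| * (4 * β) ^ 4 := by
    rw [abs_mul, abs_mul, abs_mul, abs_mul, abs_neg, abs_of_pos hb0,
      abs_of_pos (by linarith : 0 < β + 1),
      abs_of_pos (by linarith : 0 < β + 2), abs_of_pos (by linarith : 0 < β + 3),
      mul_assoc, mul_assoc, mul_assoc]
    refine mul_le_mul_of_nonneg_left ?_ hκ
    calc β * ((β + 1) * ((β + 2) * (β + 3))) ≤ (4 * β) * ((4 * β) * ((4 * β) * (4 * β))) := by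
          gcongr
      _ = (4 * β) ^ 4 := by ring
  refine ⟨?_, hε1, fun t ht => hasDerivAt_powerPert κ β (hpos ht), fun t ht => ?_, fun t ht => ?_,
    fun t ht => ?_, hbound _ _ c1 (by norm_num) (by norm_num),
    hbound _ _ c2 (by norm_num) (by norm_num), hbound _ _ c3 (by norm_num) (by norm_num),
    hbound _ _ c4 (by norm_num) (by norm_num)⟩
  · unfold powerPert
    fun_prop
  · refine (hasDerivAt_const_mul_rpow (κ * β) (-β - 1) (hpos ht)).congr_deriv ?_
    rw [show -β - 1 - 1 = -β - 2 by ring]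
    ring
  · refine (hasDerivAt_const_mul_rpow (-κ * β * (β + 1)) (-β - 2) (hpos ht)).congr_deriv ?_
    rw [show -β - 2 - 1 = -β - 3 by ring]
    ring
  · refine (hasDerivAt_const_mul_rpow (κ * β * (β + 1) * (β + 2)) (-β - 3)
      (hpos ht)).congr_deriv ?_
    rw [show -β - 3 - 1 = -β - 4 by ring]
    ring

lemma lower_bound_of_bBeta_le {β : ℝ} {m : ℤ} (hβ : 1 < β) (hm : bBeta β ≤ m) :
    100 * β - 1 < (m : ℝ) := by
  have h1 : β ≤ β ^ 100 := le_self_pow₀ hβ.le (by norm_num)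
  have h2 : 100 * β ^ 100 < (⌊100 * β ^ 100⌋ : ℝ) + 1 := Int.lt_floor_add_one _
  have h3 : ((⌊100 * β ^ 100⌋ : ℤ) : ℝ) ≤ (m : ℝ) := by exact_mod_cast hm
  linarith

/-- As a power of two the left side is at most 2^{36+9β-m}, and m > 100β - 1 leaves room for
2^{-m/8}, the strip width used for small j. -/
lemma perturbation_size_le {β : ℝ} {m : ℤ} (hβ : 1 < β) (hm : bBeta β ≤ m) :
    400 * ((2 : ℝ) ^ (-m - 1) * (4 * β) ^ 4 * 32 ^ (β + 4)) ≤ (2 : ℝ) ^ (-(m : ℝ) / 8) := by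
  have hmβ := lower_bound_of_bBeta_le hβ hm
  have hβ2 : β ≤ 2 ^ β := by
    have := one_add_mul_self_le_rpow_one_add (s := 1) (by norm_num) hβ.le
    norm_num at this
    linarith
  have e1 : (4 * β) ^ 4 ≤ (2 : ℝ) ^ (8 + 4 * β) := by
    calc (4 * β) ^ 4 ≤ (4 * 2 ^ β) ^ 4 := by gcongr
      _ = 2 ^ (8 : ℝ) * (2 ^ β) ^ 4 := by norm_num; ring
      _ = _ := by
        rw [← Real.rpow_natCast (2 ^ β), ← Real.rpow_mul (by norm_num),
          ← Real.rpow_add (by norm_num)]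
        congr 1
        push_cast
        ring
  have e2 : (32 : ℝ) ^ (β + 4) = 2 ^ (5 * β + 20) := by
    rw [show (32 : ℝ) = 2 ^ (5 : ℝ) by norm_num, ← Real.rpow_mul (by norm_num)]
    congr 1
    ring
  have e3 : (2 : ℝ) ^ (-m - 1) = 2 ^ (-(m : ℝ) - 1) := by
    rw [← Real.rpow_intCast]
    push_cast
    rfl
  have e4 : (400 : ℝ) ≤ 2 ^ (9 : ℝ) := by norm_num
  rw [e2, e3]
  calc 400 * ((2 : ℝ) ^ (-(m : ℝ) - 1) * (4 * β) ^ 4 * 2 ^ (5 * β + 20)) ≤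
      2 ^ (9 : ℝ) * ((2 : ℝ) ^ (-(m : ℝ) - 1) * 2 ^ (8 + 4 * β) * 2 ^ (5 * β + 20)) := by gcongr
    _ = 2 ^ (9 + ((-(m : ℝ) - 1) + (8 + 4 * β) + (5 * β + 20))) := by
        rw [← Real.rpow_add (by norm_num), ← Real.rpow_add (by norm_num),
          ← Real.rpow_add (by norm_num)]
    _ ≤ _ := Real.rpow_le_rpow_of_exponent_le (by norm_num) (by linarith)

lemma exists_smallPhase {β : ℝ} {m : ℤ} (hβ : 1 < β) (hm : bBeta β ≤ m) {κ : ℝ}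
    (hκ : |κ| = (2 : ℝ) ^ (-m - 1)) :
    ∃ ε, 400 * ε ≤ (2 : ℝ) ^ (-(m : ℝ) / 8) ∧ ∃ w₂ w₃ w₄ : ℝ → ℝ,
      SmallPhase ε (powerPert κ β) (powerPertDeriv κ β) w₂ w₃ w₄ := by
  have h := perturbation_size_le hβ hm
  rw [← hκ] at h
  refine ⟨_, h, _, _, _, smallPhase_powerPert hβ le_rfl ?_⟩
  have hmβ := lower_bound_of_bBeta_le hβ hm
  have : (2 : ℝ) ^ (-(m : ℝ) / 8) ≤ 2 ^ (-2 : ℝ) :=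
    Real.rpow_le_rpow_of_exponent_le (by norm_num) (by linarith)
  have e : (2 : ℝ) ^ (-2 : ℝ) = 1 / 4 := by
    rw [Real.rpow_neg (by norm_num)]; norm_num
  linarith

/-! ### Choice of exponents and exponential gain. -/

/-- The trilinear bound for the kernel with critical points, with exponential gain. -/
theorem exists_trilinearBound {β : ℝ} (hβ : 1 < β) :
    ∃ ε₀ : ℝ, 0 < ε₀ ∧ ∃ C : ℝ, 0 < C ∧ ∀ (j : ℕ) (m : ℤ), bBeta β ≤ m → ∀ κ lam : ℝ,
      |κ| = (2 : ℝ) ^ (-m - 1) → |lam| = (2 : ℝ) ^ (β * j + m + 1) →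
        TrilinearBound (phaseKernel (powerPert κ β) (powerPertDeriv κ β)
          (critDomain (powerPertDeriv κ β)) lam) ((2 : ℝ) ^ (-(j : ℤ)))
          (C * 2 ^ (-(ε₀ * ((j : ℝ) + (m : ℝ))))) := by
  -- The midpoint of 1/β and 1: p < 1 keeps the singularity integrable, and pβ > 1 beats the loss
  -- s⁻¹ = 2^j.
  set p : ℝ := (1 + 1 / β) / 2 with hp
  have hβ0 : 0 < β := by linarith
  have hinv : 1 / β < 1 := by rw [div_lt_one hβ0]; exact hβ
  have hinv0 : 0 < 1 / β := by positivity
  have hp0 : 1 / 2 ≤ p := by rw [hp]; linarith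
  have hp1 : p < 1 := by rw [hp]; linarith
  have hpβ : p * β = (β + 1) / 2 := by rw [hp]; field_simp
  set W := (∫ v, singularWeight p (2 * 5) v) ^ 2 with hW
  have hW0 : 0 ≤ W := sq_nonneg _
  -- The gain in j is (pβ - 1)/4 = (β - 1)/8; the gain 1/16 in m is dictated by the strip, where
  -- (δ²)^{1/4} = 2^{-m/16}.
  set ε₀ := min ((β - 1) / 8) (1 / 16) with hε₀
  have hε1 : ε₀ ≤ (β - 1) / 8 := min_le_left _ _
  have hε2 : ε₀ ≤ 1 / 16 := min_le_right _ _
  have hε0 : 0 < ε₀ := lt_min (by linarith) (by norm_num)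
  set C₁ := (60000 * ((7 / 16 : ℝ) ^ 2) ^ (-p) * W) ^ (1 / 4 : ℝ) with hC₁
  -- The factor 4 = 2² absorbs the bounded powers of two that occur for j ≤ 1.
  set C₂ := 4 * (2 * (60000 * W) ^ (1 / 4 : ℝ) + 40 ^ (1 / 4 : ℝ)) with hC₂
  have hC₁0 : 0 ≤ C₁ := by positivity
  have hC₂0 : 0 < C₂ := by positivity
  refine ⟨ε₀, hε0, C₁ + C₂, by positivity, fun j m hm κ lam hκ hlam => ?_⟩
  obtain ⟨ε, hε, w₂, w₃, w₄, h⟩ := exists_smallPhase hβ hm hκ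
  have hmβ := lower_bound_of_bBeta_le hβ hm
  have hm0 : (0 : ℝ) ≤ m := by linarith
  have hj0 : (0 : ℝ) ≤ j := j.cast_nonneg
  have hlam0 : lam ≠ 0 := by
    rw [← abs_pos, hlam]
    positivity
  have two0 : (0 : ℝ) < 2 := two_pos
  set s : ℝ := (2 : ℝ) ^ (-(j : ℤ)) with hs
  have hsr : s = 2 ^ (-(j : ℝ)) := by
    rw [hs, ← Real.rpow_intCast]
    push_cast
    rfl
  have hs0 : 0 < s := by rw [hsr]; positivity
  have hsinv : s⁻¹ = 2 ^ (j : ℝ) := by rw [hsr, ← Real.rpow_neg two0.le, neg_neg]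
  have hs1 : s ≤ 1 := by
    rw [hsr]; exact Real.rpow_le_one_of_one_le_of_nonpos (by norm_num) (by linarith)
  set g : ℝ := 2 ^ (-(ε₀ * ((j : ℝ) + (m : ℝ)))) with hg
  have hg0 : 0 < g := by positivity
  rcases le_or_gt 2 j with hj | hj
  · have hj2 : (2 : ℝ) ≤ j := by exact_mod_cast hj
    have hs4 : s ≤ 1 / 4 := by
      rw [hsr]
      calc (2 : ℝ) ^ (-(j : ℝ)) ≤ 2 ^ (-2 : ℝ) :=
            Real.rpow_le_rpow_of_exponent_le (by norm_num) (by linarith)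
        _ = 1 / 4 := by rw [Real.rpow_neg (by norm_num)]; norm_num
    refine (h.trilinearBound_of_le_quarter hs0 hs4 hlam0 (by linarith : 0 ≤ p) hp1).mono ?_
    have e : 60000 * (|lam| * (7 / 16 : ℝ) ^ 2) ^ (-p) * W * s⁻¹ =
        60000 * ((7 / 16 : ℝ) ^ 2) ^ (-p) * W * 2 ^ (-p * (β * j + m + 1) + j) := by
      rw [hlam, hsinv, Real.mul_rpow (by positivity) (by positivity), ← Real.rpow_mul two0.le,
        Real.rpow_add two0, mul_comm (-p)]
      ring
    rw [e, Real.mul_rpow (by positivity) (by positivity), ← Real.rpow_mul two0.le,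
      add_mul C₁ C₂ g]
    have hC₂g : 0 ≤ C₂ * g := by positivity
    refine le_trans ?_ (le_add_of_nonneg_right hC₂g)
    refine mul_le_mul_of_nonneg_left ?_ hC₁0
    refine Real.rpow_le_rpow_of_exponent_le (by norm_num) ?_
    have a1 : ε₀ * j ≤ (β - 1) / 8 * j := mul_le_mul_of_nonneg_right hε1 hj0
    have a2 : ε₀ * m ≤ 1 / 16 * m := mul_le_mul_of_nonneg_right hε2 hm0
    have a3 : 1 / 2 * (m : ℝ) ≤ p * m := mul_le_mul_of_nonneg_right hp0 hm0
    have a4 : p * (β * j) = (β + 1) / 2 * j := by rw [← mul_assoc, hpβ]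
    linarith
  -- Now s is 1 or 1/2 and 1 - 4sT vanishes at T = 1/4 or T = 1/2, inside the critical interval, so
  -- the strip is needed.
  · have hj1 : (j : ℝ) ≤ 1 := by exact_mod_cast Nat.le_of_lt_succ hj
    refine (h.trilinearBound_with_strip hs0 hs1 (Real.rpow_pos_of_pos two0 _) hε hlam0
      (by linarith : 0 ≤ p) hp1).mono ?_
    set δ : ℝ := 2 ^ (-(m : ℝ) / 8) with hδ
    have hδ2 : δ ^ 2 = 2 ^ (-(m : ℝ) / 4) := by
      rw [hδ, ← Real.rpow_natCast, ← Real.rpow_mul two0.le]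
      congr 1
      push_cast
      ring
    have hδ4 : (δ / 4) ^ 2 = 2 ^ (-(m : ℝ) / 4 - 4) := by
      rw [div_pow, hδ2, Real.rpow_sub two0]
      norm_num
    have a1 : ε₀ * (j + m) ≤ 1 / 16 * (1 + m) := by
      refine mul_le_mul hε2 (by linarith) (by positivity) (by norm_num)
    have hgle : 2 ^ (2 : ℝ) * g = 2 ^ (2 - ε₀ * (j + m)) := by
      rw [hg, ← Real.rpow_add two0]
      rfl
    have e : (60000 * (|lam| * (δ / 4) ^ 2) ^ (-p) * W * s⁻¹) ^ (1 / 4 : ℝ) ≤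
        (60000 * W) ^ (1 / 4 : ℝ) * (4 * g) := by
      have : 60000 * (|lam| * (δ / 4) ^ 2) ^ (-p) * W * s⁻¹ =
          60000 * W * 2 ^ ((β * j + m + 1 + (-(m : ℝ) / 4 - 4)) * (-p) + j) := by
        rw [hlam, hsinv, hδ4, ← Real.rpow_add two0, ← Real.rpow_mul two0.le, Real.rpow_add two0]
        ring
      rw [this, Real.mul_rpow (by positivity) (by positivity), ← Real.rpow_mul two0.le]
      refine mul_le_mul_of_nonneg_left ?_ (by positivity)
      rw [show (4 : ℝ) * g = 2 ^ (2 : ℝ) * g by norm_num, hgle]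
      refine Real.rpow_le_rpow_of_exponent_le (by norm_num) ?_
      have a3 : 1 / 2 * (m : ℝ) ≤ p * m := mul_le_mul_of_nonneg_right hp0 hm0
      have a4 : 0 ≤ p * (β * j) := by positivity
      linarith
    have e' : (40 * δ ^ 2 * s⁻¹ ^ 2) ^ (1 / 4 : ℝ) ≤ 40 ^ (1 / 4 : ℝ) * (4 * g) := by
      have : 40 * δ ^ 2 * s⁻¹ ^ 2 = 40 * 2 ^ (-(m : ℝ) / 4 + 2 * j) := by
        rw [hδ2, hsinv, Real.rpow_add two0, mul_comm 2 (j : ℝ), Real.rpow_mul two0.le]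
        norm_num
        ring
      rw [this, Real.mul_rpow (by positivity) (by positivity), ← Real.rpow_mul two0.le]
      refine mul_le_mul_of_nonneg_left ?_ (by positivity)
      rw [show (4 : ℝ) * g = 2 ^ (2 : ℝ) * g by norm_num, hgle]
      refine Real.rpow_le_rpow_of_exponent_le (by norm_num) ?_
      linarith
    calc _ ≤ 2 * ((60000 * W) ^ (1 / 4 : ℝ) * (4 * g)) + 40 ^ (1 / 4 : ℝ) * (4 * g) := by
          gcongr
      _ = C₂ * g := by rw [hC₂]; ring
      _ ≤ _ := by
          rw [add_mul]
          exact le_add_of_nonneg_left (by positivity)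

/-! ### Reduction of the oscillatory form to the model kernels. -/

lemma phiHat_eq_zero {Θ : 𝓢(ℝ, ℂ)} (hΘ : IsCutoff Θ) {x : ℝ} (hx : |x| ≤ 1 / 2 ∨ 2 ≤ |x|) :
    phiHat Θ x = 0 := by
  unfold phiHat
  rcases hx with hx | hx
  · rw [hΘ.eq_one x hx, hΘ.eq_one (x / 2), sub_self]
    rw [abs_div, abs_two]
    linarith [abs_nonneg x]
  · have key : ∀ y : ℝ, 1 ≤ |y| → Θ y = 0 := fun y hy => by
      by_contra hne
      have := hΘ.support_subset hne
      exact absurd (abs_lt.2 this) (not_lt.2 hy)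
    rw [key x (by linarith), key (x / 2), sub_self]
    rw [abs_div, abs_two]
    linarith

lemma exists_phiHat_bound (Θ : 𝓢(ℝ, ℂ)) : ∃ M : ℝ, 0 ≤ M ∧ ∀ x, ‖phiHat Θ x‖ ≤ M := by
  obtain ⟨C, hC⟩ := Θ.decay 0 0
  have hC' : ∀ x, ‖Θ x‖ ≤ C := fun x => by simpa using hC.2 x
  have h0 : 0 ≤ C := (norm_nonneg _).trans (hC' 0)
  exact ⟨C + C, by positivity, fun x => (norm_sub_le _ _).trans (add_le_add (hC' _) (hC' _))⟩

lemma continuous_phiHat (Θ : 𝓢(ℝ, ℂ)) : Continuous (phiHat Θ) := by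
  have := Θ.continuous
  unfold phiHat
  fun_prop

lemma phase8_eq (β : ℝ) (m : ℤ) (ξ η t : ℝ) :
    phase8 β m ξ η t = ξ * t + η * t ^ 2 + powerPert ((2 : ℝ) ^ (-m - 1)) β t := by
  unfold phase8 powerPert
  ring

lemma deriv_phase8 (β : ℝ) (m : ℤ) (ξ η : ℝ) {t : ℝ} (ht : 0 < t) :
    deriv (phase8 β m ξ η) t = ξ + 2 * η * t + powerPertDeriv ((2 : ℝ) ^ (-m - 1)) β t := by
  have h := (((hasDerivAt_id t).const_mul ξ).add (((hasDerivAt_id t).pow 2).const_mul η)).add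
    (hasDerivAt_powerPert ((2 : ℝ) ^ (-m - 1)) β ht)
  have h' : HasDerivAt (phase8 β m ξ η)
      (ξ + 2 * η * t + powerPertDeriv ((2 : ℝ) ^ (-m - 1)) β t) t := by
    have e : phase8 β m ξ η = fun t => ξ * id t + η * id t ^ 2 +
        powerPert ((2 : ℝ) ^ (-m - 1)) β t := funext fun t => phase8_eq β m ξ η t
    rw [e]
    refine h.congr_deriv ?_
    simp only [id]
    push_cast
    ring
  exact h'.deriv

section critical

variable {β ε σ : ℝ} {m : ℤ} {w₂ w₃ w₄ : ℝ → ℝ} {p : ℝ × ℝ}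

/-- The critical points of `phase8` with sign `σ` of `η`, in terms of `critRoot`. -/
lemma deriv_phase8_eq_zero_iff (hσ : σ * σ = 1) {t : ℝ} (ht : 0 < t) :
    deriv (phase8 β m p.1 p.2) t = 0 ↔
      σ * p.1 + 2 * (σ * p.2) * t + powerPertDeriv (σ * (2 : ℝ) ^ (-m - 1)) β t = 0 := by
  rw [deriv_phase8 β m p.1 p.2 ht]
  have hσ0 : σ ≠ 0 := fun h => by simp [h] at hσ
  have : σ * p.1 + 2 * (σ * p.2) * t + powerPertDeriv (σ * (2 : ℝ) ^ (-m - 1)) β t =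
      σ * (p.1 + 2 * p.2 * t + powerPertDeriv ((2 : ℝ) ^ (-m - 1)) β t) := by
    unfold powerPertDeriv
    ring
  rw [this, mul_eq_zero, or_iff_right hσ0]

lemma critRoot_of_critical (h : SmallPhase ε (powerPert (σ * (2 : ℝ) ^ (-m - 1)) β)
      (powerPertDeriv (σ * (2 : ℝ) ^ (-m - 1)) β) w₂ w₃ w₄)
    (hσ : σ * σ = 1) (hη : σ * p.2 ∈ Icc (1 / 2 : ℝ) 2) {t : ℝ}
    (ht : t ∈ Icc (1 / 16 : ℝ) (9 / 16)) (h0 : deriv (phase8 β m p.1 p.2) t = 0) :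
    critRoot (powerPertDeriv (σ * (2 : ℝ) ^ (-m - 1)) β) (σ * p.1) (σ * p.2) = t :=
  h.critRoot_eq (by linarith [hη.1]) ⟨by linarith [ht.1], by linarith [ht.2]⟩
    ((deriv_phase8_eq_zero_iff hσ (by linarith [ht.1])).1 h0)

/-- Uniqueness is automatic, since σ times the t-derivative of the phase is strictly increasing
there. The sign σ = ±1 moves η to the positive side and flips the perturbation. -/
lemma hasCritPt_iff (h : SmallPhase ε (powerPert (σ * (2 : ℝ) ^ (-m - 1)) β)
      (powerPertDeriv (σ * (2 : ℝ) ^ (-m - 1)) β) w₂ w₃ w₄)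
    (hσ : σ * σ = 1) (hη : σ * p.2 ∈ Icc (1 / 2 : ℝ) 2) :
    HasCritPt β m p.1 p.2 ↔
      σ • p ∈ critDomain (powerPertDeriv (σ * (2 : ℝ) ^ (-m - 1)) β) := by
  constructor
  · rintro ⟨t, ⟨ht, h0⟩, _⟩
    refine ⟨hη, ?_⟩
    simp only [Prod.smul_fst, Prod.smul_snd, smul_eq_mul]
    rwa [critRoot_of_critical h hσ hη ht h0]
  · intro hD
    have hT := hD.2
    have h0 := h.critRoot_zero' hD
    simp only [Prod.smul_fst, Prod.smul_snd, smul_eq_mul] at hT h0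
    refine ⟨_, ⟨hT, (deriv_phase8_eq_zero_iff hσ (by linarith [hT.1])).2 h0⟩, ?_⟩
    rintro t ⟨ht, ht0⟩
    exact (critRoot_of_critical h hσ hη ht ht0).symm

lemma phase8_critPt (h : SmallPhase ε (powerPert (σ * (2 : ℝ) ^ (-m - 1)) β)
      (powerPertDeriv (σ * (2 : ℝ) ^ (-m - 1)) β) w₂ w₃ w₄)
    (hσ : σ * σ = 1) (hη : σ * p.2 ∈ Icc (1 / 2 : ℝ) 2) (hc : HasCritPt β m p.1 p.2) :
    phase8 β m p.1 p.2 (critPt β m p.1 p.2) =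
      σ * critPhase (powerPert (σ * (2 : ℝ) ^ (-m - 1)) β)
        (powerPertDeriv (σ * (2 : ℝ) ^ (-m - 1)) β) (σ * p.1) (σ * p.2) := by
  have hspec := hc.choose_spec.1
  have e : critPt β m p.1 p.2 = hc.choose := by
    unfold critPt
    rw [dif_pos hc]
  have e2 := critRoot_of_critical h hσ hη hspec.1 hspec.2
  rw [phase8_eq, critPhase, e2, e]
  unfold powerPert
  linear_combination (-(p.1 * hc.choose + p.2 * hc.choose ^ 2 +
    -(2 : ℝ) ^ (-m - 1) * |hc.choose| ^ (-β))) * hσ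

end critical

/-- The kernel of the trilinear form, written with the two signs of `η`. -/
noncomputable def critKernel (β : ℝ) (m : ℤ) (lam : ℝ) (p : ℝ × ℝ) : ℂ :=
  phaseKernel (powerPert ((2 : ℝ) ^ (-m - 1)) β) (powerPertDeriv ((2 : ℝ) ^ (-m - 1)) β)
    (critDomain (powerPertDeriv ((2 : ℝ) ^ (-m - 1)) β)) lam p +
  phaseKernel (powerPert (-(2 : ℝ) ^ (-m - 1)) β) (powerPertDeriv (-(2 : ℝ) ^ (-m - 1)) β)
    (critDomain (powerPertDeriv (-(2 : ℝ) ^ (-m - 1)) β)) (-lam) (-p)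

section kernel

variable {β ε ε' : ℝ} {m : ℤ} {w₂ w₃ w₄ w₂' w₃' w₄' : ℝ → ℝ}

/-- The sign of η selects the summand that can be nonzero, and the reflected phase changes sign
together with λ. Agreement for 1/2 ≤ |η| ≤ 2 is enough because Φ̂(η) vanishes elsewhere. -/
lemma critKernel_eq
    (h : SmallPhase ε (powerPert ((2 : ℝ) ^ (-m - 1)) β)
      (powerPertDeriv ((2 : ℝ) ^ (-m - 1)) β) w₂ w₃ w₄)
    (h' : SmallPhase ε' (powerPert (-(2 : ℝ) ^ (-m - 1)) β)
      (powerPertDeriv (-(2 : ℝ) ^ (-m - 1)) β) w₂' w₃' w₄')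
    (lam : ℝ) {p : ℝ × ℝ} (hp : |p.2| ∈ Icc (1 / 2 : ℝ) 2) :
    critKernel β m lam p = (critRegion β m).indicator (fun p => Complex.exp (Complex.I *
      ((lam * phase8 β m p.1 p.2 (critPt β m p.1 p.2) : ℝ) : ℂ))) p := by
  rcases le_or_gt 0 p.2 with hpos | hneg
  · rw [abs_of_nonneg hpos] at hp
    have hη : (1 : ℝ) * p.2 ∈ Icc (1 / 2 : ℝ) 2 := by rwa [one_mul]
    have hz : phaseKernel (powerPert (-(2 : ℝ) ^ (-m - 1)) β)
        (powerPertDeriv (-(2 : ℝ) ^ (-m - 1)) β)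
        (critDomain (powerPertDeriv (-(2 : ℝ) ^ (-m - 1)) β)) (-lam) (-p) = 0 := by
      by_contra hne
      have := (SmallPhase.mem_of_phaseKernel_ne_zero hne).1.1
      rw [Prod.snd_neg] at this
      linarith
    rw [critKernel, hz, add_zero]
    rw [← one_mul ((2 : ℝ) ^ (-m - 1))] at h ⊢
    have hiff := hasCritPt_iff h (one_mul 1) hη
    rw [one_smul] at hiff
    by_cases hc : HasCritPt β m p.1 p.2
    · rw [indicator_of_mem (show p ∈ critRegion β m from hc), phaseKernel,
        indicator_of_mem (hiff.1 hc), phase8_critPt h (one_mul 1) hη hc]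
      simp only [one_mul]
    · rw [indicator_of_notMem (show p ∉ critRegion β m from hc), phaseKernel,
        indicator_of_notMem (fun hh => hc (hiff.2 hh))]
  · rw [abs_of_neg hneg] at hp
    have hη : (-1 : ℝ) * p.2 ∈ Icc (1 / 2 : ℝ) 2 := by rwa [neg_one_mul]
    have hz : phaseKernel (powerPert ((2 : ℝ) ^ (-m - 1)) β)
        (powerPertDeriv ((2 : ℝ) ^ (-m - 1)) β)
        (critDomain (powerPertDeriv ((2 : ℝ) ^ (-m - 1)) β)) lam p = 0 := by
      by_contra hne
      have := (SmallPhase.mem_of_phaseKernel_ne_zero hne).1.1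
      linarith
    rw [critKernel, hz, zero_add]
    rw [← neg_one_mul ((2 : ℝ) ^ (-m - 1))] at h' ⊢
    have hσ : (-1 : ℝ) * (-1) = 1 := by norm_num
    have hiff := hasCritPt_iff h' hσ hη
    rw [neg_one_smul] at hiff
    by_cases hc : HasCritPt β m p.1 p.2
    · rw [indicator_of_mem (show p ∈ critRegion β m from hc), phaseKernel,
        indicator_of_mem (hiff.1 hc), phase8_critPt h' hσ hη hc]
      simp only [neg_mul, one_mul, Prod.fst_neg, Prod.snd_neg, mul_neg]
    · rw [indicator_of_notMem (show p ∉ critRegion β m from hc), phaseKernel,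
        indicator_of_notMem (fun hh => hc (hiff.2 hh))]

/-- At λ = 0 the kernel is the indicator of the region, so its measurability gives that of the set
without unfolding the existence of a critical point. -/
lemma measurableSet_critRegion_inter
    (h : SmallPhase ε (powerPert ((2 : ℝ) ^ (-m - 1)) β)
      (powerPertDeriv ((2 : ℝ) ^ (-m - 1)) β) w₂ w₃ w₄)
    (h' : SmallPhase ε' (powerPert (-(2 : ℝ) ^ (-m - 1)) β)
      (powerPertDeriv (-(2 : ℝ) ^ (-m - 1)) β) w₂' w₃' w₄') :
    MeasurableSet (critRegion β m ∩ {p : ℝ × ℝ | |p.2| ∈ Icc (1 / 2 : ℝ) 2}) := by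
  have e : critRegion β m ∩ {p : ℝ × ℝ | |p.2| ∈ Icc (1 / 2 : ℝ) 2} =
      {p : ℝ × ℝ | |p.2| ∈ Icc (1 / 2 : ℝ) 2} ∩ {p | critKernel β m 0 p ≠ 0} := by
    ext p
    rw [inter_comm]
    refine and_congr_right fun hp => ?_
    simp only [mem_ofPred_eq, critKernel_eq h h' 0 hp]
    by_cases hc : p ∈ critRegion β m
    · simp [hc]
    · simp [hc]
  rw [e]
  refine MeasurableSet.inter ?_ ?_
  · exact measurableSet_Icc.preimage (continuous_abs.comp continuous_snd).measurable
  · have hm : Measurable (critKernel β m 0) :=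
      (h.measurable_phaseKernel h.isClosed_critDomain.measurableSet _).add
        ((h'.measurable_phaseKernel h'.isClosed_critDomain.measurableSet _).comp measurable_neg)
    exact hm (measurableSet_singleton 0).compl

lemma bddSupp_critKernel
    (h : SmallPhase ε (powerPert ((2 : ℝ) ^ (-m - 1)) β)
      (powerPertDeriv ((2 : ℝ) ^ (-m - 1)) β) w₂ w₃ w₄)
    (h' : SmallPhase ε' (powerPert (-(2 : ℝ) ^ (-m - 1)) β)
      (powerPertDeriv (-(2 : ℝ) ^ (-m - 1)) β) w₂' w₃' w₄') (lam : ℝ) :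
    BddSupp (critKernel β m lam) ∧
      ∀ p, critKernel β m lam p ≠ 0 → |p.1| ≤ 3 ∧ |p.2| ≤ 2 := by
  have hsupp : ∀ p, critKernel β m lam p ≠ 0 → |p.1| ≤ 3 ∧ |p.2| ≤ 2 := fun p hp => by
    rcases ne_or_eq (phaseKernel (powerPert ((2 : ℝ) ^ (-m - 1)) β)
      (powerPertDeriv ((2 : ℝ) ^ (-m - 1)) β)
      (critDomain (powerPertDeriv ((2 : ℝ) ^ (-m - 1)) β)) lam p) 0 with h1 | h1
    · have hD := SmallPhase.mem_of_phaseKernel_ne_zero h1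
      have h2 := h.fst_mem hD
      have h3 := hD.1
      exact ⟨abs_le.2 ⟨by linarith [h2.1], by linarith [h2.2]⟩,
        abs_le.2 ⟨by linarith [h3.1], by linarith [h3.2]⟩⟩
    · rw [critKernel, h1, zero_add] at hp
      have hD := SmallPhase.mem_of_phaseKernel_ne_zero hp
      have h2 := h'.fst_mem hD
      have h3 := hD.1
      rw [Prod.fst_neg] at h2
      rw [Prod.snd_neg] at h3
      exact ⟨abs_le.2 ⟨by linarith [h2.2], by linarith [h2.1]⟩,
        abs_le.2 ⟨by linarith [h3.2], by linarith [h3.1]⟩⟩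
  refine ⟨⟨?_, ⟨1 + 1, by norm_num, fun p => ?_⟩, ⟨3, fun p hp => ?_⟩⟩, hsupp⟩
  · exact (h.measurable_phaseKernel h.isClosed_critDomain.measurableSet _).add
        ((h'.measurable_phaseKernel h'.isClosed_critDomain.measurableSet _).comp measurable_neg)
  · exact (norm_add_le _ _).trans (add_le_add (SmallPhase.norm_phaseKernel_le _ _ _)
      (SmallPhase.norm_phaseKernel_le _ _ _))
  · obtain ⟨a, b⟩ := hsupp p hp
    rw [Prod.norm_def]
    exact max_le a (le_trans b (by norm_num))

end kernel

lemma memLp_mul_phiHat {Θ : 𝓢(ℝ, ℂ)} {M : ℝ} (hM : ∀ x, ‖phiHat Θ x‖ ≤ M) {q : ENNReal}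
    {f : ℝ → ℂ} (hf : MemLp f q) :
    MemLp (fun x => f x * phiHat Θ x) q ∧
      (eLpNorm (fun x => f x * phiHat Θ x) q volume).toReal ≤
        M * (eLpNorm f q volume).toReal := by
  have hle : ∀ x, ‖f x * phiHat Θ x‖ ≤ M * ‖f x‖ := fun x => by
    rw [norm_mul, mul_comm]
    exact mul_le_mul_of_nonneg_right (hM x) (norm_nonneg _)
  have hM0 : 0 ≤ M := (norm_nonneg _).trans (hM 0)
  refine ⟨hf.of_le_mul (hf.1.mul (continuous_phiHat Θ).aestronglyMeasurable)
    (ae_of_all _ hle), ?_⟩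
  have h1 := eLpNorm_le_mul_eLpNorm_of_ae_le_mul (μ := volume) (ae_of_all _ hle) q
  have h2 := ENNReal.toReal_mono (ENNReal.mul_ne_top ENNReal.ofReal_ne_top hf.2.ne) h1
  rwa [ENNReal.toReal_mul, ENNReal.toReal_ofReal hM0] at h2

theorem mainTheorem5 (Θ : 𝓢(ℝ, ℂ)) (hΘ : IsCutoff Θ) (β : ℝ) (hβ : 1 < β) :
    ∃ ε₀ : ℝ, 0 < ε₀ ∧ ∃ C : ℝ, 0 < C ∧
      ∀ (j : ℕ) (m : ℤ), bBeta β ≤ m →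
        ∀ f₁ f₂ f₃ : ℝ → ℂ, MemLp f₁ 4 volume → MemLp f₂ 2 volume → MemLp f₃ 2 volume →
          IntegrableOn (integrand8 Θ β j m f₁ f₂ f₃) (critRegion β m) volume ∧
          ‖trilinearForm8 Θ β j m f₁ f₂ f₃‖ ≤
            C * (2 : ℝ) ^ (-(ε₀ * ((j : ℝ) + (m : ℝ)))) *
              ((eLpNorm f₁ 4 volume).toReal * (eLpNorm f₂ 2 volume).toReal *
                (eLpNorm f₃ 2 volume).toReal) := by
  obtain ⟨ε₀, hε₀, C, hC, hbound⟩ := exists_trilinearBound hβ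
  obtain ⟨M, hM0, hM⟩ := exists_phiHat_bound Θ
  -- The factor 2 counts the two signs of η; M² + 1 keeps the constant positive even when M = 0.
  refine ⟨ε₀, hε₀, 2 * C * (M ^ 2 + 1), by positivity, fun j m hm f₁ f₂ f₃ h₁ h₂ h₃ => ?_⟩
  set lam : ℝ := (2 : ℝ) ^ (β * j + m + 1) with hlam
  have hlam0 : 0 < lam := by positivity
  have hκ0 : (0 : ℝ) < (2 : ℝ) ^ (-m - 1) := by positivity
  have hκ1 : |(2 : ℝ) ^ (-m - 1)| = (2 : ℝ) ^ (-m - 1) := abs_of_pos hκ0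
  have hκ2 : |-(2 : ℝ) ^ (-m - 1)| = (2 : ℝ) ^ (-m - 1) := by rw [abs_neg, hκ1]
  obtain ⟨ε, -, w₂, w₃, w₄, h⟩ := exists_smallPhase hβ hm hκ1
  obtain ⟨ε', -, w₂', w₃', w₄', h'⟩ := exists_smallPhase hβ hm hκ2
  set s : ℝ := (2 : ℝ) ^ (-(j : ℤ)) with hs
  have hs0 : 0 < s := by positivity
  have hs1 : s ≤ 1 := zpow_le_one_of_nonpos₀ (by norm_num) (by simp)
  set g : ℝ := 2 ^ (-(ε₀ * ((j : ℝ) + (m : ℝ)))) with hg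
  have hg0 : 0 < g := by positivity
  obtain ⟨hK, hKs⟩ := bddSupp_critKernel h h' lam
  have hKb : TrilinearBound (critKernel β m lam) s (C * g + C * g) :=
    (hbound j m hm _ lam hκ1 (abs_of_pos hlam0)).add
      (h.bddSupp_phaseKernel h.isClosed_critDomain.measurableSet subset_rfl _)
      (h'.bddSupp_phaseKernel h'.isClosed_critDomain.measurableSet subset_rfl _).comp_neg
      (hbound j m hm _ (-lam) hκ2 (by rw [abs_neg, abs_of_pos hlam0])).comp_neg
  -- The cutoffs are bounded multipliers absorbed into f₁ and f₂.
  obtain ⟨hg₁, n₁⟩ := memLp_mul_phiHat hM h₁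
  obtain ⟨hg₂, n₂⟩ := memLp_mul_phiHat hM h₂
  obtain ⟨hint, hle⟩ := hKb.norm_le (by positivity) hg₁ hg₂ h₃ hK hs0 hs1 hKs
  set K : Set (ℝ × ℝ) := {p : ℝ × ℝ | |p.2| ∈ Icc (1 / 2 : ℝ) 2} with hKdef
  have hKm : MeasurableSet K :=
    measurableSet_Icc.preimage (continuous_abs.comp continuous_snd).measurable
  have hEK := measurableSet_critRegion_inter h h'
  have hzero : ∀ x : ℝ, |x| ∉ Icc (1 / 2 : ℝ) 2 → phiHat Θ x = 0 := fun x hx => by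
    refine phiHat_eq_zero hΘ ?_
    by_contra hcon
    push Not at hcon
    exact hx ⟨hcon.1.le, hcon.2.le⟩
  -- Measurability of the critical region is established only inside K, so the integrand is first
  -- confined to K, where Φ̂(η) may be nonzero.
  have hKind : K.indicator (integrand8 Θ β j m f₁ f₂ f₃) = integrand8 Θ β j m f₁ f₂ f₃ := by
    refine indicator_eq_self.2 fun p hp => ?_
    by_contra hpK
    refine hp ?_
    simp only [integrand8, hzero p.2 hpK, mul_zero, zero_mul]
  have hEKind : (critRegion β m ∩ K).indicator (integrand8 Θ β j m f₁ f₂ f₃) =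
      fun p : ℝ × ℝ => (f₁ p.1 * phiHat Θ p.1) * (f₂ p.2 * phiHat Θ p.2) *
        f₃ (s * p.1 + p.2) * critKernel β m lam p := by
    ext p
    by_cases hpK : p ∈ K
    · rw [critKernel_eq h h' lam hpK]
      by_cases hc : p ∈ critRegion β m
      · rw [indicator_of_mem (mem_inter hc hpK), indicator_of_mem hc]
        simp only [integrand8]
        ring
      · rw [indicator_of_notMem (fun hh => hc hh.1), indicator_of_notMem hc, mul_zero]
    · rw [indicator_of_notMem (fun hh => hpK hh.2), hzero p.2 hpK]
      ring
  constructor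
  · rw [← hKind, IntegrableOn, integrable_indicator_iff hKm, IntegrableOn,
      Measure.restrict_restrict hKm, inter_comm, ← IntegrableOn, ← integrable_indicator_iff hEK,
      hEKind]
    exact hint
  · have hform : trilinearForm8 Θ β j m f₁ f₂ f₃ = trilinearForm (critKernel β m lam) s
        (fun x => f₁ x * phiHat Θ x) (fun x => f₂ x * phiHat Θ x) f₃ := by
      unfold trilinearForm8 trilinearForm
      rw [← hKind, setIntegral_indicator hKm, ← integral_indicator hEK, hEKind]
    rw [hform]
    refine hle.trans ?_
    rw [triNorm_eq_eLpNorm hg₁ hg₂ h₃]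
    set a := (eLpNorm f₁ 4 volume).toReal
    set b := (eLpNorm f₂ 2 volume).toReal
    set c := (eLpNorm f₃ 2 volume).toReal
    have ha : 0 ≤ a := ENNReal.toReal_nonneg
    have hb : 0 ≤ b := ENNReal.toReal_nonneg
    have hc : 0 ≤ c := ENNReal.toReal_nonneg
    calc _ ≤ (C * g + C * g) * ((M * a) * (M * b) * c) := by gcongr
      _ = 2 * C * M ^ 2 * g * (a * b * c) := by ring
      _ ≤ _ := by
        gcongr
        linarith
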